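/- Let $k$ be a field of characteristic $0$ and $V$ a $k$-vector space. All operads are symmetric operads with unit in $k$-vector spaces. A cyclic operad is such an operad in which the action of the symmetric groups on the inputs is extended to permutations of all entries (inputs and output), compatibly with composition. *The operad $\mathrm{Lie}$.* Its operations with $n \ge 1$ inputs are spanned by the trivalent trees with a cyclic ordering at each trivalent vertex and with $n+1$ univalent vertices, numbered by the entries (the $n$ inputs and the output), modulo the antisymmetry relation AS and the relation IHX; it has no nonzero operations with $0$ inputs. Composition glues leaves, and the cyclic structure permutes the numbers of the leaves. *The operad $\overline{\mathrm{Lie}_V}$.* Its operations with $n\ge 1$ inputs are spanned by the trivalent trees with a cyclic ordering at each trivalent vertex in which $n+1$ univalent vertices are numbered by the entries and all the other univalent vertices are labelled by elements of $V$, modulo AS, IHX and multilinearity in the labels; the space of operations with $0$ inputs is $0$. Composition glues numbered leaves, and the cyclic structure permutes the numbers. *The operad $H\mathrm{Lie}$.* Let $H=T(V)$ be the tensor algebra with its cocommutative Hopf algebra structure in which the elements of $V$ are primitive; its antipode is $S(v_1\cdots v_m)=(-1)^m v_m\cdots v_1$. Regard $H$ as an operad with operations of arity one only, with composition given by multiplication,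 and cyclic through $S$. Then $H\mathrm{Lie}$ is the quotient of the operad freely generated by $H$ and $\mathrm{Lie}$ (with the two units identified) by the operadic ideal generated by $$h\circ o-\sum o\circ(h_{(1)},\dots,h_{(n)}),\qquad h\in H,\ o\in\mathrm{Lie}\text{ with } n \text{ inputs},$$ where $\sum h_{(1)}\otimes\cdots\otimes h_{(n)}$ is the iterated coproduct of $h$. **Proposition.** There is exactly one cyclic structure on $H\mathrm{Lie}$ that extends those of $H$ and of $\mathrm{Lie}$ (along the canonical maps $H\to H\mathrm{Lie}$ and $\mathrm{Lie}\to H\mathrm{Lie}$), and with this structure $H\mathrm{Lie}$ is isomorphic to $\overline{\mathrm{Lie}_V}$ as a cyclic operad. Moreover, the isomorphism can be chosen such that it sends $v\in V\subset H$ to the line from the output to the input with one leaf labelled $v$ attached to it (the tree with one trivalent vertex whose cyclic order is: leaf $v$, input, output), and the bracket, i.e. the tree with one trivalent vertex and cyclic order (first input, second input, output), to the same tree. -/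

import Mathlib

open scoped TensorProduct

universe u v w x

/-! ## Bijections between arity sets -/

namespace ArityEquiv

/-- `(A ⊔ {∗}) ⊔ B ≃ (A ⊔ B) ⊔ {∗}`. -/
def optSumL (A B : Type) : Option A ⊕ B ≃ Option (A ⊕ B) where
  toFun
    | .inl none => none
    | .inl (some a) => some (.inl a)
    | .inr b => some (.inr b)
  invFun
    | none => .inl none
    | some (.inl a) => .inl (some a)
    | some (.inr b) => .inr b
  left_inv := by rintro ((_ | a) | b) <;> rfl
  right_inv := by rintro (_ | a | b) <;> rfl

/-- `A ⊔ (B ⊔ {∗}) ≃ (A ⊔ B) ⊔ {∗}`. -/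
def optSumR (A B : Type) : A ⊕ Option B ≃ Option (A ⊕ B) where
  toFun
    | .inl a => some (.inl a)
    | .inr none => none
    | .inr (some b) => some (.inr b)
  invFun
    | none => .inr none
    | some (.inl a) => .inl a
    | some (.inr b) => .inr (some b)
  left_inv := by rintro (a | _ | b) <;> rfl
  right_inv := by rintro (_ | a | b) <;> rfl

/-- Exchange the two added points of `A ⊔ {∗} ⊔ {∗'}`. -/
def optSwap (A : Type) : Option (Option A) ≃ Option (Option A) where
  toFun
    | none => some none
    | some none => none
    | some (some a) => some (some a)
  invFun
    | none => some none
    | some none => none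
    | some (some a) => some (some a)
  left_inv := by rintro (_ | _ | a) <;> rfl
  right_inv := by rintro (_ | _ | a) <;> rfl

/-- The one-point set as `∅ ⊔ {∗}`. -/
def unitOpt : Unit ≃ Option Empty where
  toFun _ := none
  invFun _ := ()
  left_inv _ := rfl
  right_inv := by rintro (_ | a); exacts [rfl, a.elim]

/-- `A ⊔ {∗}`, written in two ways. -/
def sumUnit (A : Type) : A ⊕ Unit ≃ Option A where
  toFun
    | .inl a => some a
    | .inr _ => none
  invFun
    | none => .inr ()
    | some a => .inl a
  left_inv := by rintro (a | _) <;> rfl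
  right_inv := by rintro (_ | a) <;> rfl

/-- Exchange the last two summands. -/
def sumSwapRight (A B C : Type) : (A ⊕ B) ⊕ C ≃ (A ⊕ C) ⊕ B where
  toFun
    | .inl (.inl a) => .inl (.inl a)
    | .inl (.inr b) => .inr b
    | .inr c => .inl (.inr c)
  invFun
    | .inl (.inl a) => .inl (.inl a)
    | .inl (.inr c) => .inr c
    | .inr b => .inl (.inr b)
  left_inv := by rintro ((a | b) | c) <;> rfl
  right_inv := by rintro ((a | c) | b) <;> rfl

/-- An arity set with a chosen element `a` split off. -/
noncomputable def splitOff {A : Type} (a : A) : A ≃ Option {x : A // x ≠ a} := by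
  classical exact (Equiv.optionSubtypeNe a).symm

/-- The bijection of entries (root and inputs) under which grafting the root of `b` (entries
`{root} ⊔ B ⊔ {∗'}`) on the input `∗` of `a` (entries `{root} ⊔ A ⊔ {∗}`) becomes grafting `a` on
`b` when the input `∗'` of `b` is declared to be the new root. -/
def rotateComp (A B : Type) : Option (A ⊕ Option B) ≃ Option (B ⊕ Option A) where
  toFun
    | none => some (.inr none)
    | some (.inl a) => some (.inr (some a))
    | some (.inr none) => none
    | some (.inr (some b)) => some (.inl b)
  invFun
    | none => some (.inr none)
    | some (.inl b) => some (.inr (some b))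
    | some (.inr none) => none
    | some (.inr (some a)) => some (.inl a)
  left_inv := by rintro (_ | a | _ | b) <;> rfl
  right_inv := by rintro (_ | b | _ | a) <;> rfl

/-- A bijection `e` of the entries `{root} ⊔ A` extended by an input `∗` that stays fixed. -/
def extendSlot {A A' : Type} (e : Option A ≃ Option A') :
    Option (Option A) ≃ Option (Option A') :=
  (optSwap A).trans ((Equiv.optionCongr e).trans (optSwap A'))

/-- A bijection `e` of the entries `{root} ⊔ A` extended by inputs `B` that stay fixed. -/
def extendSum {A A' : Type} (e : Option A ≃ Option A') (B : Type) :
    Option (A ⊕ B) ≃ Option (A' ⊕ B) :=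
  (optSumL A B).symm.trans ((Equiv.sumCongr e (Equiv.refl B)).trans (optSumL A' B))

end ArityEquiv

open ArityEquiv

/-! ## Operads and cyclic operads -/

/-- A symmetric operad with unit in `k`-modules, in the coordinate-free form: `obj A` is the space
of operations whose inputs are labelled by the finite set `A` (so `obj (Fin n)` is the arity `n`
part with its action of the symmetric group), and `comp a b` grafts the root of `b` on the
distinguished input `none` of `a`. -/
structure Operad (k : Type u) [Field k] where
  obj : (A : Type) → [Finite A] → Type v
  [addCommGroup : ∀ (A : Type) [Finite A], AddCommGroup (obj A)]
  [module : ∀ (A : Type) [Finite A], Module k (obj A)]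
  map : ∀ {A B : Type} [Finite A] [Finite B], (A ≃ B) → obj A →ₗ[k] obj B
  one : obj Unit
  comp : ∀ {A B : Type} [Finite A] [Finite B], obj (Option A) →ₗ[k] obj B →ₗ[k] obj (A ⊕ B)
  map_refl : ∀ {A : Type} [Finite A] (a : obj A), map (Equiv.refl A) a = a
  map_trans : ∀ {A B C : Type} [Finite A] [Finite B] [Finite C] (e : A ≃ B) (f : B ≃ C)
    (a : obj A), map (e.trans f) a = map f (map e a)
  comp_map : ∀ {A A' B B' : Type} [Finite A] [Finite A'] [Finite B] [Finite B'] (e : A ≃ A')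
    (f : B ≃ B') (a : obj (Option A)) (b : obj B),
    comp (map (Equiv.optionCongr e) a) (map f b) = map (Equiv.sumCongr e f) (comp a b)
  one_comp : ∀ {B : Type} [Finite B] (b : obj B),
    map (Equiv.emptySum Empty B) (comp (map unitOpt one) b) = b
  comp_one : ∀ {A : Type} [Finite A] (a : obj (Option A)), map (sumUnit A) (comp a one) = a
  comp_assoc : ∀ {A B C : Type} [Finite A] [Finite B] [Finite C] (a : obj (Option A))
    (b : obj (Option B)) (c : obj C),
    map (Equiv.sumAssoc A B C) (comp (map (optSumR A B) (comp a b)) c) = comp a (comp b c)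
  comp_parallel : ∀ {A B C : Type} [Finite A] [Finite B] [Finite C] (a : obj (Option (Option A)))
    (b : obj B) (c : obj C),
    map (sumSwapRight A B C) (comp (map (optSumL A B) (comp a b)) c) =
      comp (map (optSumL A C) (comp (map (optSwap A) a) c)) b

namespace Operad

variable {k : Type u} [Field k]

attribute [instance] Operad.addCommGroup Operad.module

/-- A cyclic structure on an operad: the action of bijections of input sets is extended to
bijections of the sets `Option A = {root} ⊔ A` of all entries, compatibly with grafting. -/
@[ext]
structure CyclicStructure (P : Operad.{u, v} k) where
  act : ∀ {A B : Type} [Finite A] [Finite B], (Option A ≃ Option B) → P.obj A →ₗ[k] P.obj B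
  act_optionCongr : ∀ {A B : Type} [Finite A] [Finite B] (e : A ≃ B) (a : P.obj A),
    act (Equiv.optionCongr e) a = P.map e a
  act_trans : ∀ {A B C : Type} [Finite A] [Finite B] [Finite C] (e : Option A ≃ Option B)
    (f : Option B ≃ Option C) (a : P.obj A), act (e.trans f) a = act f (act e a)
  act_comp_left : ∀ {A A' B : Type} [Finite A] [Finite A'] [Finite B] (e : Option A ≃ Option A')
    (a : P.obj (Option A)) (b : P.obj B),
    act (extendSum e B) (P.comp a b) = P.comp (act (extendSlot e) a) b
  act_comp_rotate : ∀ {A B : Type} [Finite A] [Finite B] (a : P.obj (Option A))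
    (b : P.obj (Option B)),
    act (rotateComp A B) (P.comp a b) = P.comp (act (optSwap B) b) (act (optSwap A) a)

/-- Isomorphisms of operads. -/
structure Iso (P : Operad.{u, v} k) (Q : Operad.{u, w} k) where
  app : ∀ (A : Type) [Finite A], P.obj A ≃ₗ[k] Q.obj A
  app_map : ∀ {A B : Type} [Finite A] [Finite B] (e : A ≃ B) (a : P.obj A),
    app B (P.map e a) = Q.map e (app A a)
  app_one : app Unit P.one = Q.one
  app_comp : ∀ {A B : Type} [Finite A] [Finite B] (a : P.obj (Option A)) (b : P.obj B),
    app (A ⊕ B) (P.comp a b) = Q.comp (app (Option A) a) (app B b)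

/-- An isomorphism of operads is one of cyclic operads if it commutes with the cyclic actions. -/
def Iso.IsCyclic {P : Operad.{u, v} k} {Q : Operad.{u, w} k} (f : Iso P Q)
    (C : CyclicStructure P) (D : CyclicStructure Q) : Prop :=
  ∀ {A B : Type} [Finite A] [Finite B] (e : Option A ≃ Option B) (a : P.obj A),
    f.app B (C.act e a) = D.act e (f.app A a)

/-! ### Quotients -/

/-- An operadic ideal. -/
structure Ideal (P : Operad.{u, v} k) where
  carrier : ∀ (A : Type) [Finite A], Submodule k (P.obj A)
  map_mem : ∀ {A B : Type} [Finite A] [Finite B] (e : A ≃ B) {a : P.obj A},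
    a ∈ carrier A → P.map e a ∈ carrier B
  comp_mem_left : ∀ {A B : Type} [Finite A] [Finite B] {a : P.obj (Option A)} (b : P.obj B),
    a ∈ carrier (Option A) → P.comp a b ∈ carrier (A ⊕ B)
  comp_mem_right : ∀ {A B : Type} [Finite A] [Finite B] (a : P.obj (Option A)) {b : P.obj B},
    b ∈ carrier B → P.comp a b ∈ carrier (A ⊕ B)

/-- The smallest operadic ideal that contains the given elements. -/
def Ideal.span (P : Operad.{u, v} k) (S : ∀ (A : Type) [Finite A], Set (P.obj A)) : Ideal P where
  carrier A _ := sInf {N | ∃ I : Ideal P,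
    (∀ (B : Type) [Finite B], S B ⊆ I.carrier B) ∧ N = I.carrier A}
  map_mem e a ha := by
    simp only [Submodule.mem_sInf] at ha ⊢
    rintro _ ⟨I, hI, rfl⟩
    exact I.map_mem e (ha _ ⟨I, hI, rfl⟩)
  comp_mem_left b ha := by
    simp only [Submodule.mem_sInf] at ha ⊢
    rintro _ ⟨I, hI, rfl⟩
    exact I.comp_mem_left b (ha _ ⟨I, hI, rfl⟩)
  comp_mem_right a b hb := by
    simp only [Submodule.mem_sInf] at hb ⊢
    rintro _ ⟨I, hI, rfl⟩
    exact I.comp_mem_right a (hb _ ⟨I, hI, rfl⟩)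

/-- Grafting in a quotient. -/
def quotientComp (P : Operad.{u, v} k) (I : Ideal P) (A B : Type) [Finite A] [Finite B] :
    (P.obj (Option A) ⧸ I.carrier (Option A)) →ₗ[k] (P.obj B ⧸ I.carrier B) →ₗ[k]
      (P.obj (A ⊕ B) ⧸ I.carrier (A ⊕ B)) :=
  (I.carrier (Option A)).liftQ
    (LinearMap.flip ((I.carrier B).liftQ
      (LinearMap.flip (P.comp.compr₂ (I.carrier (A ⊕ B)).mkQ))
      fun b hb => by
        ext a
        simpa using I.comp_mem_right a hb))
    fun a ha => by
      refine LinearMap.ext fun b => ?_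
      induction b using Submodule.Quotient.induction_on with
      | _ b => exact (Submodule.Quotient.mk_eq_zero _).2 (I.comp_mem_left b ha)

/-- The quotient of an operad by an operadic ideal. -/
def quotient (P : Operad.{u, v} k) (I : Ideal P) : Operad.{u, v} k where
  obj A _ := P.obj A ⧸ I.carrier A
  map {A B} _ _ e := (I.carrier A).mapQ (I.carrier B) (P.map e) fun _ h => I.map_mem e h
  one := (I.carrier Unit).mkQ P.one
  comp {A B} _ _ := quotientComp P I A B
  map_refl a := by
    induction a using Submodule.Quotient.induction_on with
    | _ a =>
    exact congrArg (I.carrier _).mkQ (P.map_refl a)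
  map_trans e f a := by
    induction a using Submodule.Quotient.induction_on with
    | _ a =>
    exact congrArg (I.carrier _).mkQ (P.map_trans e f a)
  comp_map e f a b := by
    induction a using Submodule.Quotient.induction_on with
    | _ a =>
    induction b using Submodule.Quotient.induction_on with
    | _ b =>
    exact congrArg (I.carrier _).mkQ (P.comp_map e f a b)
  one_comp b := by
    induction b using Submodule.Quotient.induction_on with
    | _ b =>
    exact congrArg (I.carrier _).mkQ (P.one_comp b)
  comp_one a := by
    induction a using Submodule.Quotient.induction_on with
    | _ a =>
    exact congrArg (I.carrier _).mkQ (P.comp_one a)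
  comp_assoc a b c := by
    induction a using Submodule.Quotient.induction_on with
    | _ a =>
    induction b using Submodule.Quotient.induction_on with
    | _ b =>
    induction c using Submodule.Quotient.induction_on with
    | _ c =>
    exact congrArg (I.carrier _).mkQ (P.comp_assoc a b c)
  comp_parallel a b c := by
    induction a using Submodule.Quotient.induction_on with
    | _ a =>
    induction b using Submodule.Quotient.induction_on with
    | _ b =>
    induction c using Submodule.Quotient.induction_on with
    | _ c =>
    exact congrArg (I.carrier _).mkQ (P.comp_parallel a b c)

/-! ### The operad freely generated by two operads -/

/-- Formal expressions in elements of `P` and `Q`. -/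
inductive FreeProd.Term (P : Operad.{u, v} k) (Q : Operad.{u, w} k) : Type → Type (max 1 u v w)
  | inl {A : Type} [Finite A] (a : P.obj A) : Term P Q A
  | inr {A : Type} [Finite A] (a : Q.obj A) : Term P Q A
  | map {A B : Type} [Finite A] [Finite B] (e : A ≃ B) (s : Term P Q A) : Term P Q B
  | comp {A B : Type} [Finite A] [Finite B] (s : Term P Q (Option A)) (t : Term P Q B) :
      Term P Q (A ⊕ B)
  | zero (A : Type) : Term P Q A
  | add {A : Type} (s t : Term P Q A) : Term P Q A
  | smul {A : Type} (c : k) (s : Term P Q A) : Term P Q A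

/-- The congruence on formal expressions generated by the laws of an operad, by the requirement
that `P` and `Q` map to the result by morphisms of operads, and by the identification of the two
units. -/
inductive FreeProd.Rel (P : Operad.{u, v} k) (Q : Operad.{u, w} k) :
    ∀ {A : Type}, FreeProd.Term P Q A → FreeProd.Term P Q A → Prop
  -- an equivalence relation, compatible with all the operations
  | refl {A : Type} (s : FreeProd.Term P Q A) : Rel P Q s s
  | symm {A : Type} {s t : FreeProd.Term P Q A} : Rel P Q s t → Rel P Q t s
  | trans {A : Type} {s t r : FreeProd.Term P Q A} : Rel P Q s t → Rel P Q t r → Rel P Q s r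
  | map_congr {A B : Type} [Finite A] [Finite B] (e : A ≃ B) {s t : FreeProd.Term P Q A} :
      Rel P Q s t → Rel P Q (.map e s) (.map e t)
  | comp_congr {A B : Type} [Finite A] [Finite B] {s s' : FreeProd.Term P Q (Option A)}
      {t t' : FreeProd.Term P Q B} :
      Rel P Q s s' → Rel P Q t t' → Rel P Q (.comp s t) (.comp s' t')
  | add_congr {A : Type} {s s' t t' : FreeProd.Term P Q A} :
      Rel P Q s s' → Rel P Q t t' → Rel P Q (.add s t) (.add s' t')
  | smul_congr {A : Type} (c : k) {s t : FreeProd.Term P Q A} :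
      Rel P Q s t → Rel P Q (.smul c s) (.smul c t)
  -- vector space laws
  | add_comm {A : Type} (s t : FreeProd.Term P Q A) : Rel P Q (.add s t) (.add t s)
  | add_assoc {A : Type} (s t r : FreeProd.Term P Q A) :
      Rel P Q (.add (.add s t) r) (.add s (.add t r))
  | zero_add {A : Type} (s : FreeProd.Term P Q A) : Rel P Q (.add (.zero A) s) s
  | neg_add {A : Type} (s : FreeProd.Term P Q A) : Rel P Q (.add (.smul (-1) s) s) (.zero A)
  | smul_add {A : Type} (c : k) (s t : FreeProd.Term P Q A) :
      Rel P Q (.smul c (.add s t)) (.add (.smul c s) (.smul c t))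
  | add_smul {A : Type} (c d : k) (s : FreeProd.Term P Q A) :
      Rel P Q (.smul (c + d) s) (.add (.smul c s) (.smul d s))
  | mul_smul {A : Type} (c d : k) (s : FreeProd.Term P Q A) :
      Rel P Q (.smul (c * d) s) (.smul c (.smul d s))
  | one_smul {A : Type} (s : FreeProd.Term P Q A) : Rel P Q (.smul 1 s) s
  -- linearity of the operad structure
  | map_add {A B : Type} [Finite A] [Finite B] (e : A ≃ B) (s t : FreeProd.Term P Q A) :
      Rel P Q (.map e (.add s t)) (.add (.map e s) (.map e t))
  | map_smul {A B : Type} [Finite A] [Finite B] (e : A ≃ B) (c : k) (s : FreeProd.Term P Q A) :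
      Rel P Q (.map e (.smul c s)) (.smul c (.map e s))
  | add_comp {A B : Type} [Finite A] [Finite B] (s s' : FreeProd.Term P Q (Option A))
      (t : FreeProd.Term P Q B) : Rel P Q (.comp (.add s s') t) (.add (.comp s t) (.comp s' t))
  | smul_comp {A B : Type} [Finite A] [Finite B] (c : k) (s : FreeProd.Term P Q (Option A))
      (t : FreeProd.Term P Q B) : Rel P Q (.comp (.smul c s) t) (.smul c (.comp s t))
  | comp_add {A B : Type} [Finite A] [Finite B] (s : FreeProd.Term P Q (Option A))
      (t t' : FreeProd.Term P Q B) : Rel P Q (.comp s (.add t t')) (.add (.comp s t) (.comp s t'))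
  | comp_smul {A B : Type} [Finite A] [Finite B] (c : k) (s : FreeProd.Term P Q (Option A))
      (t : FreeProd.Term P Q B) : Rel P Q (.comp s (.smul c t)) (.smul c (.comp s t))
  -- operad laws
  | map_refl {A : Type} [Finite A] (s : FreeProd.Term P Q A) : Rel P Q (.map (Equiv.refl A) s) s
  | map_trans {A B C : Type} [Finite A] [Finite B] [Finite C] (e : A ≃ B) (f : B ≃ C)
      (s : FreeProd.Term P Q A) : Rel P Q (.map (e.trans f) s) (.map f (.map e s))
  | comp_map {A A' B B' : Type} [Finite A] [Finite A'] [Finite B] [Finite B'] (e : A ≃ A')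
      (f : B ≃ B') (s : FreeProd.Term P Q (Option A)) (t : FreeProd.Term P Q B) :
      Rel P Q (.comp (.map (Equiv.optionCongr e) s) (.map f t))
        (.map (Equiv.sumCongr e f) (.comp s t))
  | one_comp {B : Type} [Finite B] (t : FreeProd.Term P Q B) :
      Rel P Q (.map (Equiv.emptySum Empty B) (.comp (.map unitOpt (.inl P.one)) t)) t
  | comp_one {A : Type} [Finite A] (s : FreeProd.Term P Q (Option A)) :
      Rel P Q (.map (sumUnit A) (.comp s (.inl P.one))) s
  | comp_assoc {A B C : Type} [Finite A] [Finite B] [Finite C] (s : FreeProd.Term P Q (Option A))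
      (t : FreeProd.Term P Q (Option B)) (r : FreeProd.Term P Q C) :
      Rel P Q (.map (Equiv.sumAssoc A B C) (.comp (.map (optSumR A B) (.comp s t)) r))
        (.comp s (.comp t r))
  | comp_parallel {A B C : Type} [Finite A] [Finite B] [Finite C]
      (s : FreeProd.Term P Q (Option (Option A))) (t : FreeProd.Term P Q B)
      (r : FreeProd.Term P Q C) :
      Rel P Q (.map (sumSwapRight A B C) (.comp (.map (optSumL A B) (.comp s t)) r))
        (.comp (.map (optSumL A C) (.comp (.map (optSwap A) s) r)) t)
  -- the maps from `P` and `Q` are morphisms of operads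
  | inl_add {A : Type} [Finite A] (a b : P.obj A) : Rel P Q (.inl (a + b)) (.add (.inl a) (.inl b))
  | inl_smul {A : Type} [Finite A] (c : k) (a : P.obj A) :
      Rel P Q (.inl (c • a)) (.smul c (.inl a))
  | inl_map {A B : Type} [Finite A] [Finite B] (e : A ≃ B) (a : P.obj A) :
      Rel P Q (.inl (P.map e a)) (.map e (.inl a))
  | inl_comp {A B : Type} [Finite A] [Finite B] (a : P.obj (Option A)) (b : P.obj B) :
      Rel P Q (.inl (P.comp a b)) (.comp (.inl a) (.inl b))
  | inr_add {A : Type} [Finite A] (a b : Q.obj A) : Rel P Q (.inr (a + b)) (.add (.inr a) (.inr b))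
  | inr_smul {A : Type} [Finite A] (c : k) (a : Q.obj A) :
      Rel P Q (.inr (c • a)) (.smul c (.inr a))
  | inr_map {A B : Type} [Finite A] [Finite B] (e : A ≃ B) (a : Q.obj A) :
      Rel P Q (.inr (Q.map e a)) (.map e (.inr a))
  | inr_comp {A B : Type} [Finite A] [Finite B] (a : Q.obj (Option A)) (b : Q.obj B) :
      Rel P Q (.inr (Q.comp a b)) (.comp (.inr a) (.inr b))
  -- the units are identified
  | inl_one : Rel P Q (.inl P.one) (.inr Q.one)

namespace FreeProd

variable (P : Operad.{u, v} k) (Q : Operad.{u, w} k)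

/-- Equality in the operad freely generated by `P` and `Q`. -/
def setoid (A : Type) : Setoid (Term P Q A) where
  r := Rel P Q
  iseqv := ⟨Rel.refl, Rel.symm, Rel.trans⟩

/-- The operations of the operad freely generated by `P` and `Q`. -/
def Obj (A : Type) : Type (max 1 u v w) := Quotient (setoid P Q A)

variable {P Q}

/-- The class of a formal expression. -/
def mk {A : Type} (s : Term P Q A) : Obj P Q A := Quotient.mk (setoid P Q A) s

theorem mk_eq {A : Type} {s t : Term P Q A} (h : Rel P Q s t) : mk s = mk t :=
  Quotient.sound (s := setoid P Q A) h

theorem ind {A : Type} {p : Obj P Q A → Prop} (h : ∀ s, p (mk s)) (x : Obj P Q A) : p x :=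
  Quotient.ind h x

instance (A : Type) : Zero (Obj P Q A) := ⟨mk (.zero A)⟩

instance (A : Type) : Add (Obj P Q A) :=
  ⟨Quotient.map₂ Term.add fun _ _ h _ _ h' => .add_congr h h'⟩

instance (A : Type) : Neg (Obj P Q A) :=
  ⟨Quotient.map (Term.smul (-1)) fun _ _ h => .smul_congr _ h⟩

instance (A : Type) : AddCommGroup (Obj P Q A) where
  nsmul := nsmulRec
  zsmul := zsmulRec
  add_assoc x y z := by
    induction x using ind; induction y using ind; induction z using ind
    exact mk_eq (.add_assoc _ _ _)
  add_comm x y := by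
    induction x using ind; induction y using ind
    exact mk_eq (.add_comm _ _)
  zero_add x := by
    induction x using ind
    exact mk_eq (.zero_add _)
  add_zero x := by
    induction x using ind
    exact mk_eq ((Rel.add_comm _ _).trans (.zero_add _))
  neg_add_cancel x := by
    induction x using ind
    exact mk_eq (.neg_add _)

theorem mk_add {A : Type} (s t : Term P Q A) : mk (s.add t) = mk s + mk t := rfl

instance (A : Type) : Module k (Obj P Q A) :=
  letI : SMul k (Obj P Q A) := ⟨fun c => Quotient.map (Term.smul c) fun _ _ h => .smul_congr _ h⟩
  Module.ofMinimalAxioms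
    (fun c x y => by
      induction x using ind; induction y using ind
      exact mk_eq (.smul_add _ _ _))
    (fun c d x => by
      induction x using ind
      exact mk_eq (.add_smul _ _ _))
    (fun c d x => by
      induction x using ind
      exact mk_eq (.mul_smul _ _ _))
    (fun x => by
      induction x using ind
      exact mk_eq (.one_smul _))

theorem mk_smul {A : Type} (c : k) (s : Term P Q A) : mk (s.smul c) = c • mk s := rfl

end FreeProd

open FreeProd in
/-- The operad freely generated by two operads, with their units identified. -/
def freeProd (P : Operad.{u, v} k) (Q : Operad.{u, w} k) : Operad.{u, max 1 u v w} k where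
  obj A _ := Obj P Q A
  map e :=
    { toFun := Quotient.map (Term.map e) fun _ _ h => .map_congr e h
      map_add' := fun x y => by
        induction x using ind; induction y using ind
        exact mk_eq (.map_add _ _ _)
      map_smul' := fun c x => by
        induction x using ind
        exact mk_eq (.map_smul _ _ _) }
  one := FreeProd.mk (Term.inl P.one)
  comp := LinearMap.mk₂ k (Quotient.map₂ Term.comp fun _ _ h _ _ h' => .comp_congr h h')
    (fun x x' y => by
      induction x using ind; induction x' using ind; induction y using ind
      exact mk_eq (.add_comp _ _ _))
    (fun c x y => by
      induction x using ind; induction y using ind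
      exact mk_eq (.smul_comp _ _ _))
    (fun x y y' => by
      induction x using ind; induction y using ind; induction y' using ind
      exact mk_eq (.comp_add _ _ _))
    (fun c x y => by
      induction x using ind; induction y using ind
      exact mk_eq (.comp_smul _ _ _))
  map_refl x := by
    induction x using ind
    exact mk_eq (.map_refl _)
  map_trans e f x := by
    induction x using ind
    exact mk_eq (.map_trans _ _ _)
  comp_map e f x y := by
    induction x using ind; induction y using ind
    exact mk_eq (.comp_map _ _ _ _)
  one_comp y := by
    induction y using ind
    exact mk_eq (.one_comp _)
  comp_one x := by
    induction x using ind
    exact mk_eq (.comp_one _)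
  comp_assoc x y z := by
    induction x using ind; induction y using ind; induction z using ind
    exact mk_eq (.comp_assoc _ _ _)
  comp_parallel x y z := by
    induction x using ind; induction y using ind; induction z using ind
    exact mk_eq (.comp_parallel _ _ _)

/-- The morphism from the first operad. -/
def freeProd.inl (P : Operad.{u, v} k) (Q : Operad.{u, w} k) (A : Type) [Finite A] :
    P.obj A →ₗ[k] (freeProd P Q).obj A where
  toFun a := FreeProd.mk (.inl a)
  map_add' _ _ := FreeProd.mk_eq (.inl_add _ _)
  map_smul' _ _ := FreeProd.mk_eq (.inl_smul _ _)

/-- The morphism from the second operad. -/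
def freeProd.inr (P : Operad.{u, v} k) (Q : Operad.{u, w} k) (A : Type) [Finite A] :
    Q.obj A →ₗ[k] (freeProd P Q).obj A where
  toFun a := FreeProd.mk (.inr a)
  map_add' _ _ := FreeProd.mk_eq (.inr_add _ _)
  map_smul' _ _ := FreeProd.mk_eq (.inr_smul _ _)

/-- `P.insert i u a` is the composition `a ∘ᵢ u` of `a` with the unary operation `u` at the
input `i`, with the input of `u` again called `i`. -/
noncomputable def insert (P : Operad.{u, v} k) {A : Type} [Finite A] (i : A) :
    P.obj Unit →ₗ[k] P.obj A →ₗ[k] P.obj A :=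
  ((P.comp.compl₁₂ (P.map (splitOff i)) LinearMap.id).compr₂
    (P.map ((sumUnit {x : A // x ≠ i}).trans (splitOff i).symm))).flip

end Operad

/-! ## Hopf algebras as operads and the operad `H𝒪` -/

section Hopf

variable (k : Type u) [Field k] (H : Type v) [Ring H]

/-- An algebra as an operad concentrated in arity one: the space of operations with input set `A`
is `H` if `A` has one element, and zero otherwise. -/
def algebraOperadObj [Algebra k H] (A : Type) : Submodule k H where
  carrier := {h | Nat.card A ≠ 1 → h = 0}
  add_mem' hx hy h := by simp [hx h, hy h]
  zero_mem' _ := rfl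
  smul_mem' c x hx h := by simp [hx h]

variable {H} in
/-- An element of the algebra as a unary operation. -/
def algebraOperadUnary [Algebra k H] : H →ₗ[k] algebraOperadObj k H Unit where
  toFun h := ⟨h, fun hn => absurd (by simp) hn⟩
  map_add' _ _ := rfl
  map_smul' _ _ := rfl

theorem algebraOperad_mul_mem [Algebra k H] {A B : Type} [Finite A] [Finite B] (a b : H)
    (ha : a ∈ algebraOperadObj k H (Option A)) (hb : b ∈ algebraOperadObj k H B) :
    a * b ∈ algebraOperadObj k H (A ⊕ B) := by
  intro h
  by_cases h1 : Nat.card (Option A) = 1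
  · by_cases h2 : Nat.card B = 1
    · refine absurd ?_ h
      rw [Finite.card_option] at h1
      rw [Nat.card_sum]
      omega
    · rw [hb h2, mul_zero]
  · rw [ha h1, zero_mul]

/-- An algebra as an operad with operations of arity one only; composition is multiplication. -/
def algebraOperad [Algebra k H] : Operad.{u, v} k where
  obj A _ := algebraOperadObj k H A
  map e := LinearMap.restrict (LinearMap.id : H →ₗ[k] H)
    (fun _ hx h => hx (by rwa [Nat.card_congr e]))
  one := ⟨1, fun hn => absurd (by simp) hn⟩
  comp := LinearMap.mk₂ k (fun a b => ⟨a.1 * b.1, algebraOperad_mul_mem k H a.1 b.1 a.2 b.2⟩)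
    (fun _ _ _ => Subtype.ext (add_mul _ _ _)) (fun _ _ _ => Subtype.ext (smul_mul_assoc _ _ _))
    (fun _ _ _ => Subtype.ext (mul_add _ _ _)) (fun _ _ _ => Subtype.ext (mul_smul_comm _ _ _))
  map_refl _ := rfl
  map_trans _ _ _ := rfl
  comp_map _ _ _ _ := rfl
  one_comp b := Subtype.ext (one_mul _)
  comp_one a := Subtype.ext (mul_one _)
  comp_assoc a b c := Subtype.ext (mul_assoc _ _ _)
  comp_parallel {A B C} _ _ _ a b c := by
    have : a.1 = 0 := a.2 (by simp [Finite.card_option])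
    refine Subtype.ext ?_
    change (a.1 * b.1) * c.1 = (a.1 * c.1) * b.1
    simp [this]

end Hopf

section Antipode

open Coalgebra HopfAlgebra WithConv

/-- The antipode of a cocommutative Hopf algebra is an involution. -/
theorem antipode_antipode_of_isCocomm (k : Type u) [CommRing k] {H : Type v} [Ring H]
    [HopfAlgebra k H] [IsCocomm k H] (h : H) : antipode k (antipode k h) = h := by
  have key : toConv (antipode k ∘ₗ antipode k (A := H)) * toConv (antipode k) = 1 := by
    ext c
    have hc : comul (R := k) c = ∑ i ∈ (ℛ k c).index, (ℛ k c).right i ⊗ₜ[k] (ℛ k c).left i := by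
      rw [← comm_comul k c]
      conv_lhs => rw [← (ℛ k c).eq]
      simp
    have : ∑ i ∈ (ℛ k c).index, antipode k (antipode k ((ℛ k c).right i)) *
        antipode k ((ℛ k c).left i) = algebraMap k H (counit c) := by
      simp_rw [← antipode_mul_antidistrib, ← map_sum]
      rw [sum_mul_antipode_eq_smul (ℛ k c), map_smul, antipode_one,
        Algebra.algebraMap_eq_smul_one]
    simp [LinearMap.convMul_apply, hc, this]
  have : toConv (antipode k ∘ₗ antipode k (A := H)) = toConv LinearMap.id := by
    calc _ = toConv (antipode k ∘ₗ antipode k (A := H)) *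
          (toConv (antipode k) * toConv LinearMap.id) := by
          rw [LinearMap.antipode_mul_id, mul_one]
      _ = _ := by rw [← mul_assoc, key, one_mul]
  exact LinearMap.congr_fun (congrArg WithConv.ofConv this) h

end Antipode

section CyclicHopf

open HopfAlgebra

variable (k : Type u) [Field k] (H : Type v) [Ring H] [HopfAlgebra k H] [Coalgebra.IsCocomm k H]

open Classical in
/-- The action of a bijection of the two entries of a unary operation: the antipode if the root
is moved, and the identity otherwise. -/
noncomputable def hopfEntryAct {A B : Type} (e : Option A ≃ Option B) : H →ₗ[k] H :=
  if e none = none then LinearMap.id else antipode k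

/-- The cyclic structure on a cocommutative Hopf algebra: a bijection of the two entries that moves
the root acts by the antipode. -/
noncomputable def hopfCyclic : (algebraOperad k H).CyclicStructure where
  act e := LinearMap.restrict (hopfEntryAct k H e)
    (fun x hx h => by
      have := hx (by
        have := Nat.card_congr e
        rw [Finite.card_option, Finite.card_option] at this
        omega)
      rw [this, map_zero])
  act_optionCongr e a := by
    refine Subtype.ext ?_
    change hopfEntryAct k H (Equiv.optionCongr e) a.1 = a.1
    simp [hopfEntryAct]
  act_trans {A B C} _ _ _ e f a := by
    refine Subtype.ext ?_
    change hopfEntryAct k H _ a.1 =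
      hopfEntryAct k H _ (hopfEntryAct k H _ a.1)
    by_cases hA : Nat.card A = 1
    · obtain ⟨x, hx⟩ := Nat.card_eq_one_iff_exists.1 hA
      have key : ∀ y : Option B, y ≠ e none → y = e (some x) := by
        intro y hy
        obtain ⟨z, rfl⟩ := e.surjective y
        rcases z with _ | z
        · exact absurd rfl hy
        · rw [hx z]
      by_cases he : e none = none
      · simp [hopfEntryAct, he]
      · have h1 := key none (fun h => he h.symm)
        by_cases hf : f none = none
        · have : f (e none) ≠ none := fun h => he (f.injective (h.trans hf.symm))
          simp [hopfEntryAct, he, hf, this]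
        · have : f (e none) = none := by
            obtain ⟨z, hz⟩ := f.surjective none
            by_cases hz' : z = e none
            · rw [← hz', hz]
            · rw [key z hz', ← h1] at hz
              exact absurd hz hf
          simp [hopfEntryAct, he, hf, this, antipode_antipode_of_isCocomm]
    · simp [a.2 hA]
  act_comp_left {A A' B} _ _ _ e a b := by
    refine Subtype.ext ?_
    change hopfEntryAct k H _ (a.1 * b.1) =
      hopfEntryAct k H _ a.1 * b.1
    by_cases hA : Nat.card (Option A) = 1
    · have hA' : IsEmpty A := by
        rw [Finite.card_option] at hA
        rw [← Finite.card_eq_zero_iff]; omega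
      have hA'' : IsEmpty A' := by
        have := Nat.card_congr e
        rw [hA, Finite.card_option] at this
        rw [← Finite.card_eq_zero_iff]; omega
      have h1 : ∀ x, e x = none := fun x => by
        rcases e x with _ | y
        · rfl
        · exact hA''.elim y
      rw [hopfEntryAct, hopfEntryAct, if_pos, if_pos]
      · rfl
      · change optSwap A' (Option.map e (some none)) = none
        simp [h1, optSwap]
      · change optSumL A' B (Sum.map e id (.inl none)) = none
        simp [h1, optSumL]
    · simp [a.2 hA]
  act_comp_rotate {A B} _ _ a b := by
    refine Subtype.ext ?_
    change hopfEntryAct k H _ (a.1 * b.1) =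
      hopfEntryAct k H _ b.1 * hopfEntryAct k H _ a.1
    simp [hopfEntryAct, rotateComp, optSwap, antipode_mul_antidistrib]

end CyclicHopf

section TensorHopf

open TensorProduct

variable (k : Type u) [Field k] (V : Type v) [AddCommGroup V] [Module k V]

/-- The bialgebra structure of the tensor algebra: the elements of `V` are primitive. -/
noncomputable instance tensorAlgebraBialgebra : Bialgebra k (TensorAlgebra k V) :=
  Bialgebra.ofAlgHom
    (TensorAlgebra.lift k
      ((TensorProduct.mk k (TensorAlgebra k V) (TensorAlgebra k V)).flip 1 ∘ₗ TensorAlgebra.ι k +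
        TensorProduct.mk k (TensorAlgebra k V) (TensorAlgebra k V) 1 ∘ₗ TensorAlgebra.ι k))
    (TensorAlgebra.lift k 0)
    (by
      ext v
      simp [tmul_add, add_tmul, Algebra.TensorProduct.one_def, add_assoc])
    (by ext v; simp)
    (by ext v; simp)

theorem TensorAlgebra.comul_ι (x : V) :
    Coalgebra.comul (R := k) (TensorAlgebra.ι k x) =
      TensorAlgebra.ι k x ⊗ₜ[k] 1 + 1 ⊗ₜ[k] TensorAlgebra.ι k x := by
  change TensorAlgebra.lift k _ _ = _
  simp

theorem TensorAlgebra.counit_ι (x : V) :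
    Coalgebra.counit (R := k) (TensorAlgebra.ι k x) = 0 := by
  change TensorAlgebra.lift k _ _ = _
  simp

instance : Coalgebra.IsCocomm k (TensorAlgebra k V) where
  comm_comp_comul := by
    have : ((Algebra.TensorProduct.comm k (TensorAlgebra k V) (TensorAlgebra k V)).toAlgHom.comp
        (Bialgebra.comulAlgHom k (TensorAlgebra k V))) =
        Bialgebra.comulAlgHom k (TensorAlgebra k V) := by
      ext v
      simp [TensorAlgebra.comul_ι, add_comm]
    ext x
    exact DFunLike.congr_fun this x

/-- The antipode of the tensor algebra, `v₁⋯vₙ ↦ (-1)ⁿ vₙ⋯v₁`, as a map to the opposite algebra. -/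
noncomputable def tensorAntipode : TensorAlgebra k V →ₐ[k] (TensorAlgebra k V)ᵐᵒᵖ :=
  TensorAlgebra.lift k
    (-((MulOpposite.opLinearEquiv k).toLinearMap ∘ₗ TensorAlgebra.ι k (M := V)))

/-- The Hopf algebra structure of the tensor algebra. -/
noncomputable instance tensorAlgebraHopf : HopfAlgebra k (TensorAlgebra k V) where
  antipode := (MulOpposite.opLinearEquiv k).symm.toLinearMap ∘ₗ (tensorAntipode k V).toLinearMap
  mul_antipode_rTensor_comul := by
    ext x
    induction x using TensorAlgebra.induction with
    | algebraMap r => simp [Algebra.TensorProduct.one_def, Algebra.algebraMap_eq_smul_one]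
    | ι x => simp [TensorAlgebra.comul_ι, TensorAlgebra.counit_ι, tensorAntipode]
    | add a b ha hb => simp only [map_add, ha, hb]
    | mul a b ha hb =>
      simp only [LinearMap.comp_apply] at ha hb ⊢
      rw [← (Coalgebra.Repr.arbitrary k a).eq] at ha
      rw [← (Coalgebra.Repr.arbitrary k b).eq] at hb
      rw [Bialgebra.comul_mul, Bialgebra.counit_mul, ← (Coalgebra.Repr.arbitrary k a).eq,
        ← (Coalgebra.Repr.arbitrary k b).eq, Finset.sum_mul_sum]
      rw [Finset.sum_comm]
      simp [mul_assoc] at ha hb ⊢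
      simp_rw [← mul_assoc (MulOpposite.unop _) _ ((Coalgebra.Repr.arbitrary k b).right _),
        ← Finset.sum_mul, ← Finset.mul_sum, ha]
      simp only [Algebra.algebraMap_eq_smul_one, smul_mul_assoc, mul_smul_comm, mul_one,
        ← Finset.smul_sum] at hb ⊢
      rw [hb, smul_comm]
  mul_antipode_lTensor_comul := by
    ext x
    induction x using TensorAlgebra.induction with
    | algebraMap r => simp [Algebra.TensorProduct.one_def, Algebra.algebraMap_eq_smul_one]
    | ι x => simp [TensorAlgebra.comul_ι, TensorAlgebra.counit_ι, tensorAntipode]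
    | add a b ha hb => simp only [map_add, ha, hb]
    | mul a b ha hb =>
      simp only [LinearMap.comp_apply] at ha hb ⊢
      rw [← (Coalgebra.Repr.arbitrary k a).eq] at ha
      rw [← (Coalgebra.Repr.arbitrary k b).eq] at hb
      rw [Bialgebra.comul_mul, Bialgebra.counit_mul, ← (Coalgebra.Repr.arbitrary k a).eq,
        ← (Coalgebra.Repr.arbitrary k b).eq, Finset.sum_mul_sum]
      simp [mul_assoc] at ha hb ⊢
      simp_rw [← mul_assoc ((Coalgebra.Repr.arbitrary k b).left _), ← Finset.mul_sum,
        ← Finset.sum_mul, hb]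
      simp only [Algebra.algebraMap_eq_smul_one, smul_mul_assoc, one_mul, mul_smul_comm, mul_one,
        ← Finset.smul_sum] at ha ⊢
      rw [ha, smul_comm]

end TensorHopf

section HopfOperad

open TensorProduct

variable (k : Type u) [Field k] (H : Type v) [Ring H] [HopfAlgebra k H]

/-- `spread P j l h` sends an operation `a` to `∑ a ∘ (h₍₁₎, …, h₍ₙ₎)`, where the factors of the
iterated coproduct of `h`, regarded as unary operations through `j`, are inserted at the inputs in
the list `l`, and it is the counit of `h` times `a` for the empty list. -/
noncomputable def spread (P : Operad.{u, w} k) (j : H →ₗ[k] P.obj Unit) {A : Type} [Finite A] :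
    List A → H →ₗ[k] Module.End k (P.obj A)
  | [] => LinearMap.smulRight Coalgebra.counit LinearMap.id
  | i :: l => TensorProduct.lift
      ((LinearMap.mul k (Module.End k (P.obj A))).compl₁₂ (P.insert i ∘ₗ j) (spread P j l)) ∘ₗ
      Coalgebra.comul

/-- The morphism from `H` to the operad freely generated by `H` and `𝒪`, on unary operations. -/
noncomputable def hopfInFree (O : Operad.{u, w} k) :
    H →ₗ[k] (Operad.freeProd (algebraOperad k H) O).obj Unit :=
  Operad.freeProd.inl (algebraOperad k H) O Unit ∘ₗ algebraOperadUnary k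

/-- The differences `h ∘ o - ∑ o ∘ (h₍₁₎, …, h₍ₙ₎)` for `h ∈ H` and `o ∈ 𝒪` with set of inputs `A`,
where `l` enumerates `A`. -/
def commutationRelations (O : Operad.{u, w} k) (A : Type) [Finite A] :
    Set ((Operad.freeProd (algebraOperad k H) O).obj A) :=
  {r | ∃ (h : H) (o : O.obj A) (l : List A), l.Nodup ∧ (∀ i, i ∈ l) ∧
    r = (Operad.freeProd (algebraOperad k H) O).map (Equiv.emptySum Empty A)
          ((Operad.freeProd (algebraOperad k H) O).comp
            ((Operad.freeProd (algebraOperad k H) O).map unitOpt (hopfInFree k H O h))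
            (Operad.freeProd.inr (algebraOperad k H) O A o)) -
        spread k H (Operad.freeProd (algebraOperad k H) O) (hopfInFree k H O) l h
          (Operad.freeProd.inr (algebraOperad k H) O A o)}

/-- The operad `H𝒪`: the quotient of the operad freely generated by `H` and `𝒪` by the relation
that elements of `H` commute with the operations of `𝒪` via the coproduct. -/
def hopfOperad (O : Operad.{u, w} k) : Operad.{u, max 1 u v w} k :=
  (Operad.freeProd (algebraOperad k H) O).quotient
    (Operad.Ideal.span _ (fun A _ => commutationRelations k H O A))

/-- The morphism of operads `H → H𝒪`. -/
def hopfOperad.ofHopf (O : Operad.{u, w} k) (A : Type) [Finite A] :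
    (algebraOperad k H).obj A →ₗ[k] (hopfOperad k H O).obj A :=
  Submodule.mkQ _ ∘ₗ Operad.freeProd.inl (algebraOperad k H) O A

/-- The morphism of operads `𝒪 → H𝒪`. -/
def hopfOperad.ofOperad (O : Operad.{u, w} k) (A : Type) [Finite A] :
    O.obj A →ₗ[k] (hopfOperad k H O).obj A :=
  Submodule.mkQ _ ∘ₗ Operad.freeProd.inr (algebraOperad k H) O A

/-- `C` is the cyclic structure on `H𝒪` induced by the antipode of `H` and by the cyclic
structure `D` of `𝒪`: it extends both. -/
def IsInducedCyclic [Coalgebra.IsCocomm k H] (O : Operad.{u, w} k) (D : O.CyclicStructure)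
    (C : (hopfOperad k H O).CyclicStructure) : Prop :=
  ∀ {A B : Type} [Finite A] [Finite B] (e : Option A ≃ Option B),
    (∀ h : (algebraOperad k H).obj A, C.act e (hopfOperad.ofHopf k H O A h) =
      hopfOperad.ofHopf k H O B ((hopfCyclic k H).act e h)) ∧
    (∀ o : O.obj A, C.act e (hopfOperad.ofOperad k H O A o) =
      hopfOperad.ofOperad k H O B (D.act e o))

end HopfOperad

/-! ## Trees -/

/-- Rooted planar binary trees whose leaves are either inputs in `A` or hairs with a label in `D`.
Adding the root as a univalent vertex, these are the trivalent trees with a cyclic ordering at each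
trivalent vertex, with one of the univalent vertices chosen as the root. -/
inductive HTree (A : Type) (D : Type v) : Type v
  | leaf (a : A) : HTree A D
  | hair (d : D) : HTree A D
  | node (s t : HTree A D) : HTree A D

namespace HTree

variable {A B C : Type} {D : Type v}

open Classical in
/-- The number of occurrences of the input `a`. -/
noncomputable def occ (a : A) : HTree A D → ℕ
  | leaf b => if b = a then 1 else 0
  | hair _ => 0
  | node s t => occ a s + occ a t

/-- Substitute trees for the inputs. -/
def bind (f : A → HTree B D) : HTree A D → HTree B D
  | leaf a => f a
  | hair d => hair d
  | node s t => node (bind f s) (bind f t)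

/-- Relabel the inputs. -/
def map (f : A → B) (t : HTree A D) : HTree B D := t.bind fun a => leaf (f a)

/-- Graft the root of `t` on the input `none` of `s`. -/
def graft (s : HTree (Option A) D) (t : HTree B D) : HTree (A ⊕ B) D :=
  s.bind fun
    | none => t.map .inr
    | some a => leaf (.inl a)

open Classical in
/-- Let `s` contain the input `a`, and let `r` be glued to the root of `s`. The result, seen from
`a` as the new root. At a trivalent vertex with the cyclic order `(x, y, root)`, the tree is
`node x y` as seen from `root`, `node y root` as seen from `x` and `node root x` as seen
from `y`. -/
noncomputable def up (a : A) : HTree A D → HTree A D → HTree A D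
  | leaf _, r => r
  | hair _, r => r
  | node x y, r => if occ a x ≠ 0 then up a x (node y r) else up a y (node r x)

/-- Exchange the root and the input `a`. -/
noncomputable def reroot (a : A) (t : HTree A D) : HTree A D := up a t (leaf a)

/-- The action of a bijection of the sets of entries (root and inputs). -/
noncomputable def act (e : Option A ≃ Option B) (t : HTree A D) : HTree B D :=
  match e.symm none with
  | none => t.map (Equiv.removeNone e)
  | some a => (reroot a t).map (Equiv.removeNone e)

/-- Every input occurs exactly once, and there is at least one input. -/
def IsLin (t : HTree A D) : Prop := Nonempty A ∧ ∀ a, t.occ a = 1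

/-! ### Relabelling and substitution -/

theorem bind_bind (f : A → HTree B D) (g : B → HTree C D) (t : HTree A D) :
    (t.bind f).bind g = t.bind fun a => (f a).bind g := by
  induction t with
  | leaf a => rfl
  | hair d => rfl
  | node s t hs ht => simp [bind, hs, ht]

theorem bind_leaf (t : HTree A D) : t.bind leaf = t := by
  induction t with
  | leaf a => rfl
  | hair d => rfl
  | node s t hs ht => simp [bind, hs, ht]

theorem bind_congr {f g : A → HTree B D} {t : HTree A D} (h : ∀ a, t.occ a ≠ 0 → f a = g a) :
    t.bind f = t.bind g := by
  induction t with
  | leaf a => exact h a (by simp [occ])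
  | hair d => rfl
  | node s t hs ht =>
    simp only [bind]
    rw [hs fun a ha => h a (by simp only [occ]; omega), ht fun a ha => h a (by simp only [occ]; omega)]

theorem occ_bind_of_unique {f : A → HTree B D} {b : B} {a : A} (h1 : (f a).occ b = 1)
    (h2 : ∀ a', a' ≠ a → (f a').occ b = 0) (t : HTree A D) : (t.bind f).occ b = t.occ a := by
  induction t with
  | leaf a' =>
    by_cases h : a' = a
    · simp [bind, occ, h, h1]
    · simp [bind, occ, h, h2 a' h]
  | hair d => rfl
  | node s t hs ht => simp [bind, occ, hs, ht]

theorem occ_bind_eq_zero {f : A → HTree B D} {b : B} (t : HTree A D)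
    (h : ∀ a, t.occ a ≠ 0 → (f a).occ b = 0) : (t.bind f).occ b = 0 := by
  induction t with
  | leaf a' => exact h a' (by simp [occ])
  | hair d => rfl
  | node s t hs ht =>
    simp only [bind, occ]
    rw [hs fun a ha => h a (by simp only [occ]; omega), ht fun a ha => h a (by simp only [occ]; omega)]

theorem occ_map {f : A → B} (hf : Function.Injective f) (a : A) (t : HTree A D) :
    (t.map f).occ (f a) = t.occ a :=
  occ_bind_of_unique (by simp [occ]) (fun a' h => by simp [occ, hf.ne h]) t

theorem occ_map_eq_zero {f : A → B} {b : B} (h : ∀ a, f a ≠ b) (t : HTree A D) :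
    (t.map f).occ b = 0 :=
  occ_bind_eq_zero t fun a _ => by simp [occ, h a]

theorem map_map (f : A → B) (g : B → C) (t : HTree A D) : (t.map f).map g = t.map (g ∘ f) :=
  bind_bind _ _ _

theorem map_inj {f : A → B} (hf : Function.Injective f) {s t : HTree A D}
    (h : s.map f = t.map f) : s = t := by
  induction s generalizing t with
  | leaf a =>
    cases t with
    | leaf b => rw [hf (HTree.leaf.inj h)]
    | hair d => cases h
    | node => cases h
  | hair d =>
    cases t with
    | leaf b => cases h
    | hair d => cases h; rfl
    | node => cases h
  | node s s' hs hs' =>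
    cases t with
    | leaf b => cases h
    | hair d => cases h
    | node t t' =>
      obtain ⟨h1, h2⟩ := HTree.node.inj h
      rw [hs h1, hs' h2]

theorem occ_graft_inl (s : HTree (Option A) D) (t : HTree B D) (a : A) :
    (s.graft t).occ (.inl a) = s.occ (some a) := by
  refine occ_bind_of_unique (by simp [occ]) ?_ s
  rintro (_ | a') h
  · exact occ_map_eq_zero (by simp) t
  · have : a' ≠ a := fun h' => h (by rw [h'])
    simp [occ, this]

theorem occ_graft_inr (s : HTree (Option A) D) (t : HTree B D) (b : B) (ht : t.occ b = 1) :
    (s.graft t).occ (.inr b) = s.occ none := by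
  refine occ_bind_of_unique (by simpa using (occ_map Sum.inr_injective b t).trans ht) ?_ s
  rintro (_ | a') h
  · exact absurd rfl h
  · simp [occ]

theorem IsLin.graft {s : HTree (Option A) D} {t : HTree B D} (hs : s.IsLin) (ht : t.IsLin) :
    (s.graft t).IsLin := by
  obtain ⟨b⟩ := ht.1
  refine ⟨⟨.inr b⟩, ?_⟩
  rintro (a | b)
  · rw [occ_graft_inl, hs.2]
  · rw [occ_graft_inr _ _ _ (ht.2 b), hs.2]

theorem IsLin.map {t : HTree A D} (ht : t.IsLin) (e : A ≃ B) : (t.map e).IsLin := by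
  refine ⟨ht.1.map e, fun b => ?_⟩
  obtain ⟨a, rfl⟩ := e.surjective b
  rw [occ_map e.injective, ht.2]

/-! ### Changing the root -/

/-- The equivalence relation on pairs of trees glued along their roots that is generated by the
moves of the glueing point: the pairs describe the same unrooted planar tree. -/
inductive Eqv : HTree A D → HTree A D → HTree A D → HTree A D → Prop
  | refl (s t) : Eqv s t s t
  | symm {s t s' t'} : Eqv s t s' t' → Eqv s' t' s t
  | trans {s t s' t' s'' t''} : Eqv s t s' t' → Eqv s' t' s'' t'' → Eqv s t s'' t''
  | swap (s t) : Eqv s t t s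
  | rot (s t r) : Eqv (node s t) r s (node t r)

theorem Eqv.bind {s t s' t' : HTree A D} (h : Eqv s t s' t') (f : A → HTree B D) :
    Eqv (s.bind f) (t.bind f) (s'.bind f) (t'.bind f) := by
  induction h with
  | refl => exact .refl _ _
  | symm _ h => exact h.symm
  | trans _ _ h h' => exact h.trans h'
  | swap => exact .swap _ _
  | rot => exact .rot _ _ _

theorem Eqv.occ {s t s' t' : HTree A D} (h : Eqv s t s' t') (a : A) :
    s.occ a + t.occ a = s'.occ a + t'.occ a := by
  induction h with
  | refl => rfl
  | symm _ h => exact h.symm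
  | trans _ _ h h' => exact h.trans h'
  | swap => exact Nat.add_comm _ _
  | rot => simp only [HTree.occ]; omega

open Classical in
/-- The tree described by a glued pair, seen from the input `a`. -/
noncomputable def root (a : A) (s t : HTree A D) : HTree A D :=
  if s.occ a ≠ 0 then up a s t else up a t s

theorem eqv_up (a : A) (s t : HTree A D) (h : s.occ a ≠ 0) : Eqv s t (leaf a) (up a s t) := by
  induction s generalizing t with
  | leaf b =>
    have : b = a := by by_contra hb; simp [HTree.occ, hb] at h
    subst this; exact .refl _ _
  | hair d => exact absurd rfl h
  | node x y hx hy =>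
    simp only [up]
    split_ifs with hxa
    · exact (Eqv.rot _ _ _).trans (hx _ hxa)
    · have hya : y.occ a ≠ 0 := by simp only [HTree.occ] at h; omega
      exact (Eqv.rot _ _ _).trans ((Eqv.swap _ _).trans ((Eqv.rot _ _ _).trans (hy _ hya)))

theorem Eqv.root_eq {s t s' t' : HTree A D} (h : Eqv s t s' t') (a : A)
    (ha : s.occ a + t.occ a = 1) : root a s t = root a s' t' := by
  induction h with
  | refl => rfl
  | symm h' h => exact (h ((h'.occ a).trans ha)).symm
  | trans h1 _ h h' => exact (h ha).trans (h' ((h1.occ a).symm.trans ha))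
  | swap s t =>
    simp only [root]
    by_cases h1 : s.occ a = 0 <;> by_cases h2 : t.occ a = 0
    · rw [h1, h2] at ha
      exact absurd ha (by simp)
    · simp [h1, h2]
    · simp [h1, h2]
    · exact absurd ha (by omega)
  | rot s t r =>
    simp only [root, up, HTree.occ] at ha ⊢
    by_cases h1 : s.occ a = 0 <;> by_cases h2 : t.occ a = 0 <;> simp [h1, h2]

theorem Eqv.eq_of_leaf {a : A} {s t : HTree A D} (h : Eqv (leaf a) s (leaf a) t)
    (hs : s.occ a = 0) : s = t := by
  have := h.root_eq a (by simp [HTree.occ, hs])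
  simpa [root, HTree.occ, up] using this

theorem up_bind_update [DecidableEq A] {a : A} {b : B} {f : A → HTree B D} (hf : f a = leaf b)
    (hf' : ∀ a', a' ≠ a → (f a').occ b = 0) (r : HTree B D) (s q : HTree A D)
    (hs : s.occ a = 1) :
    up b (s.bind f) (q.bind (Function.update f a r)) =
      (up a s q).bind (Function.update f a r) := by
  have hocc : ∀ t : HTree A D, (t.bind f).occ b = t.occ a :=
    occ_bind_of_unique (by simp [hf, HTree.occ]) hf'
  have hupd : ∀ t : HTree A D, t.occ a = 0 → t.bind f = t.bind (Function.update f a r) := by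
    intro t ht
    refine bind_congr fun a' ha' => ?_
    rw [Function.update_of_ne]
    rintro rfl
    exact ha' ht
  induction s generalizing q with
  | leaf a' =>
    have : a' = a := by by_contra hb; simp [HTree.occ, hb] at hs
    subst this; simp [HTree.bind, hf, up]
  | hair d => exact absurd hs (by simp [HTree.occ])
  | node x y hx hy =>
    simp only [HTree.bind, up, hocc]
    simp only [HTree.occ] at hs
    split_ifs with h
    · rw [← hx _ (by omega), HTree.bind, hupd y (by omega)]
    · rw [← hy _ (by omega), HTree.bind, hupd x (by omega)]

/-- The rerooted tree describes the same unrooted tree. -/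
theorem eqv_act (e : Option A ≃ Option B) {t : HTree A D} (ht : t.IsLin) :
    Eqv (leaf (e none)) (t.map fun a => e (some a)) (leaf none) ((act e t).map some) := by
  classical
  unfold act
  rcases h : e.symm none with _ | a
  · have he : e none = none := by rw [← h, e.apply_symm_apply]
    rw [he, map_map]
    have : (fun a => e (some a)) = some ∘ Equiv.removeNone e := by
      funext a
      refine (Equiv.removeNone_some e ?_).symm
      rcases hx : e (some a) with _ | b
      · exact absurd (e.injective (hx.trans he.symm)) (by simp)
      · exact ⟨b, rfl⟩
    rw [this]
    exact .refl _ _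
  · have he : e (some a) = none := by rw [← h, e.apply_symm_apply]
    have hn : ∀ a', a' ≠ a → e (some a') ≠ none := fun a' h' h'' =>
      h' (Option.some_injective _ (e.injective (h''.trans he.symm)))
    have h1 := eqv_up none (t.map fun a => e (some a)) (leaf (e none) : HTree (Option B) D)
      (by
        rw [← he, occ_map (f := fun a => e (some a))
          (e.injective.comp (Option.some_injective _)), ht.2]; simp)
    refine (Eqv.swap _ _).trans (h1.trans ?_)
    have h2 := up_bind_update (a := a) (b := none) (f := fun a => leaf (e (some a)))
      (by rw [he]) (fun a' h' => by simp [HTree.occ, hn a' h']) (leaf (e none)) t (leaf a) (ht.2 a)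
    have h3 : (leaf a : HTree A D).bind (Function.update (fun a => leaf (e (some a))) a
        (leaf (e none))) = leaf (e none) := by simp [HTree.bind]
    rw [h3] at h2
    change Eqv _ (up none (t.bind fun a => leaf (e (some a))) _) _ _
    rw [h2, map_map]
    have : (Function.update (fun a => leaf (e (some a))) a (leaf (e none)) :
        A → HTree (Option B) D) = fun a' => leaf ((some ∘ Equiv.removeNone e) a') := by
      funext a'
      by_cases h' : a' = a
      · subst h'
        simp [Equiv.removeNone_none e he]
      · rw [Function.update_of_ne h', Function.comp,
          Equiv.removeNone_some e (Option.ne_none_iff_exists'.1 (hn a' h'))]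
    rw [this]
    exact .refl _ _

theorem act_unique {e : Option A ≃ Option B} {t : HTree A D} (ht : t.IsLin) {s : HTree B D}
    (h : Eqv (leaf (e none)) (t.map fun a => e (some a)) (leaf none) (s.map some)) :
    act e t = s :=
  map_inj (Option.some_injective _) (((eqv_act e ht).symm.trans h).eq_of_leaf
    (occ_map_eq_zero (by simp) _))

theorem IsLin.act {t : HTree A D} (ht : t.IsLin) (e : Option A ≃ Option B) : (act e t).IsLin := by
  constructor
  · obtain ⟨a⟩ := ht.1
    have : Nontrivial (Option A) := ⟨none, some a, by simp⟩
    have : Nontrivial (Option B) := e.symm.nontrivial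
    obtain ⟨x, hx⟩ := exists_ne (none : Option B)
    obtain ⟨b, rfl⟩ := Option.ne_none_iff_exists'.1 hx
    exact ⟨b⟩
  · intro b
    have := (eqv_act e ht).occ (some b)
    rw [occ_map (Option.some_injective _)] at this
    classical
    simp only [HTree.occ, reduceCtorEq, if_false, Nat.zero_add] at this
    have h0 : (HTree.act e t).occ b = (t.map fun a => e (some a)).occ (some b) +
        if e none = some b then 1 else 0 := by
      rw [← this, Nat.add_comm]
      simp
    rw [h0]
    rcases h : e.symm (some b) with _ | a
    · have he : e none = some b := by rw [← h, e.apply_symm_apply]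
      rw [he, if_pos rfl, occ_map_eq_zero]
      intro a ha
      exact absurd (e.injective (ha.trans he.symm)) (by simp)
    · have he : e (some a) = some b := by rw [← h, e.apply_symm_apply]
      rw [if_neg, ← he, occ_map (f := fun a => e (some a))
          (e.injective.comp (Option.some_injective _)), ht.2]
      intro h'
      exact absurd (e.injective (h'.trans he.symm)) (by simp)

theorem act_graft_left {A' : Type} (e : Option A ≃ Option A') {s : HTree (Option A) D}
    {t : HTree B D} (hs : s.IsLin) (ht : t.IsLin) :
    HTree.act (extendSum e B) (s.graft t) = (HTree.act (extendSlot e) s).graft t := by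
  refine act_unique (hs.graft ht) ?_
  let F : Option (Option A') → HTree (Option (A' ⊕ B)) D
    | none => leaf none
    | some none => t.map fun b => some (.inr b)
    | some (some a) => leaf (some (.inl a))
  have h1 := (eqv_act (extendSlot e) hs).bind F
  have e1 : (leaf (extendSlot e none) : HTree (Option (Option A')) D).bind F =
      leaf (extendSum e B none) := by
    change HTree.bind F (leaf (optSwap A' (some (e none)))) = leaf (optSumL A' B (.inl (e none)))
    rcases e none with _ | x <;> rfl
  have e2 : (s.map fun a => extendSlot e (some a)).bind F =
      (s.graft t).map fun a => extendSum e B (some a) := by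
    rw [HTree.map, bind_bind, HTree.graft, HTree.map, bind_bind]
    congr 1
    funext x
    rcases x with _ | x
    · change HTree.map _ t = HTree.bind _ (HTree.map _ t)
      rw [HTree.map, HTree.map, bind_bind]
      rfl
    · change HTree.bind F (leaf (optSwap A' (some (e (some x))))) =
        leaf (optSumL A' B (.inl (e (some x))))
      rcases e (some x) with _ | x <;> rfl
  have e3 : ((HTree.act (extendSlot e) s).map some).bind F =
      ((HTree.act (extendSlot e) s).graft t).map some := by
    rw [HTree.map, bind_bind, HTree.graft, HTree.map, bind_bind]
    congr 1
    funext x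
    rcases x with _ | x
    · change HTree.map _ t = HTree.bind _ (HTree.map _ t)
      rw [HTree.map, HTree.map, bind_bind]
      rfl
    · rfl
  rw [e1, e2, e3] at h1
  exact h1

theorem act_graft_rotate {s : HTree (Option A) D} {t : HTree (Option B) D} (hs : s.IsLin)
    (ht : t.IsLin) :
    HTree.act (rotateComp A B) (s.graft t) =
      (HTree.act (optSwap B) t).graft (HTree.act (optSwap A) s) := by
  refine act_unique (hs.graft ht) ?_
  let g : Option B → Option (B ⊕ Option A) := Option.map .inl
  let F : Option (Option A) → HTree (Option (B ⊕ Option A)) D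
    | none => t.map g
    | some x => leaf (some (.inr x))
  let G : Option (Option B) → HTree (Option (B ⊕ Option A)) D
    | none => leaf none
    | some none => (HTree.act (optSwap A) s).map fun x => some (.inr x)
    | some (some b) => leaf (some (.inl b))
  have h1 := (eqv_act (optSwap A) hs).bind F
  have h2 := (eqv_act (optSwap B) ht).bind G
  have e1 : (s.map fun a => optSwap A (some a)).bind F =
      (s.graft t).map fun a => rotateComp A B (some a) := by
    rw [HTree.map, bind_bind, HTree.graft, HTree.map, bind_bind]
    congr 1
    funext x
    rcases x with _ | x
    · change t.map g = HTree.bind _ (HTree.map _ _)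
      rw [HTree.map, HTree.map, bind_bind]
      congr 1
      funext y
      rcases y with _ | y <;> rfl
    · rfl
  have e2 : ((HTree.act (optSwap A) s).map some).bind F =
      (HTree.act (optSwap A) s).map fun x => some (.inr x) := by
    rw [HTree.map, bind_bind]
    rfl
  have e3 : (t.map fun a => optSwap B (some a)).bind G = t.map g := by
    rw [HTree.map, bind_bind, HTree.map]
    congr 1
    funext y
    rcases y with _ | y <;> rfl
  have e4 : ((HTree.act (optSwap B) t).map some).bind G =
      ((HTree.act (optSwap B) t).graft (HTree.act (optSwap A) s)).map some := by
    rw [HTree.map, bind_bind, HTree.graft, HTree.map, bind_bind]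
    congr 1
    funext x
    rcases x with _ | x
    · change HTree.map _ (HTree.act (optSwap A) s) = HTree.bind _ (HTree.map _ (HTree.act (optSwap A) s))
      rw [HTree.map, HTree.map, bind_bind]
      rfl
    · rfl
  rw [e1, e2] at h1
  rw [e3, e4] at h2
  exact h1.trans ((Eqv.swap _ _).trans h2)

end HTree

/-! ## The operads of trees -/

namespace TreeOperad

open HTree
open Finsupp hiding some

variable {k : Type u} [Field k] {D : Type v} {W : Type w} [AddCommGroup W] [Module k W]

/-- The antisymmetry relation, the IHX relation, and multilinearity in the labels of the hairs
(where `ℓ d` is the vector that the label `d` stands for), inside arbitrary trees. -/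
inductive Rel {A : Type} (ℓ : D → W) : (HTree A D →₀ k) → Prop
  | as (s t : HTree A D) : Rel ℓ (single (node s t) 1 + single (node t s) 1)
  | ihx (s t r : HTree A D) : Rel ℓ (single (node (node s t) r) 1 -
      single (node s (node t r)) 1 + single (node t (node s r)) 1)
  | add (d d₁ d₂ : D) (h : ℓ d = ℓ d₁ + ℓ d₂) :
      Rel ℓ (single (hair d) 1 - single (hair d₁) 1 - single (hair d₂) 1)
  | smul (c : k) (d d₁ : D) (h : ℓ d = c • ℓ d₁) : Rel ℓ (single (hair d) 1 - single (hair d₁) c)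
  | left {p : HTree A D →₀ k} (t : HTree A D) (h : Rel ℓ p) : Rel ℓ (p.mapDomain fun s => node s t)
  | right {p : HTree A D →₀ k} (s : HTree A D) (h : Rel ℓ p) : Rel ℓ (p.mapDomain fun t => node s t)

/-- The trees with set of inputs `A`. -/
abbrev LinTree (A : Type) (D : Type v) : Type v := {t : HTree A D // t.IsLin}

/-- The relations between the trees with set of inputs `A`. -/
noncomputable def relations (k : Type u) [Field k] {D : Type v} {W : Type w} [AddCommGroup W] [Module k W]
    (ℓ : D → W) (A : Type) : Submodule k (LinTree A D →₀ k) :=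
  Submodule.span k {p | Rel ℓ (p.mapDomain Subtype.val)}

/-- The space spanned by the trees with set of inputs `A`, modulo antisymmetry, IHX and
multilinearity. -/
abbrev Obj (k : Type u) [Field k] {D : Type v} {W : Type w} [AddCommGroup W] [Module k W]
    (ℓ : D → W) (A : Type) : Type (max u v) :=
  (LinTree A D →₀ k) ⧸ relations k ℓ A

/-- The class of a tree. -/
noncomputable def mk (k : Type u) [Field k] {D : Type v} {W : Type w} [AddCommGroup W] [Module k W]
    (ℓ : D → W) {A : Type} (t : HTree A D) (ht : t.IsLin) : Obj k ℓ A :=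
  (relations k ℓ A).mkQ (single ⟨t, ht⟩ 1)

open Classical in
/-- The class of a tree, and zero for a tree in which some input does not occur exactly once. -/
noncomputable def mk' (k : Type u) [Field k] {D : Type v} {W : Type w} [AddCommGroup W]
    [Module k W] (ℓ : D → W) {A : Type} (t : HTree A D) : Obj k ℓ A :=
  if ht : t.IsLin then mk k ℓ t ht else 0

variable {ℓ : D → W} {A B C : Type}

theorem mk'_of_isLin {t : HTree A D} (ht : t.IsLin) : mk' k ℓ t = mk k ℓ t ht := dif_pos ht

/-! ### Relations and substitutions -/

theorem Rel.bind {p : HTree A D →₀ k} (h : Rel ℓ p) (f : A → HTree B D) :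
    Rel ℓ (p.mapDomain fun t => t.bind f) := by
  induction h with
  | as s t => simpa [mapDomain_add, mapDomain_single, HTree.bind] using Rel.as _ _
  | ihx s t r =>
    simpa [mapDomain_add, mapDomain_sub, mapDomain_single, HTree.bind] using Rel.ihx _ _ _
  | add d d₁ d₂ h =>
    simpa [mapDomain_add, mapDomain_sub, mapDomain_single, HTree.bind] using Rel.add _ _ _ h
  | smul c d d₁ h =>
    simpa [mapDomain_add, mapDomain_sub, mapDomain_single, HTree.bind] using Rel.smul _ _ _ h
  | left t _ h =>
    rw [← mapDomain_comp]
    have := h.left (t.bind f)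
    rwa [← mapDomain_comp] at this
  | right t _ h =>
    rw [← mapDomain_comp]
    have := h.right (t.bind f)
    rwa [← mapDomain_comp] at this

theorem Rel.nonempty {p : HTree A D →₀ k} (h : Rel ℓ p) : Nonempty (HTree A D) := by
  induction h with
  | as s t => exact ⟨s⟩
  | ihx s t r => exact ⟨s⟩
  | add d d₁ d₂ h => exact ⟨hair d⟩
  | smul c d d₁ h => exact ⟨hair d⟩
  | left t _ h => exact h
  | right t _ h => exact h

theorem Rel.graft {p : HTree B D →₀ k} (h : Rel ℓ p) (s : HTree (Option A) D)
    (hs : s.occ none = 1) : Rel ℓ (p.mapDomain fun t => s.graft t) := by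
  induction s with
  | leaf a =>
    have : a = none := by by_contra ha; simp [HTree.occ, ha] at hs
    subst this
    exact h.bind _
  | hair d => exact absurd hs (by simp [HTree.occ])
  | node x y hx hy =>
    simp only [HTree.occ] at hs
    have key : ∀ (z : HTree (Option A) D), z.occ none = 0 → ∀ t t' : HTree B D,
        z.graft t = z.graft t' := by
      intro z hz t t'
      refine bind_congr fun a ha => ?_
      rcases a with _ | a
      · exact absurd hz ha
      · rfl
    obtain ⟨t₀⟩ := h.nonempty
    by_cases hx0 : x.occ none = 0
    · have := (hy (by omega)).right (x.graft t₀)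
      rw [← mapDomain_comp] at this
      have e : (fun t => (node x y).graft t) =
          (fun t => node (x.graft t₀) t) ∘ fun t : HTree B D => y.graft t := by
        funext t
        change node (x.graft t) (y.graft t) = _
        rw [key x hx0 t t₀]; rfl
      rwa [e]
    · have := (hx (by omega)).left (y.graft t₀)
      rw [← mapDomain_comp] at this
      have e : (fun t => (node x y).graft t) =
          (fun t => node t (y.graft t₀)) ∘ fun t : HTree B D => x.graft t := by
        funext t
        change node (x.graft t) (y.graft t) = _
        rw [key y (by omega) t t₀]; rfl
      rwa [e]

theorem Rel.up_right {p : HTree A D →₀ k} (h : Rel ℓ p) (a : A) (s : HTree A D) :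
    Rel ℓ (p.mapDomain fun r => up a s r) := by
  induction s generalizing p with
  | leaf b =>
    change Rel ℓ (p.mapDomain id)
    rwa [mapDomain_id]
  | hair d =>
    change Rel ℓ (p.mapDomain id)
    rwa [mapDomain_id]
  | node x y hx hy =>
    by_cases h0 : x.occ a = 0
    · have := hy (h.left x)
      rw [← mapDomain_comp] at this
      simpa [up, h0, Function.comp_def] using this
    · have := hx (h.right y)
      rw [← mapDomain_comp] at this
      simpa [up, h0, Function.comp_def] using this

/-- The span of all relations. -/
noncomputable def relSpan (k : Type u) [Field k] {D : Type v} {W : Type w} [AddCommGroup W] [Module k W]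
    (ℓ : D → W) (A : Type) : Submodule k (HTree A D →₀ k) :=
  Submodule.span k {p | Rel ℓ p}

theorem mem_relSpan {p : HTree A D →₀ k} (h : Rel ℓ p) : p ∈ relSpan k ℓ A :=
  Submodule.subset_span h

theorem up_right_mem {p : HTree A D →₀ k} (h : p ∈ relSpan k ℓ A) (a : A) (s : HTree A D) :
    p.mapDomain (fun r => up a s r) ∈ relSpan k ℓ A := by
  have : relSpan k ℓ A ≤ (relSpan k ℓ A).comap (lmapDomain k k fun r => up a s r) :=
    Submodule.span_le.2 fun p hp => mem_relSpan (Rel.up_right hp a s)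
  exact this h

/-- All the trees in a relation have the same inputs, and rerooting preserves relations. -/
theorem Rel.aux {p : HTree A D →₀ k} (h : Rel ℓ p) :
    ∃ c : A → ℕ, p ∈ supported k k {t : HTree A D | ∀ a, t.occ a = c a} ∧
      ∀ a, c a = 1 → ∀ r, p.mapDomain (fun t => up a t r) ∈ relSpan k ℓ A := by
  induction h with
  | as s t =>
    refine ⟨fun a => (node s t).occ a, add_mem (single_mem_supported _ _ fun _ => rfl)
      (single_mem_supported _ _ fun a => by simp only [HTree.occ]; omega), fun a ha r => ?_⟩
    simp only [HTree.occ] at ha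
    rw [mapDomain_add, mapDomain_single, mapDomain_single]
    by_cases hs : s.occ a = 0
    · have ht : t.occ a ≠ 0 := by omega
      have := (Rel.as (k := k) (ℓ := ℓ) r s).up_right a t
      simp only [mapDomain_add, mapDomain_single] at this
      simpa [up, hs, ht] using mem_relSpan this
    · have ht : t.occ a = 0 := by omega
      have := (Rel.as (k := k) (ℓ := ℓ) t r).up_right a s
      simp only [mapDomain_add, mapDomain_single] at this
      simpa [up, hs, ht] using mem_relSpan this
  | ihx s t r =>
    refine ⟨fun a => (node (node s t) r).occ a, add_mem (sub_mem
      (single_mem_supported _ _ fun _ => rfl)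
      (single_mem_supported _ _ fun a => by simp only [HTree.occ]; omega))
      (single_mem_supported _ _ fun a => by simp only [HTree.occ]; omega), fun a ha q => ?_⟩
    simp only [HTree.occ] at ha
    simp only [mapDomain_add, mapDomain_sub, mapDomain_single]
    by_cases hs : s.occ a = 0
    · by_cases ht : t.occ a = 0
      · have hr : r.occ a ≠ 0 := by omega
        have h1 := up_right_mem (sub_mem (mem_relSpan (Rel.as (k := k) (ℓ := ℓ) (node q t) s))
          (mem_relSpan (Rel.ihx (k := k) (ℓ := ℓ) q s t))) a r
        simp only [mapDomain_add, mapDomain_sub, mapDomain_single] at h1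
        convert h1 using 1
        simp [up, HTree.occ, hs, ht]
        abel
      · have hr : r.occ a = 0 := by omega
        have h2 := (Rel.as (k := k) (ℓ := ℓ) s r).right q
        simp only [mapDomain_add, mapDomain_single] at h2
        have h1 := up_right_mem (sub_mem (add_mem
          (mem_relSpan (Rel.ihx (k := k) (ℓ := ℓ) r q s))
          (mem_relSpan (Rel.as (k := k) (ℓ := ℓ) (node s r) q))) (mem_relSpan h2)) a t
        simp only [mapDomain_add, mapDomain_sub, mapDomain_single] at h1
        convert h1 using 1
        simp [up, HTree.occ, hs, ht]
        abel
    · have ht : t.occ a = 0 := by omega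
      have hr : r.occ a = 0 := by omega
      have h2 := (Rel.as (k := k) (ℓ := ℓ) q t).right r
      simp only [mapDomain_add, mapDomain_single] at h2
      have h1 := up_right_mem (sub_mem (mem_relSpan h2)
        (mem_relSpan (Rel.ihx (k := k) (ℓ := ℓ) t r q))) a s
      simp only [mapDomain_add, mapDomain_sub, mapDomain_single] at h1
      convert h1 using 1
      simp [up, HTree.occ, hs, ht]
      abel
  | add d d₁ d₂ h =>
    exact ⟨fun _ => 0, sub_mem (sub_mem (single_mem_supported _ _ fun _ => rfl)
      (single_mem_supported _ _ fun _ => rfl)) (single_mem_supported _ _ fun _ => rfl),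
      fun a ha => absurd ha (by simp)⟩
  | smul c d d₁ h =>
    exact ⟨fun _ => 0, sub_mem (single_mem_supported _ _ fun _ => rfl)
      (single_mem_supported _ _ fun _ => rfl), fun a ha => absurd ha (by simp)⟩
  | @left p t h ih =>
    obtain ⟨c, hc, ih⟩ := ih
    refine ⟨fun a => c a + t.occ a, ?_, fun a ha r => ?_⟩
    · classical
      rw [mem_supported] at hc ⊢
      intro x hx
      obtain ⟨y, hy, rfl⟩ := Finset.mem_image.1 (mapDomain_support hx)
      intro a
      simp only [HTree.occ]
      rw [hc hy a]
    · rw [← mapDomain_comp]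
      dsimp only at ha
      by_cases h0 : t.occ a = 0
      · rw [mapDomain_congr (g := fun x => up a x (node t r))]
        · exact ih a (by omega) _
        · intro x hx
          have : x.occ a = c a := hc hx a
          have : x.occ a ≠ 0 := by omega
          simp [up, this]
      · rw [mapDomain_congr (g := (fun x => up a t x) ∘ fun x => node r x)]
        · rw [mapDomain_comp]
          exact mem_relSpan ((h.right r).up_right a t)
        · intro x hx
          have : x.occ a = c a := hc hx a
          have : x.occ a = 0 := by omega
          simp [up, this]
  | @right p t h ih =>
    obtain ⟨c, hc, ih⟩ := ih
    refine ⟨fun a => t.occ a + c a, ?_, fun a ha r => ?_⟩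
    · classical
      rw [mem_supported] at hc ⊢
      intro x hx
      obtain ⟨y, hy, rfl⟩ := Finset.mem_image.1 (mapDomain_support hx)
      intro a
      simp only [HTree.occ]
      rw [hc hy a]
    · rw [← mapDomain_comp]
      dsimp only at ha
      by_cases h0 : t.occ a = 0
      · rw [mapDomain_congr (g := fun x => up a x (node r t))]
        · exact ih a (by omega) _
        · intro x hx
          simp [up, h0]
      · rw [mapDomain_congr (g := (fun x => up a t x) ∘ fun x => node x r)]
        · rw [mapDomain_comp]
          exact mem_relSpan ((h.left r).up_right a t)
        · intro x hx
          simp [up, h0]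

theorem linearCombination_mk_val (p : LinTree A D →₀ k) :
    linearCombination k (mk' k ℓ) (p.mapDomain Subtype.val) = (relations k ℓ A).mkQ p := by
  rw [linearCombination_mapDomain]
  have : (mk' k ℓ ∘ Subtype.val : LinTree A D → Obj k ℓ A) =
      fun t => (relations k ℓ A).mkQ (single t 1) := by
    funext t
    exact mk'_of_isLin t.2
  rw [this]
  induction p using Finsupp.induction_linear with
  | zero => simp
  | add p q hp hq => rw [map_add, map_add, hp, hq]
  | single t c => rw [linearCombination_single, ← map_smul, smul_single_one]

theorem Rel.mk_eq_zero {p : HTree A D →₀ k} (h : Rel ℓ p) :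
    linearCombination k (mk' k ℓ) p = 0 := by
  classical
  obtain ⟨c, hc, -⟩ := h.aux
  rw [mem_supported] at hc
  by_cases hlin : Nonempty A ∧ ∀ a, c a = 1
  · have hp : ∃ q : LinTree A D →₀ k, q.mapDomain Subtype.val = p := by
      refine ⟨p.comapDomain Subtype.val Subtype.val_injective.injOn,
        mapDomain_comapDomain _ Subtype.val_injective _ ?_⟩
      intro t ht
      exact ⟨⟨t, hlin.1, fun a => (hc ht a).trans (hlin.2 a)⟩, rfl⟩
    obtain ⟨q, rfl⟩ := hp
    rw [linearCombination_mk_val]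
    exact (Submodule.Quotient.mk_eq_zero _).2 (Submodule.subset_span h)
  · rw [linearCombination_apply]
    refine Finset.sum_eq_zero fun t ht => ?_
    have : mk' k ℓ t = 0 := dif_neg fun h' => hlin ⟨h'.1, fun a => (hc ht a).symm.trans (h'.2 a)⟩
    simp [this]

theorem relSpan_mk_eq_zero {p : HTree A D →₀ k} (h : p ∈ relSpan k ℓ A) :
    linearCombination k (mk' k ℓ) p = 0 := by
  have : relSpan k ℓ A ≤ LinearMap.ker (linearCombination k (mk' k ℓ)) :=
    Submodule.span_le.2 fun p hp => Rel.mk_eq_zero hp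
  exact this h

/-- A linear map out of the space of trees. -/
noncomputable def lift {M : Type*} [AddCommGroup M] [Module k M] (f : LinTree A D → M)
    (hf : ∀ p : LinTree A D →₀ k, Rel ℓ (p.mapDomain Subtype.val) →
      linearCombination k f p = 0) : Obj k ℓ A →ₗ[k] M :=
  (relations k ℓ A).liftQ (linearCombination k f) (Submodule.span_le.2 fun p hp => hf p hp)

theorem lift_mk {M : Type*} [AddCommGroup M] [Module k M] (f : LinTree A D → M)
    (hf : ∀ p : LinTree A D →₀ k, Rel ℓ (p.mapDomain Subtype.val) →
      linearCombination k f p = 0) (t : HTree A D) (ht : t.IsLin) :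
    lift f hf (mk k ℓ t ht) = f ⟨t, ht⟩ := by
  refine (Submodule.liftQ_apply _ _ _).trans ?_
  rw [linearCombination_single, one_smul]

theorem hom_ext {M : Type*} [AddCommGroup M] [Module k M] {f g : Obj k ℓ A →ₗ[k] M}
    (h : ∀ (t : HTree A D) (ht : t.IsLin), f (mk k ℓ t ht) = g (mk k ℓ t ht)) : f = g := by
  apply Submodule.linearMap_qext
  apply Finsupp.lhom_ext'
  intro t
  apply LinearMap.ext_ring
  exact h t.1 t.2

/-- Relabelling of the entries. -/
noncomputable def act (e : Option A ≃ Option B) : Obj k ℓ A →ₗ[k] Obj k ℓ B :=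
  lift (fun t => mk' k ℓ (t.1.act e)) fun p hp => by
    obtain ⟨c, hc, hup⟩ := hp.aux
    rcases Finset.eq_empty_or_nonempty p.support with h0 | ⟨t, ht⟩
    · rw [Finsupp.support_eq_empty.1 h0, map_zero]
    have hc1 : ∀ a, c a = 1 := by
      classical
      intro a
      rw [mem_supported, mapDomain_support_of_injective Subtype.val_injective] at hc
      rw [← hc (Finset.mem_coe.2 (Finset.mem_image_of_mem _ ht)) a]
      exact t.2.2 a
    have h1 : linearCombination k (fun t : LinTree A D => mk' k ℓ (t.1.act e)) p =
        linearCombination k (mk' k ℓ) ((p.mapDomain Subtype.val).mapDomain (HTree.act e)) := by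
      rw [linearCombination_mapDomain, linearCombination_mapDomain]; rfl
    rw [h1]
    rcases h : e.symm none with _ | a
    · have : (HTree.act e : HTree A D → HTree B D) =
          fun t => t.bind fun a => leaf (Equiv.removeNone e a) := by
        funext t; simp only [HTree.act, h]; rfl
      rw [this]
      exact (hp.bind _).mk_eq_zero
    · have : (HTree.act e : HTree A D → HTree B D) =
          (fun t => t.bind fun a => leaf (Equiv.removeNone e a)) ∘ fun t => up a t (leaf a) := by
        funext t; simp only [HTree.act, h]; rfl
      rw [this, mapDomain_comp]
      have h2 : relSpan k ℓ A ≤ LinearMap.ker (linearCombination k (mk' k ℓ) ∘ₗ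
          lmapDomain k k fun t => t.bind fun a => leaf (Equiv.removeNone e a)) :=
        Submodule.span_le.2 fun p hp => (Rel.bind hp _).mk_eq_zero
      exact h2 (hup a (hc1 a) _)

theorem act_mk (e : Option A ≃ Option B) (t : HTree A D) (ht : t.IsLin) :
    act e (mk k ℓ t ht) = mk k ℓ (t.act e) (ht.act e) := by
  rw [act, lift_mk, mk'_of_isLin (ht.act e)]

/-- Relabelling of the inputs. -/
noncomputable def map (e : A ≃ B) : Obj k ℓ A →ₗ[k] Obj k ℓ B :=
  lift (fun t => mk' k ℓ (t.1.map e)) fun p hp => by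
    have h1 : linearCombination k (fun t : LinTree A D => mk' k ℓ (t.1.map e)) p =
        linearCombination k (mk' k ℓ) ((p.mapDomain Subtype.val).mapDomain (HTree.map e)) := by
      rw [linearCombination_mapDomain, linearCombination_mapDomain]; rfl
    rw [h1]
    exact (hp.bind _).mk_eq_zero

theorem map_mk (e : A ≃ B) (t : HTree A D) (ht : t.IsLin) :
    map e (mk k ℓ t ht) = mk k ℓ (t.map e) (ht.map e) := by
  rw [map, lift_mk, mk'_of_isLin (ht.map e)]

/-- Grafting on a fixed tree. -/
noncomputable def compRight (s : LinTree (Option A) D) : Obj k ℓ B →ₗ[k] Obj k ℓ (A ⊕ B) :=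
  lift (fun t => mk' k ℓ (s.1.graft t.1)) fun p hp => by
    have h1 : linearCombination k (fun t : LinTree B D => mk' k ℓ (s.1.graft t.1)) p =
        linearCombination k (mk' k ℓ) ((p.mapDomain Subtype.val).mapDomain
          fun t => s.1.graft t) := by
      rw [linearCombination_mapDomain, linearCombination_mapDomain]; rfl
    rw [h1]
    exact (hp.graft s.1 (s.2.2 none)).mk_eq_zero

/-- Grafting. -/
noncomputable def comp : Obj k ℓ (Option A) →ₗ[k] Obj k ℓ B →ₗ[k] Obj k ℓ (A ⊕ B) :=
  lift compRight fun p hp => by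
    refine hom_ext fun t ht => ?_
    have h1 : linearCombination k (compRight (k := k) (ℓ := ℓ) (B := B)) p (mk k ℓ t ht) =
        linearCombination k (mk' k ℓ) ((p.mapDomain Subtype.val).mapDomain
          fun s : HTree (Option A) D => s.graft t) := by
      rw [linearCombination_mapDomain, linearCombination_mapDomain, linearCombination_apply,
        linearCombination_apply, Finsupp.sum, Finsupp.sum, LinearMap.sum_apply]
      refine Finset.sum_congr rfl fun s _ => ?_
      rw [LinearMap.smul_apply, compRight, lift_mk]; rfl
    rw [h1]
    exact (hp.bind _).mk_eq_zero

theorem comp_mk (s : HTree (Option A) D) (hs : s.IsLin) (t : HTree B D) (ht : t.IsLin) :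
    comp (mk k ℓ s hs) (mk k ℓ t ht) = mk k ℓ (s.graft t) (hs.graft ht) := by
  rw [comp, lift_mk, compRight, lift_mk, mk'_of_isLin (hs.graft ht)]

theorem mk_congr {s t : HTree A D} (hs : s.IsLin) (ht : t.IsLin) (h : s = t) :
    mk k ℓ s hs = mk k ℓ t ht := by
  subst h; rfl

theorem ind {p : Obj k ℓ A → Prop} (mk : ∀ (t : HTree A D) (ht : t.IsLin), p (mk k ℓ t ht))
    (add : ∀ x y, p x → p y → p (x + y)) (smul : ∀ (c : k) x, p x → p (c • x)) (zero : p 0)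
    (x : Obj k ℓ A) : p x := by
  induction x using Submodule.Quotient.induction_on with
  | _ x =>
    induction x using Finsupp.induction_linear with
    | zero => exact zero
    | add x y hx hy => exact add _ _ hx hy
    | single t c =>
      rw [← mul_one c, ← smul_eq_mul, ← smul_single]
      exact smul c _ (mk t.1 t.2)

/-! ### The laws of a cyclic operad -/

set_option linter.unusedSimpArgs false

theorem map_refl (a : Obj k ℓ A) :
    map (Equiv.refl A) a = a := by
  induction a using ind with
  | mk s hs =>
    rw [map_mk]
    exact mk_congr _ _ (bind_leaf s)
  | add x y hx hy => simp only [map_add, LinearMap.add_apply, hx, hy]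
  | smul c x hx => simp only [map_smul, LinearMap.smul_apply, hx]
  | zero => simp only [map_zero, LinearMap.zero_apply]


theorem map_trans (e : A ≃ B) (f : B ≃ C) (a : Obj k ℓ A) :
    map (e.trans f) a = map f (map e a) := by
  induction a using ind with
  | mk s hs =>
    rw [map_mk, map_mk, map_mk]
    exact mk_congr _ _ (HTree.map_map e f s).symm
  | add x y hx hy => simp only [map_add, LinearMap.add_apply, hx, hy]
  | smul c x hx => simp only [map_smul, LinearMap.smul_apply, hx]
  | zero => simp only [map_zero, LinearMap.zero_apply]


theorem comp_map {A' B' : Type} (e : A ≃ A') (f : B ≃ B') (a : Obj k ℓ (Option A))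
    (b : Obj k ℓ B) :
    comp (map (Equiv.optionCongr e) a) (map f b) = map (Equiv.sumCongr e f) (comp a b) := by
  induction a using ind with
  | mk s hs =>
    induction b using ind with
    | mk t ht =>
      simp only [map_mk, comp_mk]
      refine mk_congr _ _ ?_
      simp only [HTree.graft, HTree.map, bind_bind]
      congr 1
      funext x
      rcases x with _ | x
      · simp only [HTree.bind, bind_bind, Equiv.optionCongr_apply, Option.map_none]
        rfl
      · rfl
    | add x y hx hy => simp only [map_add, LinearMap.add_apply, hx, hy]
    | smul c x hx => simp only [map_smul, LinearMap.smul_apply, hx]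
    | zero => simp only [map_zero, LinearMap.zero_apply]
  | add x y hx hy => simp only [map_add, LinearMap.add_apply, hx, hy]
  | smul c x hx => simp only [map_smul, LinearMap.smul_apply, hx]
  | zero => simp only [map_zero, LinearMap.zero_apply]


theorem one_comp (b : Obj k ℓ B) (h : (leaf () : HTree Unit D).IsLin) :
    map (Equiv.emptySum Empty B) (comp (map unitOpt (mk k ℓ (leaf ()) h)) b) = b := by
  induction b using ind with
  | mk t ht =>
    simp only [map_mk, comp_mk]
    refine mk_congr _ _ ?_
    change (t.map Sum.inr).map _ = t
    rw [HTree.map_map]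
    exact bind_leaf t
  | add x y hx hy => simp only [map_add, LinearMap.add_apply, hx, hy]
  | smul c x hx => simp only [map_smul, LinearMap.smul_apply, hx]
  | zero => simp only [map_zero, LinearMap.zero_apply]


theorem comp_one (a : Obj k ℓ (Option A)) (h : (leaf () : HTree Unit D).IsLin) :
    map (sumUnit A) (comp a (mk k ℓ (leaf ()) h)) = a := by
  induction a using ind with
  | mk s hs =>
    simp only [map_mk, comp_mk]
    refine mk_congr _ _ ?_
    conv_rhs => rw [← bind_leaf s]
    simp only [HTree.graft, HTree.map, bind_bind]
    congr 1
    funext x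
    rcases x with _ | x <;> rfl
  | add x y hx hy => simp only [map_add, LinearMap.add_apply, hx, hy]
  | smul c x hx => simp only [map_smul, LinearMap.smul_apply, hx]
  | zero => simp only [map_zero, LinearMap.zero_apply]


theorem comp_assoc (a : Obj k ℓ (Option A)) (b : Obj k ℓ (Option B)) (c : Obj k ℓ C) :
    map (Equiv.sumAssoc A B C) (comp (map (optSumR A B) (comp a b)) c) = comp a (comp b c) := by
  induction a using ind with
  | mk s hs =>
    induction b using ind with
    | mk t ht =>
      induction c using ind with
      | mk r hr =>
        simp only [map_mk, comp_mk]
        refine mk_congr _ _ ?_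
        simp only [HTree.graft, HTree.map, bind_bind]
        congr 1
        funext x
        rcases x with _ | x
        · simp only [bind_bind, HTree.bind]
          congr 1
          funext x
          rcases x with _ | x
          · simp only [optSumR, Equiv.coe_fn_mk, bind_bind, HTree.bind]
            rfl
          · rfl
        · rfl
      | add x y hx hy => simp only [map_add, LinearMap.add_apply, hx, hy]
      | smul c x hx => simp only [map_smul, LinearMap.smul_apply, hx]
      | zero => simp only [map_zero, LinearMap.zero_apply]
    | add x y hx hy => simp only [map_add, LinearMap.add_apply, hx, hy]
    | smul c x hx => simp only [map_smul, LinearMap.smul_apply, hx]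
    | zero => simp only [map_zero, LinearMap.zero_apply]
  | add x y hx hy => simp only [map_add, LinearMap.add_apply, hx, hy]
  | smul c x hx => simp only [map_smul, LinearMap.smul_apply, hx]
  | zero => simp only [map_zero, LinearMap.zero_apply]


theorem comp_parallel (a : Obj k ℓ (Option (Option A))) (b : Obj k ℓ B) (c : Obj k ℓ C) :
    map (sumSwapRight A B C) (comp (map (optSumL A B) (comp a b)) c) =
      comp (map (optSumL A C) (comp (map (optSwap A) a) c)) b := by
  induction a using ind with
  | mk s hs =>
    induction b using ind with
    | mk t ht =>
      induction c using ind with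
      | mk r hr =>
        simp only [map_mk, comp_mk]
        refine mk_congr _ _ ?_
        simp only [HTree.graft, HTree.map, bind_bind]
        congr 1
        funext x
        rcases x with _ | _ | x
        · simp only [bind_bind, HTree.bind, optSwap, optSumL, Equiv.coe_fn_mk]
          rfl
        · simp only [bind_bind, HTree.bind, optSwap, optSumL, Equiv.coe_fn_mk]
          rfl
        · rfl
      | add x y hx hy => simp only [map_add, LinearMap.add_apply, hx, hy]
      | smul c x hx => simp only [map_smul, LinearMap.smul_apply, hx]
      | zero => simp only [map_zero, LinearMap.zero_apply]
    | add x y hx hy => simp only [map_add, LinearMap.add_apply, hx, hy]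
    | smul c x hx => simp only [map_smul, LinearMap.smul_apply, hx]
    | zero => simp only [map_zero, LinearMap.zero_apply]
  | add x y hx hy => simp only [map_add, LinearMap.add_apply, hx, hy]
  | smul c x hx => simp only [map_smul, LinearMap.smul_apply, hx]
  | zero => simp only [map_zero, LinearMap.zero_apply]


theorem act_optionCongr (e : A ≃ B) (a : Obj k ℓ A) :
    act (Equiv.optionCongr e) a = map e a := by
  induction a using ind with
  | mk s hs =>
    rw [act_mk, map_mk]
    refine mk_congr _ _ (act_unique hs ?_)
    rw [HTree.map_map]
    exact .refl _ _
  | add x y hx hy => simp only [map_add, LinearMap.add_apply, hx, hy]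
  | smul c x hx => simp only [map_smul, LinearMap.smul_apply, hx]
  | zero => simp only [map_zero, LinearMap.zero_apply]


theorem act_trans (e : Option A ≃ Option B) (f : Option B ≃ Option C) (a : Obj k ℓ A) :
    act (e.trans f) a = act f (act e a) := by
  induction a using ind with
  | mk s hs =>
    rw [act_mk, act_mk, act_mk]
    refine mk_congr _ _ (act_unique hs ?_)
    have h1 := (eqv_act e hs).bind fun b => leaf (f b)
    have h2 := eqv_act f (hs.act e)
    change Eqv _ (HTree.map f _) _ (HTree.map f _) at h1
    rw [HTree.map_map, HTree.map_map] at h1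
    exact h1.trans h2
  | add x y hx hy => simp only [map_add, LinearMap.add_apply, hx, hy]
  | smul c x hx => simp only [map_smul, LinearMap.smul_apply, hx]
  | zero => simp only [map_zero, LinearMap.zero_apply]


theorem act_comp_left {A' : Type} (e : Option A ≃ Option A') (a : Obj k ℓ (Option A)) (b : Obj k ℓ B) :
    act (extendSum e B) (comp a b) = comp (act (extendSlot e) a) b := by
  induction a using ind with
  | mk s hs =>
    induction b using ind with
    | mk t ht =>
      simp only [act_mk, comp_mk]
      exact mk_congr _ _ (act_graft_left e hs ht)
    | add x y hx hy => simp only [map_add, LinearMap.add_apply, hx, hy]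
    | smul c x hx => simp only [map_smul, LinearMap.smul_apply, hx]
    | zero => simp only [map_zero, LinearMap.zero_apply]
  | add x y hx hy => simp only [map_add, LinearMap.add_apply, hx, hy]
  | smul c x hx => simp only [map_smul, LinearMap.smul_apply, hx]
  | zero => simp only [map_zero, LinearMap.zero_apply]

theorem act_comp_rotate (a : Obj k ℓ (Option A)) (b : Obj k ℓ (Option B)) :
    act (rotateComp A B) (comp a b) = comp (act (optSwap B) b) (act (optSwap A) a) := by
  induction a using ind with
  | mk s hs =>
    induction b using ind with
    | mk t ht =>
      simp only [act_mk, comp_mk]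
      exact mk_congr _ _ (act_graft_rotate hs ht)
    | add x y hx hy => simp only [map_add, LinearMap.add_apply, hx, hy]
    | smul c x hx => simp only [map_smul, LinearMap.smul_apply, hx]
    | zero => simp only [map_zero, LinearMap.zero_apply]
  | add x y hx hy => simp only [map_add, LinearMap.add_apply, hx, hy]
  | smul c x hx => simp only [map_smul, LinearMap.smul_apply, hx]
  | zero => simp only [map_zero, LinearMap.zero_apply]

end TreeOperad

/-- The operad whose operations with set of inputs `A` are spanned by the trees with `A` as set
of numbered leaves besides the root, and all other leaves labelled by `D`, modulo antisymmetry, IHX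
and multilinearity in the vectors `ℓ d` that the labels `d` stand for. It is reduced: there are no
operations without inputs. -/
noncomputable def treeOperad (k : Type u) [Field k] {D : Type v} {W : Type w} [AddCommGroup W]
    [Module k W] (ℓ : D → W) : Operad.{u, max u v} k where
  obj A _ := TreeOperad.Obj k ℓ A
  map e := TreeOperad.map e
  one := TreeOperad.mk k ℓ (.leaf ()) ⟨⟨()⟩, fun _ => if_pos rfl⟩
  comp := TreeOperad.comp
  map_refl := TreeOperad.map_refl
  map_trans := TreeOperad.map_trans
  comp_map := TreeOperad.comp_map
  one_comp b := TreeOperad.one_comp b _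
  comp_one a := TreeOperad.comp_one a _
  comp_assoc := TreeOperad.comp_assoc
  comp_parallel := TreeOperad.comp_parallel

/-- The cyclic structure on the operad of trees: forget which of the numbered leaves is the
root, relabel the numbered leaves, and use the new leaf with the label of the root as the root. -/
noncomputable def treeCyclic (k : Type u) [Field k] {D : Type v} {W : Type w} [AddCommGroup W]
    [Module k W] (ℓ : D → W) : (treeOperad k ℓ).CyclicStructure where
  act e := TreeOperad.act e
  act_optionCongr := TreeOperad.act_optionCongr
  act_trans := TreeOperad.act_trans
  act_comp_left := TreeOperad.act_comp_left
  act_comp_rotate := TreeOperad.act_comp_rotate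

/-- The tree with one trivalent vertex that joins the root and two inputs: the bracket. -/
noncomputable def treeVertex (k : Type u) [Field k] {D : Type v} {W : Type w} [AddCommGroup W]
    [Module k W] (ℓ : D → W) : (treeOperad k ℓ).obj Bool :=
  TreeOperad.mk k ℓ (.node (.leaf true) (.leaf false))
    ⟨⟨true⟩, fun a => by cases a <;> simp [HTree.occ]⟩

/-- The tree with one trivalent vertex that joins the root, a hair and an input: a line with one
hair. -/
noncomputable def treeHair (k : Type u) [Field k] {D : Type v} {W : Type w} [AddCommGroup W]
    [Module k W] (ℓ : D → W) (d : D) : (treeOperad k ℓ).obj Unit :=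
  TreeOperad.mk k ℓ (.node (.hair d) (.leaf ())) ⟨⟨()⟩, fun a => by simp [HTree.occ]⟩

/-- The labels of the hairs of trees without hairs. -/
def noLabels (d : Empty) : PUnit.{1} := d.elim

/-- The Lie operad: trees without hairs modulo antisymmetry and IHX. -/
noncomputable def lieOperad (k : Type u) [Field k] : Operad.{u, u} k := treeOperad k noLabels

/-- The cyclic structure of the Lie operad. -/
noncomputable def lieCyclic (k : Type u) [Field k] : (lieOperad k).CyclicStructure :=
  treeCyclic k noLabels

/-- The reduced operad of Lie trees with hairs labelled by `V`. -/
noncomputable def hairyLie (k : Type u) [Field k] (V : Type v) [AddCommGroup V] [Module k V] :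
    Operad.{u, max u v} k :=
  treeOperad k (id : V → V)

/-- The cyclic structure of the reduced operad of Lie trees with hairs labelled by `V`. -/
noncomputable def hairyLieCyclic (k : Type u) [Field k] (V : Type v) [AddCommGroup V]
    [Module k V] : (hairyLie k V).CyclicStructure :=
  treeCyclic k (id : V → V)

/-! Grafting a line with one hair `v` on the root of a tree is the bracket with `v`. By the Jacobi
identity this bracket is a derivation, so a hair at the root of a tree without hairs equals the sum
over the inputs of the same hair placed at that input (`TreeLie.sum_of_bind_update`). This is the
commutation relation of `H Lie` for a primitive element. It extends from the generators to the whole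
tensor algebra because both sides are compatible with products (`Operad.unaryAction_eq_spread`).
Since `T(V)` is free as an algebra, the universal property `hopfOperad.exists_lift` then yields a
morphism `Φ` from `H Lie` to the operad of trees with hairs (`exists_hopfLie_hom`).

`Φ` is surjective because the bracket and the lines with one hair generate all trees with hairs as
an operad (`hairyTree_mem`): a branch without inputs is dissolved into single hairs by the Jacobi
identity.

For injectivity, the commutation relations push all elements of `H` to the inputs, so `H Lie` is
spanned by Lie operations with elements of `H` inserted at their inputs (`hopfOperad.insertSpan`).
It is therefore enough to find, in each arity, a linear map back whose value on such operations is
known; it need not be compatible with composition in advance. Let `L` be the Lie algebra of trees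
whose ends carry an input and a coefficient in `T(V)`, in effect the free Lie algebra on one copy of
`T(V)` for each input. An element of `V` acts on `L` by the derivation that multiplies coefficients
from the left. A tree with hairs is evaluated in the semidirect sum of `L` and its derivations,
where the input `a` goes to `a` with coefficient `1` and the hair `v` to its derivation
(`pushHairs`). The component in `L` consists of trees whose inputs carry coefficients, and inserting
these coefficients gives an operation of `H Lie` (`pairToHopf`); that this respects the relations is
`IsTreeFunctional.linearCombination_eq_zero`. Trees without hairs receive only coefficients `1`.
Inserting `v` at an input multiplies the coefficient of that input by `v` from the right, because
left and right multiplications commute and agree on `1` (`pushHairs_bind_update`). So the map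
inverts `Φ` from the left (`hopfLie_hom_injective`).

As for cyclic structures, the compatibility laws determine the action on a composition from the
actions on its factors (`Operad.CyclicStructure.act_comp_eq`), so at most one structure on `H Lie`
extends the given ones. For existence, the structure on trees with hairs is transported along `Φ`.
It restricts correctly to `Lie` because moving the root does not touch the labels of hairs. On `H`,
exchanging the two ends of a line with one hair reverses the cyclic order at the vertex, and
antisymmetry gives the sign of the antipode on `V`; several hairs are met in the opposite order, as
the antipode demands (`act_unaryAction`, `tensorHom_act`). -/

namespace Operad

variable {k : Type u} [Field k]

/-! ### Elementary consequences of the operad laws -/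

section Basic

variable (P : Operad.{u, v} k)

theorem map_map {A B C : Type} [Finite A] [Finite B] [Finite C] (e : A ≃ B) (f : B ≃ C)
    (a : P.obj A) : P.map f (P.map e a) = P.map (e.trans f) a := (P.map_trans e f a).symm

theorem map_congr {A B : Type} [Finite A] [Finite B] {e f : A ≃ B} (h : ∀ x, e x = f x)
    (a : P.obj A) : P.map e a = P.map f a := by
  rw [Equiv.ext h]

theorem comp_map_left {A A' B : Type} [Finite A] [Finite A'] [Finite B] (e : A ≃ A')
    (a : P.obj (Option A)) (b : P.obj B) :
    P.comp (P.map (Equiv.optionCongr e) a) b =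
      P.map (Equiv.sumCongr e (Equiv.refl B)) (P.comp a b) := by
  rw [← P.comp_map, P.map_refl]

theorem comp_map_right {A B B' : Type} [Finite A] [Finite B] [Finite B'] (f : B ≃ B')
    (a : P.obj (Option A)) (b : P.obj B) :
    P.comp a (P.map f b) = P.map (Equiv.sumCongr (Equiv.refl A) f) (P.comp a b) := by
  rw [← P.comp_map, Equiv.optionCongr_refl, P.map_refl]

/-- A bijection that preserves the added point. -/
theorem exists_optionCongr {A B : Type} (e : Option A ≃ Option B) (he : e none = none) :
    ∃ f : A ≃ B, e = Equiv.optionCongr f := by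
  refine ⟨Equiv.removeNone e, ?_⟩
  ext1 x
  rcases x with _ | x
  · simp [he]
  · rw [Equiv.optionCongr_apply, Option.map_some, Equiv.removeNone_some e]
    rcases hx : e (some x) with _ | b
    · exact absurd (e.injective (hx.trans he.symm)) (by simp)
    · exact ⟨b, rfl⟩

/-- The definition of `insert` uses one particular way of splitting off the input. By equivariance
any bijection that sends this input to the added point serves equally well, which lets later
computations choose a convenient model. -/
theorem insert_eq {A A' : Type} [Finite A] [Finite A'] (e : A ≃ Option A') {i : A}
    (he : e i = none) (h : P.obj Unit) (a : P.obj A) :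
    P.insert i h a = P.map ((sumUnit A').trans e.symm) (P.comp (P.map e a) h) := by
  have hs : splitOff i i = none := by simp [splitOff]
  obtain ⟨f, hf⟩ := exists_optionCongr ((splitOff i).symm.trans e)
    (by rw [← hs]; simp [he])
  have he' : e = (splitOff i).trans (Equiv.optionCongr f) := by
    rw [← hf, ← Equiv.trans_assoc, Equiv.self_trans_symm, Equiv.refl_trans]
  subst he'
  rw [P.map_trans (splitOff i), comp_map_left, map_map]
  refine P.map_congr (fun x => ?_) _
  rw [Equiv.trans_apply, Equiv.trans_apply, Equiv.trans_apply, Equiv.symm_apply_eq,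
    Equiv.symm_trans_apply, Equiv.apply_symm_apply, Equiv.eq_symm_apply]
  rcases x with x | x <;> simp [sumUnit]

/-- Composition of a unary operation with an arbitrary one. -/
def unaryComp {A : Type} [Finite A] : P.obj Unit →ₗ[k] P.obj A →ₗ[k] P.obj A :=
  ((P.comp ∘ₗ P.map unitOpt).compr₂ (P.map (Equiv.emptySum Empty A)))

theorem unaryComp_apply {A : Type} [Finite A] (h : P.obj Unit) (a : P.obj A) :
    P.unaryComp h a = P.map (Equiv.emptySum Empty A) (P.comp (P.map unitOpt h) a) := rfl

theorem insert_one {A : Type} [Finite A] (i : A) (a : P.obj A) : P.insert i P.one a = a := by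
  rw [P.insert_eq (splitOff i) (by simp [splitOff]), P.map_trans, P.comp_one, map_map,
    Equiv.self_trans_symm, P.map_refl]

theorem map_unaryComp {A B : Type} [Finite A] [Finite B] (e : A ≃ B) (h : P.obj Unit)
    (a : P.obj A) : P.map e (P.unaryComp h a) = P.unaryComp h (P.map e a) := by
  rw [unaryComp_apply, unaryComp_apply, comp_map_right, map_map, map_map]
  congr 1
  congr 1
  ext1 x
  rcases x with x | x
  · exact x.elim
  · rfl

theorem map_insert {A B : Type} [Finite A] [Finite B] (e : A ≃ B) (i : A) (h : P.obj Unit)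
    (a : P.obj A) : P.map e (P.insert i h a) = P.insert (e i) h (P.map e a) := by
  rw [P.insert_eq (splitOff i) (by simp [splitOff]),
    P.insert_eq (e.symm.trans (splitOff i)) (by simp [splitOff]), map_map, map_map,
    ← Equiv.trans_assoc e, Equiv.self_trans_symm, Equiv.refl_trans]
  rfl

/-- Associativity: an element placed at the slot where `b` is grafted can equally be composed with
the root of `b`. This is how inserted elements cross a grafting. -/
theorem comp_insert_none {A B : Type} [Finite A] [Finite B] (a : P.obj (Option A))
    (h : P.obj Unit) (b : P.obj B) :
    P.comp (P.insert none h a) b = P.comp a (P.unaryComp h b) := by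
  rw [P.insert_eq (Equiv.refl _) rfl, P.map_refl, unaryComp_apply, comp_map_right,
    ← P.comp_assoc, comp_map_right, map_map, map_map]
  have : (Equiv.sumCongr (Equiv.refl A) unitOpt).trans (optSumR A Empty) =
      ((sumUnit A).trans (Equiv.refl _).symm).trans
        (Equiv.optionCongr (Equiv.sumEmpty A Empty).symm) := by
    ext1 x
    rcases x with x | x <;> rfl
  rw [this, P.map_trans _ (Equiv.optionCongr _), comp_map_left, map_map, eq_comm]
  refine Eq.trans (P.map_congr (fun x => ?_) _) (P.map_refl _)
  rcases x with x | x <;> rfl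

theorem comp_insert_right {A B : Type} [Finite A] [Finite B] (a : P.obj (Option A))
    (i : B) (h : P.obj Unit) (b : P.obj B) :
    P.comp a (P.insert i h b) = P.insert (Sum.inr i) h (P.comp a b) := by
  set S := splitOff i with hS
  have hi : S i = none := by simp [hS, splitOff]
  rw [P.insert_eq S hi, comp_map_right, ← P.comp_assoc, map_map,
    P.insert_eq ((Equiv.sumCongr (Equiv.refl A) S).trans (optSumR A _))
      (by simp [hi, optSumR]), comp_map_right, map_map]
  have : (Equiv.sumAssoc A {x : B // x ≠ i} Unit).trans
      (Equiv.sumCongr (Equiv.refl A) ((sumUnit _).trans S.symm)) = 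
      (sumUnit _).trans ((Equiv.sumCongr (Equiv.refl A) S).trans (optSumR A _)).symm := by
    ext1 x
    rcases x with (x | x) | x <;> rfl
  rw [this]

theorem unaryComp_insert {A : Type} [Finite A] (g h : P.obj Unit) (i : A) (a : P.obj A) :
    P.unaryComp g (P.insert i h a) = P.insert i h (P.unaryComp g a) := by
  rw [unaryComp_apply, comp_insert_right, map_insert]
  rfl

/-- A bijection of a set with two distinct marked points. -/
theorem exists_split_two {A : Type} [Finite A] {i j : A} (hij : i ≠ j) :
    ∃ (A' : Type) (_ : Finite A') (e : A ≃ Option (Option A')), e i = none ∧ e j = some none := by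
  have hi : splitOff i i = none := by simp [splitOff]
  obtain ⟨j', hj⟩ : ∃ j', splitOff i j = some j' :=
    Option.ne_none_iff_exists'.1 fun h => hij ((splitOff i).injective (hi.trans h.symm))
  refine ⟨_, inferInstance, (splitOff i).trans (Equiv.optionCongr (splitOff j')), by simp [hi], ?_⟩
  rw [Equiv.trans_apply, hj, Equiv.optionCongr_apply, Option.map_some]
  simp [splitOff]

/-- An instance of the parallel composition law, with two unary operations grafted at different
slots. -/
theorem insert_comm {A : Type} [Finite A] {i j : A} (hij : i ≠ j) (g h : P.obj Unit)
    (a : P.obj A) : P.insert i g (P.insert j h a) = P.insert j h (P.insert i g a) := by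
  obtain ⟨A', _, e, hi, hj⟩ := exists_split_two hij
  obtain ⟨b, rfl⟩ : ∃ b, P.map e.symm b = a := ⟨P.map e a, by rw [map_map, Equiv.self_trans_symm,
    P.map_refl]⟩
  have hi' : e.symm none = i := by rw [← hi, e.symm_apply_apply]
  have hj' : e.symm (some none) = j := by rw [← hj, e.symm_apply_apply]
  -- By equivariance the inputs `i` and `j` may be taken to be the two added points of `Option
  -- (Option A')`, where the parallel law applies literally.
  rw [← hi', ← hj', ← map_insert, ← map_insert, ← map_insert, ← map_insert]
  congr 1
  rw [P.insert_eq (optSwap A') (i := some none) rfl, P.insert_eq (optSwap A') (i := some none) rfl,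
    P.insert_eq (Equiv.refl _) (i := none) rfl, P.insert_eq (Equiv.refl _) (i := none) rfl,
    P.map_refl, P.map_refl]
  have h1 := P.comp_parallel b g h
  have e1 : ((sumUnit (Option A')).trans (Equiv.refl (Option (Option A'))).symm).trans
      (optSwap A') = (optSumL A' Unit).trans (Equiv.optionCongr (sumUnit A')) := by
    ext1 x
    rcases x with (_ | x) | x <;> rfl
  have e2 : (sumUnit (Option A')).trans (optSwap A').symm = 
    (optSumL A' Unit).trans (Equiv.optionCongr (sumUnit A')) := by
    ext1 x
    rcases x with (_ | x) | x <;> rfl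
  rw [map_map, e1, e2, P.map_trans _ (Equiv.optionCongr _) (P.comp (P.map (optSwap A') b) h),
    P.map_trans _ (Equiv.optionCongr _) (P.comp b g), comp_map_left, comp_map_left, ← h1, map_map, map_map, map_map]
  refine P.map_congr (fun x => ?_) _
  rcases x with (x | x) | x <;> rfl

theorem comp_insert_some {A B : Type} [Finite A] [Finite B] (a : P.obj (Option A))
    (i : A) (h : P.obj Unit) (b : P.obj B) :
    P.comp (P.insert (some i) h a) b = P.insert (Sum.inl i) h (P.comp a b) := by
  obtain ⟨A', _, e, hi⟩ : ∃ (A' : Type) (_ : Finite A') (e : A ≃ Option A'), e i = none :=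
    ⟨_, inferInstance, splitOff i, by simp [splitOff]⟩
  obtain ⟨a, rfl⟩ : ∃ b, P.map (Equiv.optionCongr e.symm) b = a :=
    ⟨P.map (Equiv.optionCongr e) a, by
      rw [map_map, ← Equiv.optionCongr_trans, Equiv.self_trans_symm, Equiv.optionCongr_refl,
        P.map_refl]⟩
  have hi' : e.symm none = i := by rw [← hi, e.symm_apply_apply]
  have hi'' : some i = (Equiv.optionCongr e.symm) (some none) := by
    rw [Equiv.optionCongr_apply, Option.map_some, hi']
  have hi3 : Sum.inl i = (Equiv.sumCongr e.symm (Equiv.refl B)) (Sum.inl none) := by simp [hi']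
  rw [hi'', ← map_insert, comp_map_left, comp_map_left, hi3, ← map_insert]
  congr 1
  rw [P.insert_eq (optSwap A') rfl, P.insert_eq (optSumL A' B) rfl]
  have h1 := P.comp_parallel a b h
  have e2 : (sumUnit (Option A')).trans (optSwap A').symm = 
    (optSumL A' Unit).trans (Equiv.optionCongr (sumUnit A')) := by
    ext1 x
    rcases x with (_ | x) | x <;> rfl
  rw [e2, P.map_trans, comp_map_left, ← h1, map_map]
  refine P.map_congr (fun x => ?_) _
  rcases x with (x | x) | x <;> rfl

/-- The order is reversed: in `g ∘ h` the factor `g` is the one next to `a`, so it is inserted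
first. Insertion at a fixed input is thus a right action of the unary operations. -/
theorem insert_unaryComp {A : Type} [Finite A] (i : A) (g h : P.obj Unit) (a : P.obj A) :
    P.insert i (P.unaryComp g h) a = P.insert i h (P.insert i g a) := by
  obtain ⟨A', _, e, hi⟩ : ∃ (A' : Type) (_ : Finite A') (e : A ≃ Option A'), e i = none :=
    ⟨_, inferInstance, splitOff i, by simp [splitOff]⟩
  rw [P.insert_eq e hi, P.insert_eq e hi, ← comp_insert_none]
  congr 2
  rw [map_insert, hi]

end Basic

end Operad

namespace Operad

variable {k : Type u} [Field k]

/-! ### Morphisms of operads -/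

/-- Morphisms of operads. -/
structure Hom (P : Operad.{u, v} k) (Q : Operad.{u, w} k) where
  app : ∀ (A : Type) [Finite A], P.obj A →ₗ[k] Q.obj A
  app_map : ∀ {A B : Type} [Finite A] [Finite B] (e : A ≃ B) (a : P.obj A),
    app B (P.map e a) = Q.map e (app A a)
  app_one : app Unit P.one = Q.one
  app_comp : ∀ {A B : Type} [Finite A] [Finite B] (a : P.obj (Option A)) (b : P.obj B),
    app (A ⊕ B) (P.comp a b) = Q.comp (app (Option A) a) (app B b)

namespace Hom

variable {P : Operad.{u, v} k} {Q : Operad.{u, w} k}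

theorem app_unaryComp (f : Hom P Q) {A : Type} [Finite A] (h : P.obj Unit) (a : P.obj A) :
    f.app A (P.unaryComp h a) = Q.unaryComp (f.app Unit h) (f.app A a) := by
  rw [unaryComp_apply, unaryComp_apply, f.app_map, f.app_comp, f.app_map]

theorem app_insert (f : Hom P Q) {A : Type} [Finite A] (i : A) (h : P.obj Unit) (a : P.obj A) :
    f.app A (P.insert i h a) = Q.insert i (f.app Unit h) (f.app A a) := by
  have hi : splitOff i i = none := by simp [splitOff]
  rw [P.insert_eq _ hi, Q.insert_eq _ hi, f.app_map, f.app_comp, f.app_map]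

/-- The kernel of a morphism of operads. -/
def ker (f : Hom P Q) : Ideal P where
  carrier A _ := LinearMap.ker (f.app A)
  map_mem e a ha := by
    rw [LinearMap.mem_ker] at ha ⊢
    rw [f.app_map, ha, map_zero]
  comp_mem_left b ha := by
    rw [LinearMap.mem_ker] at ha ⊢
    rw [f.app_comp, ha, map_zero, LinearMap.zero_apply]
  comp_mem_right a b hb := by
    rw [LinearMap.mem_ker] at hb ⊢
    rw [f.app_comp, hb, map_zero]

end Hom

theorem Ideal.subset_span (P : Operad.{u, v} k) (S : ∀ (A : Type) [Finite A], Set (P.obj A))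
    (A : Type) [Finite A] : S A ⊆ (Ideal.span P S).carrier A := by
  intro x hx
  refine Submodule.mem_sInf.2 ?_
  rintro _ ⟨I, hI, rfl⟩
  exact hI A hx

theorem Ideal.span_le {P : Operad.{u, v} k} {S : ∀ (A : Type) [Finite A], Set (P.obj A)}
    {I : Ideal P} (h : ∀ (A : Type) [Finite A], S A ⊆ I.carrier A) (A : Type) [Finite A] :
    (Ideal.span P S).carrier A ≤ I.carrier A :=
  sInf_le ⟨I, fun B _ => h B, rfl⟩

/-- The projection to a quotient. -/
def quotientHom (P : Operad.{u, v} k) (I : Ideal P) : Hom P (P.quotient I) where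
  app A _ := (I.carrier A).mkQ
  app_map _ _ := rfl
  app_one := rfl
  app_comp _ _ := rfl

/-- Morphisms out of a quotient. -/
def quotientLift {P : Operad.{u, v} k} {Q : Operad.{u, w} k} (I : Ideal P) (f : Hom P Q)
    (hf : ∀ (A : Type) [Finite A], I.carrier A ≤ f.ker.carrier A) : Hom (P.quotient I) Q where
  app A _ := (I.carrier A).liftQ (f.app A) (hf A)
  app_map e a := by
    induction a using Submodule.Quotient.induction_on with
    | _ a => exact f.app_map e a
  app_one := f.app_one
  app_comp a b := by
    induction a using Submodule.Quotient.induction_on with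
    | _ a =>
    induction b using Submodule.Quotient.induction_on with
    | _ b => exact f.app_comp a b

/-! ### Morphisms out of the operad freely generated by two operads -/

section FreeProd

variable {P : Operad.{u, v} k} {Q : Operad.{u, w} k} {R : Operad.{u, x} k}

/-- The value of a formal expression. -/
noncomputable def FreeProd.eval (f : Hom P R) (g : Hom Q R) {A : Type} (s : FreeProd.Term P Q A) :
    ∀ [Finite A], R.obj A :=
  -- Finiteness of the arity set is an argument of the motive, since zero, sums and multiples are
  -- formal expressions over arbitrary types while a value exists only over finite ones.
  FreeProd.Term.rec (motive := fun A _ => ∀ [Finite A], R.obj A) (fun a _ => f.app _ a)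
    (fun a _ => g.app _ a) (fun e _ ih _ => R.map e ih) (fun _ _ ih ih' _ => R.comp ih ih')
    (fun _ _ => 0) (fun _ _ ih ih' _ => ih + ih') (fun c _ ih _ => c • ih) s

theorem FreeProd.eval_eq (f : Hom P R) (g : Hom Q R) {A : Type} {s t : FreeProd.Term P Q A}
    (h : FreeProd.Rel P Q s t) : ∀ [Finite A], FreeProd.eval f g s = FreeProd.eval f g t := by
  induction h <;> intro _
  case refl s => rfl
  case symm ih _ => exact ih.symm
  case trans ih ih' _ => exact ih.trans ih'
  case map_congr e _ _ _ ih _ => exact congrArg (R.map e) ih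
  case comp_congr ih ih' _ => exact congrArg₂ (fun x y => R.comp x y) ih ih'
  case add_congr ih ih' _ => exact congrArg₂ (· + ·) ih ih'
  case smul_congr c _ _ _ ih _ => exact congrArg (c • ·) ih
  case add_comm => exact _root_.add_comm _ _
  case add_assoc => exact _root_.add_assoc _ _ _
  case zero_add => exact _root_.zero_add _
  case neg_add s _ => exact (congrArg (· + _) (neg_one_smul k (eval f g s))).trans (neg_add_cancel _)
  case smul_add => exact _root_.smul_add _ _ _
  case add_smul => exact _root_.add_smul _ _ _
  case mul_smul => exact SemigroupAction.mul_smul _ _ _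
  case one_smul => exact _root_.one_smul _ _
  case map_add => exact _root_.map_add _ _ _
  case map_smul => exact _root_.map_smul _ _ _
  case add_comp => exact LinearMap.map_add₂ _ _ _ _
  case smul_comp => exact LinearMap.map_smul₂ _ _ _ _
  case comp_add => exact _root_.map_add _ _ _
  case comp_smul => exact _root_.map_smul _ _ _
  case map_refl => exact R.map_refl _
  case map_trans => exact R.map_trans _ _ _
  case comp_map => exact R.comp_map _ _ _ _
  case one_comp =>
    refine Eq.trans ?_ (R.one_comp _)
    rw [← f.app_one]
    rfl
  case comp_one =>
    refine Eq.trans ?_ (R.comp_one _)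
    rw [← f.app_one]
    rfl
  case comp_assoc => exact R.comp_assoc _ _ _
  case comp_parallel => exact R.comp_parallel _ _ _
  case inl_add => exact _root_.map_add _ _ _
  case inl_smul => exact _root_.map_smul _ _ _
  case inl_map => exact f.app_map _ _
  case inl_comp => exact f.app_comp _ _
  case inr_add => exact _root_.map_add _ _ _
  case inr_smul => exact _root_.map_smul _ _ _
  case inr_map => exact g.app_map _ _
  case inr_comp => exact g.app_comp _ _
  case inl_one => exact f.app_one.trans g.app_one.symm

/-- The universal property of the operad freely generated by two operads. -/
noncomputable def freeProdLift (f : Hom P R) (g : Hom Q R) : Hom (freeProd P Q) R where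
  app A _ :=
    { toFun := Quotient.lift (s := FreeProd.setoid P Q A) (fun s => FreeProd.eval f g s)
        fun _ _ h => FreeProd.eval_eq f g h
      map_add' := fun x y => by
        induction x using FreeProd.ind; induction y using FreeProd.ind
        rfl
      map_smul' := fun c x => by
        induction x using FreeProd.ind
        rfl }
  app_map e x := by
    induction x using FreeProd.ind
    rfl
  app_one := f.app_one
  app_comp x y := by
    induction x using FreeProd.ind; induction y using FreeProd.ind
    rfl

variable (P Q) in
/-- `freeProd.inl` as a morphism of operads. -/
def freeProd.inlHom : Hom P (freeProd P Q) where
  app := freeProd.inl P Q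
  app_map _ _ := FreeProd.mk_eq (.inl_map _ _)
  app_one := rfl
  app_comp _ _ := FreeProd.mk_eq (.inl_comp _ _)

variable (P Q) in
/-- `freeProd.inr` as a morphism of operads. -/
def freeProd.inrHom : Hom Q (freeProd P Q) where
  app := freeProd.inr P Q
  app_map _ _ := FreeProd.mk_eq (.inr_map _ _)
  app_one := (FreeProd.mk_eq .inl_one).symm
  app_comp _ _ := FreeProd.mk_eq (.inr_comp _ _)

theorem freeProd_induction {p : ∀ (A : Type) [Finite A], (freeProd P Q).obj A → Prop}
    (inl : ∀ (A : Type) [Finite A] (a : P.obj A), p A (freeProd.inl P Q A a))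
    (inr : ∀ (A : Type) [Finite A] (a : Q.obj A), p A (freeProd.inr P Q A a))
    (map : ∀ (A B : Type) [Finite A] [Finite B] (e : A ≃ B) (x : (freeProd P Q).obj A),
      p A x → p B ((freeProd P Q).map e x))
    (comp : ∀ (A B : Type) [Finite A] [Finite B] (x : (freeProd P Q).obj (Option A))
      (y : (freeProd P Q).obj B), p (Option A) x → p B y → p (A ⊕ B) ((freeProd P Q).comp x y))
    (zero : ∀ (A : Type) [Finite A], p A 0)
    (add : ∀ (A : Type) [Finite A] (x y : (freeProd P Q).obj A), p A x → p A y → p A (x + y))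
    (smul : ∀ (A : Type) [Finite A] (c : k) (x : (freeProd P Q).obj A), p A x → p A (c • x))
    (A : Type) [Finite A] (x : (freeProd P Q).obj A) : p A x := by
  induction x using FreeProd.ind with
  | _ s =>
  revert ‹Finite A›
  induction s with
  | inl a => exact inl _ a
  | inr a => exact inr _ a
  | map e s ih => exact map _ _ e _ ih
  | comp s t ih ih' => exact comp _ _ _ _ ih ih'
  | zero => exact zero _
  | add s t ih ih' => exact add _ _ _ ih ih'
  | smul c s ih => exact smul _ c _ ih

end FreeProd

end Operad

/-! ### Inserting the iterated coproduct -/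

section Spread

open TensorProduct

variable {k : Type u} [Field k] {H : Type v} [Ring H] [HopfAlgebra k H]

theorem spread_cons (P : Operad.{u, w} k) (j : H →ₗ[k] P.obj Unit) {A : Type} [Finite A] (i : A)
    (l : List A) (h : H) (a : P.obj A) :
    spread k H P j (i :: l) h a = TensorProduct.lift
      ((LinearMap.mul k (Module.End k (P.obj A))).compl₁₂ (P.insert i ∘ₗ j) (spread k H P j l))
      (Coalgebra.comul h) a := rfl

/-- A property of the operations that is closed under insertion of elements of `H` is closed
under insertion of the iterated coproduct. -/
theorem spread_mem (P : Operad.{u, w} k) (j : H →ₗ[k] P.obj Unit) {A : Type} [Finite A]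
    (N : Submodule k (P.obj A)) (hN : ∀ i h, ∀ a ∈ N, P.insert i (j h) a ∈ N) (l : List A) (h : H)
    {a : P.obj A} (ha : a ∈ N) : spread k H P j l h a ∈ N := by
  induction l generalizing h with
  | nil => exact N.smul_mem _ ha
  | cons i l ih =>
    rw [spread_cons]
    induction Coalgebra.comul (R := k) h using TensorProduct.induction_on with
    | zero => simp
    | tmul x y => exact hN i x _ (ih y)
    | add x y hx hy => rw [map_add, LinearMap.add_apply]; exact N.add_mem hx hy

theorem Operad.Hom.app_spread {P : Operad.{u, w} k} {Q : Operad.{u, x} k} (f : Operad.Hom P Q)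
    (j : H →ₗ[k] P.obj Unit) {A : Type} [Finite A] (l : List A) (h : H) (a : P.obj A) :
    f.app A (spread k H P j l h a) = spread k H Q (f.app Unit ∘ₗ j) l h (f.app A a) := by
  induction l generalizing h with
  | nil => exact map_smul _ _ _
  | cons i l ih =>
    rw [spread_cons, spread_cons]
    induction Coalgebra.comul (R := k) h using TensorProduct.induction_on with
    | zero => simp
    | tmul x y =>
      change f.app A (P.insert i (j x) (spread k H P j l y a)) = Q.insert i (f.app Unit (j x))
        (spread k H Q (f.app Unit ∘ₗ j) l y (f.app A a))
      rw [f.app_insert, ih]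
    | add x y hx hy => rw [map_add, map_add, LinearMap.add_apply, LinearMap.add_apply, map_add, hx, hy]

theorem algebraOperad_unaryComp (g h : H) :
    (algebraOperad k H).unaryComp (algebraOperadUnary k g) (algebraOperadUnary k h) =
      algebraOperadUnary k (g * h) := rfl

end Spread

/-! ### The universal property of `H𝒪` and its generation -/

namespace hopfOperad

open Operad

section

variable (k : Type u) [Field k] (H : Type v) [Ring H] [HopfAlgebra k H] (O : Operad.{u, w} k)

/-- `ofHopf` as a morphism of operads. -/
def hopfHom : Hom (algebraOperad k H) (hopfOperad k H O) where
  app A _ := ofHopf k H O A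
  app_map e a := congrArg ((quotientHom _ _).app _) ((freeProd.inlHom _ O).app_map e a)
  app_one := rfl
  app_comp a b := congrArg ((quotientHom _ _).app _) ((freeProd.inlHom _ O).app_comp a b)

/-- `ofOperad` as a morphism of operads. -/
def operadHom : Hom O (hopfOperad k H O) where
  app A _ := ofOperad k H O A
  app_map e a := congrArg ((quotientHom _ _).app _) ((freeProd.inrHom (algebraOperad k H) O).app_map e a)
  app_one := congrArg ((quotientHom _ _).app _) ((freeProd.inrHom (algebraOperad k H) O).app_one)
  app_comp a b :=
    congrArg ((quotientHom _ _).app _) ((freeProd.inrHom (algebraOperad k H) O).app_comp a b)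

/-- Elements of `H` as unary operations of `H𝒪`. -/
def unary : H →ₗ[k] (hopfOperad k H O).obj Unit := ofHopf k H O Unit ∘ₗ algebraOperadUnary k

theorem unary_mul (g h : H) :
    unary k H O (g * h) = (hopfOperad k H O).unaryComp (unary k H O g) (unary k H O h) :=
  (congrArg _ (algebraOperad_unaryComp g h).symm).trans ((hopfHom k H O).app_unaryComp _ _)

theorem unary_one : unary k H O 1 = (hopfOperad k H O).one := rfl

/-- The defining relation of the quotient; the projection is a morphism of operads, so it carries
the inserted coproduct to the inserted coproduct. -/
theorem unaryComp_ofOperad {A : Type} [Finite A] (h : H) (o : O.obj A) {l : List A}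
    (hl : l.Nodup) (hl' : ∀ i, i ∈ l) :
    (hopfOperad k H O).unaryComp (unary k H O h) (ofOperad k H O A o) =
      spread k H (hopfOperad k H O) (unary k H O) l h (ofOperad k H O A o) := by
  have h1 := Operad.Ideal.subset_span _ (fun A _ => commutationRelations k H O A) A
    ⟨h, o, l, hl, hl', rfl⟩
  have h2 := (Submodule.Quotient.mk_eq_zero _).2 h1
  refine (sub_eq_zero.1 ((map_sub (Submodule.mkQ _) _ _).symm.trans h2)).trans ?_
  exact (quotientHom _ _).app_spread (hopfInFree k H O) l h (freeProd.inr (algebraOperad k H) O A o)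

variable {k H O}

theorem induction {p : ∀ (A : Type) [Finite A], (hopfOperad k H O).obj A → Prop}
    (hopf : ∀ (A : Type) [Finite A] (a : (algebraOperad k H).obj A), p A (ofHopf k H O A a))
    (oper : ∀ (A : Type) [Finite A] (a : O.obj A), p A (ofOperad k H O A a))
    (map : ∀ (A B : Type) [Finite A] [Finite B] (e : A ≃ B) (x : (hopfOperad k H O).obj A),
      p A x → p B ((hopfOperad k H O).map e x))
    (comp : ∀ (A B : Type) [Finite A] [Finite B] (x : (hopfOperad k H O).obj (Option A))
      (y : (hopfOperad k H O).obj B), p (Option A) x → p B y →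
        p (A ⊕ B) ((hopfOperad k H O).comp x y))
    (zero : ∀ (A : Type) [Finite A], p A 0)
    (add : ∀ (A : Type) [Finite A] (x y : (hopfOperad k H O).obj A), p A x → p A y → p A (x + y))
    (smul : ∀ (A : Type) [Finite A] (c : k) (x : (hopfOperad k H O).obj A), p A x → p A (c • x))
    (A : Type) [Finite A] (x : (hopfOperad k H O).obj A) : p A x := by
  obtain ⟨y, rfl⟩ := Submodule.mkQ_surjective _ x
  exact freeProd_induction (p := fun A _ y => p A (Submodule.mkQ _ y)) (fun A _ a => hopf A a)
    (fun A _ a => oper A a) (fun A B _ _ e x hx => map A B e _ hx)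
    (fun A B _ _ x y hx hy => comp A B _ _ hx hy) (fun A _ => zero A)
    (fun A _ x y hx hy => add A _ _ hx hy) (fun A _ c x hx => smul A c _ hx) A y

/-- The universal property of `H𝒪`. -/
theorem exists_lift {R : Operad.{u, x} k} (f : Hom (algebraOperad k H) R) (g : Hom O R)
    (hfg : ∀ (A : Type) [Finite A] (h : H) (o : O.obj A) (l : List A), l.Nodup → (∀ i, i ∈ l) →
      R.unaryComp (f.app Unit (algebraOperadUnary k h)) (g.app A o) =
        spread k H R (f.app Unit ∘ₗ algebraOperadUnary k) l h (g.app A o)) :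
    ∃ F : Hom (hopfOperad k H O) R,
      (∀ (A : Type) [Finite A] (a : (algebraOperad k H).obj A),
        F.app A (ofHopf k H O A a) = f.app A a) ∧
      ∀ (A : Type) [Finite A] (a : O.obj A), F.app A (ofOperad k H O A a) = g.app A a := by
  -- The kernel of the induced morphism is an operadic ideal, so it contains the ideal generated by
  -- the relations as soon as it contains the relations.
  suffices hS : ∀ (A : Type) [Finite A],
      commutationRelations k H O A ⊆ (freeProdLift f g).ker.carrier A from
    ⟨quotientLift _ (freeProdLift f g) (fun A _ => Operad.Ideal.span_le hS A),
      fun A _ a => rfl, fun A _ a => rfl⟩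
  rintro A _ _ ⟨h, o, l, hl, hl', rfl⟩
  refine LinearMap.mem_ker.2 ?_
  rw [map_sub, sub_eq_zero, Hom.app_spread]
  refine ((freeProdLift f g).app_unaryComp (hopfInFree k H O h)
    (freeProd.inr (algebraOperad k H) O A o)).trans ?_
  exact hfg A h o l hl hl'

/-- The operations obtained from those of `𝒪` by inserting elements of `H` at the inputs. -/
inductive InsertSpan : ∀ {A : Type} [Finite A], (hopfOperad k H O).obj A → Prop
  | of {A : Type} [Finite A] (o : O.obj A) : InsertSpan (ofOperad k H O A o)
  | insert {A : Type} [Finite A] (i : A) (h : H) {x : (hopfOperad k H O).obj A} :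
      InsertSpan x → InsertSpan ((hopfOperad k H O).insert i (unary k H O h) x)
  | zero {A : Type} [Finite A] : InsertSpan (0 : (hopfOperad k H O).obj A)
  | add {A : Type} [Finite A] {x y : (hopfOperad k H O).obj A} :
      InsertSpan x → InsertSpan y → InsertSpan (x + y)
  | smul {A : Type} [Finite A] (c : k) {x : (hopfOperad k H O).obj A} :
      InsertSpan x → InsertSpan (c • x)

/-! ### Closure of the span of insertions under the operad structure -/

namespace InsertSpan

theorem map {A B : Type} [Finite A] [Finite B] (e : A ≃ B) {x : (hopfOperad k H O).obj A}
    (hx : InsertSpan x) : InsertSpan ((hopfOperad k H O).map e x) := by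
  induction hx generalizing B with
  | of o =>
    have : (hopfOperad k H O).map e (ofOperad k H O _ o) = ofOperad k H O _ (O.map e o) :=
      ((operadHom k H O).app_map e o).symm
    rw [this]; exact .of _
  | insert i h _ ih => rw [map_insert]; exact (ih e).insert _ _
  | zero => rw [map_zero]; exact .zero
  | add _ _ ih ih' => rw [map_add]; exact (ih e).add (ih' e)
  | smul c _ ih => rw [map_smul]; exact (ih e).smul c

/-- An element of `H` at the root passes by the insertions already present, since these sit at the
inputs, until it meets an operation of `𝒪`. There the commutation relation spreads it over the
inputs. -/
theorem unaryComp {A : Type} [Finite A] (h : H) {x : (hopfOperad k H O).obj A}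
    (hx : InsertSpan x) : InsertSpan ((hopfOperad k H O).unaryComp (unary k H O h) x) := by
  induction hx generalizing h with
  | of o =>
    have := Fintype.ofFinite ‹Type›
    rw [unaryComp_ofOperad k H O h o Finset.univ.nodup_toList (by simp)]
    exact spread_mem _ _
      { carrier := {x | InsertSpan x}
        add_mem' := fun hx hy => hx.add hy
        zero_mem' := .zero
        smul_mem' := fun c _ hx => hx.smul c } (fun i h a ha => InsertSpan.insert i h ha) _ _ (.of o)
  | insert i g _ ih => rw [unaryComp_insert]; exact (ih h).insert _ _
  | zero => rw [map_zero]; exact .zero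
  | add _ _ ih ih' => rw [map_add]; exact (ih h).add (ih' h)
  | smul c _ ih => rw [map_smul]; exact (ih h).smul c

theorem comp_of {A B : Type} [Finite A] [Finite B] (o : O.obj (Option A))
    {y : (hopfOperad k H O).obj B} (hy : InsertSpan y) :
    InsertSpan ((hopfOperad k H O).comp (ofOperad k H O _ o) y) := by
  induction hy with
  | of o' =>
    rw [show (hopfOperad k H O).comp (ofOperad k H O _ o) (ofOperad k H O _ o') =
      ofOperad k H O _ (O.comp o o') from ((operadHom k H O).app_comp o o').symm]
    exact .of _
  | insert i h _ ih => rw [comp_insert_right]; exact ih.insert _ _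
  | zero => rw [map_zero]; exact .zero
  | add _ _ ih ih' => rw [map_add]; exact ih.add ih'
  | smul c _ ih => rw [map_smul]; exact ih.smul c

/-- The bijection `e` frees the arity of `x` from the shape `Option A`, so that induction on `x` is
possible. An element inserted at the slot that receives `y` moves to the root of `y` and is absorbed
there by `unaryComp`; the other insertions stay outside the composition. -/
theorem comp_map {A B C : Type} [Finite A] [Finite B] [Finite C] {x : (hopfOperad k H O).obj C}
    {y : (hopfOperad k H O).obj B} (hx : InsertSpan x) (hy : InsertSpan y) (e : C ≃ Option A) :
    InsertSpan ((hopfOperad k H O).comp ((hopfOperad k H O).map e x) y) := by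
  induction hx generalizing A B with
  | of o =>
    rw [show (hopfOperad k H O).map e (ofOperad k H O _ o) = ofOperad k H O _ (O.map e o) from
      ((operadHom k H O).app_map e o).symm]
    exact comp_of _ hy
  | insert i h _ ih =>
    rw [map_insert]
    rcases e i with _ | j
    · rw [comp_insert_none]
      exact ih (hy.unaryComp h) e
    · rw [comp_insert_some]
      exact (ih hy e).insert _ _
  | zero => rw [map_zero, LinearMap.map_zero₂]; exact .zero
  | add _ _ ih ih' => rw [map_add, LinearMap.map_add₂]; exact (ih hy e).add (ih' hy e)
  | smul c _ ih => rw [map_smul, LinearMap.map_smul₂]; exact (ih hy e).smul c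

theorem comp {A B : Type} [Finite A] [Finite B] {x : (hopfOperad k H O).obj (Option A)}
    {y : (hopfOperad k H O).obj B} (hx : InsertSpan x) (hy : InsertSpan y) :
    InsertSpan ((hopfOperad k H O).comp x y) := by
  have := comp_map hx hy (Equiv.refl _)
  rwa [(hopfOperad k H O).map_refl] at this

end InsertSpan

/-- `H𝒪` is spanned by the operations obtained from those of `𝒪` by inserting elements of `H`. -/
theorem insertSpan (A : Type) [Finite A] (x : (hopfOperad k H O).obj A) : InsertSpan x := by
  refine induction (p := fun A _ x => InsertSpan x) ?_ (fun A _ o => .of o)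
    (fun A B _ _ e x hx => hx.map e) (fun A B _ _ x y hx hy => hx.comp hy) (fun A _ => .zero)
    (fun A _ x y hx hy => hx.add hy) (fun A _ c x hx => hx.smul c) A x
  intro A _ a
  -- An element of `H` is zero in any arity other than one. In arity one it is a renamed unary
  -- operation.
  by_cases hA : Nat.card A = 1
  · have := (Nat.card_eq_one_iff_unique.1 hA).1
    obtain ⟨a₀⟩ := (Nat.card_eq_one_iff_unique.1 hA).2
    let e : Unit ≃ A := ⟨fun _ => a₀, fun _ => (), fun _ => rfl, fun _ => Subsingleton.elim _ _⟩
    have h1 : ofHopf k H O A a = (hopfOperad k H O).map e (unary k H O a.1) :=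
      (hopfHom k H O).app_map e (algebraOperadUnary k a.1)
    -- Writing `h` as `h ∘ 1`, with the unit regarded as an operation of `𝒪`, allows `h` to be moved
    -- from the root to the input.
    have h2 : unary k H O a.1 = (hopfOperad k H O).unaryComp (unary k H O a.1)
      (ofOperad k H O Unit O.one) := by
      rw [show ofOperad k H O Unit O.one = unary k H O 1 from (operadHom k H O).app_one,
        ← unary_mul, mul_one]
    rw [h1, h2]
    exact ((InsertSpan.of _).unaryComp _).map e
  · have h0 : a = 0 := Subtype.ext (a.2 hA)
    rw [h0, map_zero]
    exact .zero

end

end hopfOperad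

/-! ### The Lie algebra of all trees -/

/-- The space spanned by all trees, in which inputs may be missing or repeated, modulo
antisymmetry, IHX and multilinearity. -/
def TreeLie (k : Type u) [Field k] {D : Type v} {W : Type w} [AddCommGroup W] [Module k W]
    (ℓ : D → W) (A : Type) : Type (max u v) :=
  (HTree A D →₀ k) ⧸ TreeOperad.relSpan k ℓ A

namespace TreeLie

open HTree TreeOperad
open Finsupp hiding some

variable {k : Type u} [Field k] {D : Type v} {W : Type w} [AddCommGroup W] [Module k W]
  {ℓ : D → W} {A B : Type}

theorem _root_.Finsupp.linearCombination_mapDomain_of_comp {R M N α β : Type*} [CommRing R]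
    [AddCommGroup M] [Module R M] [AddCommGroup N] [Module R N] {F : β → N} {G : α → M}
    (T : M →ₗ[R] N) {φ : α → β} (h : ∀ a, F (φ a) = T (G a)) (p : α →₀ R) :
    linearCombination R F (p.mapDomain φ) = T (linearCombination R G p) := by
  rw [linearCombination_mapDomain, show F ∘ φ = T ∘ G from funext h, linearCombination_linear_comp,
    LinearMap.comp_apply]

/-- Serves the Leibniz rule, where the value on a joined tree is a sum of two terms that depend
linearly on different functions of the factor. -/
theorem _root_.Finsupp.linearCombination_mapDomain_of_add {R M M' N α β : Type*} [CommRing R]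
    [AddCommGroup M] [Module R M] [AddCommGroup M'] [Module R M'] [AddCommGroup N] [Module R N]
    {F : β → N} {G : α → M} {G' : α → M'} (T : M →ₗ[R] N) (T' : M' →ₗ[R] N) {φ : α → β}
    (h : ∀ a, F (φ a) = T (G a) + T' (G' a)) (p : α →₀ R) :
    linearCombination R F (p.mapDomain φ) =
      T (linearCombination R G p) + T' (linearCombination R G' p) := by
  induction p using Finsupp.induction_linear with
  | zero => simp
  | add p q hp hq => simp only [mapDomain_add, map_add, hp, hq]; abel
  | single a c => simp [mapDomain_single, h]

noncomputable instance : AddCommGroup (TreeLie k ℓ A) :=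
  inferInstanceAs (AddCommGroup ((HTree A D →₀ k) ⧸ relSpan k ℓ A))

noncomputable instance : Module k (TreeLie k ℓ A) :=
  inferInstanceAs (Module k ((HTree A D →₀ k) ⧸ relSpan k ℓ A))

variable (k ℓ) in
/-- The class of a tree. -/
noncomputable def of (t : HTree A D) : TreeLie k ℓ A :=
  (relSpan k ℓ A).mkQ (single t 1)

variable (k ℓ A) in
/-- The class of a linear combination of trees. -/
noncomputable def proj : (HTree A D →₀ k) →ₗ[k] TreeLie k ℓ A := (relSpan k ℓ A).mkQ

theorem linearCombination_of (p : HTree A D →₀ k) :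
    linearCombination k (of k ℓ) p = proj k ℓ A p := by
  induction p using Finsupp.induction_linear with
  | zero => simp
  | add p q hp hq => rw [map_add, map_add, hp, hq]
  | single t c =>
    rw [linearCombination_single, ← smul_single_one, map_smul]
    rfl

theorem linearCombination_of_eq_zero {p : HTree A D →₀ k} (h : Rel ℓ p) :
    linearCombination k (of k ℓ) p = 0 := by
  rw [linearCombination_of]
  exact (Submodule.Quotient.mk_eq_zero _).2 (mem_relSpan h)

/-- A linear map out of the space of all trees. -/
noncomputable def lift {M : Type*} [AddCommGroup M] [Module k M] (f : HTree A D → M)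
    (hf : ∀ p : HTree A D →₀ k, Rel ℓ p → linearCombination k f p = 0) : TreeLie k ℓ A →ₗ[k] M :=
  (relSpan k ℓ A).liftQ (linearCombination k f) (Submodule.span_le.2 fun p hp => hf p hp)

theorem lift_of {M : Type*} [AddCommGroup M] [Module k M] (f : HTree A D → M)
    (hf : ∀ p : HTree A D →₀ k, Rel ℓ p → linearCombination k f p = 0) (t : HTree A D) :
    lift f hf (of k ℓ t) = f t := by
  refine (Submodule.liftQ_apply _ _ _).trans ?_
  rw [linearCombination_single, one_smul]

theorem ind {p : TreeLie k ℓ A → Prop} (of : ∀ t, p (of k ℓ t))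
    (add : ∀ x y, p x → p y → p (x + y)) (smul : ∀ (c : k) x, p x → p (c • x)) (zero : p 0)
    (x : TreeLie k ℓ A) : p x := by
  obtain ⟨x, rfl⟩ := Submodule.mkQ_surjective _ x
  induction x using Finsupp.induction_linear with
  | zero => exact zero
  | add x y hx hy => rw [map_add]; exact add _ _ hx hy
  | single t c => rw [← smul_single_one, map_smul]; exact smul c _ (of t)

theorem hom_ext {M : Type*} [AddCommGroup M] [Module k M] {f g : TreeLie k ℓ A →ₗ[k] M}
    (h : ∀ t, f (of k ℓ t) = g (of k ℓ t)) : f = g := by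
  refine LinearMap.ext fun x => ?_
  induction x using ind with
  | of t => exact h t
  | add x y hx hy => rw [map_add, map_add, hx, hy]
  | smul c x hx => rw [map_smul, map_smul, hx]
  | zero => rw [map_zero, map_zero]

/-- Joining a tree on the left. -/
noncomputable def joinLeft (s : HTree A D) : TreeLie k ℓ A →ₗ[k] TreeLie k ℓ A :=
  lift (fun t => of k ℓ (node s t)) fun p hp => by
    have := linearCombination_of_eq_zero (hp.right s)
    rwa [linearCombination_mapDomain] at this

/-- Joining two trees. -/
noncomputable def join : TreeLie k ℓ A →ₗ[k] TreeLie k ℓ A →ₗ[k] TreeLie k ℓ A :=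
  lift joinLeft fun p hp => by
    refine hom_ext fun t => ?_
    have h1 := linearCombination_of_eq_zero (hp.left t)
    let T : (TreeLie k ℓ A →ₗ[k] TreeLie k ℓ A) →ₗ[k] TreeLie k ℓ A :=
      LinearMap.applyₗ (of k ℓ t)
    have h2 : linearCombination k (T ∘ joinLeft) p = T (linearCombination k joinLeft p) := by
      rw [linearCombination_linear_comp, LinearMap.comp_apply]
    refine h2.symm.trans (Eq.trans ?_ h1)
    rw [linearCombination_mapDomain]
    refine congrArg (fun f => linearCombination k f p) (funext fun s => ?_)
    change joinLeft s (of k ℓ t) = of k ℓ (node s t)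
    rw [joinLeft, lift_of]

theorem join_of (s t : HTree A D) : join (of k ℓ s) (of k ℓ t) = of k ℓ (node s t) := by
  rw [join, lift_of, joinLeft, lift_of]

theorem join_skew (x y : TreeLie k ℓ A) : join x y + join y x = 0 := by
  induction x using ind with
  | of s =>
    induction y using ind with
    | of t =>
      have := linearCombination_of_eq_zero (Rel.as (k := k) (ℓ := ℓ) s t)
      simpa [join_of] using this
    | add x y hx hy =>
      rw [map_add, map_add, LinearMap.add_apply, add_add_add_comm, hx, hy, add_zero]
    | smul c x hx => rw [map_smul, map_smul, LinearMap.smul_apply, ← smul_add, hx, smul_zero]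
    | zero => simp
  | add x x' hx hx' =>
    rw [map_add, map_add, LinearMap.add_apply, add_add_add_comm, hx, hx', add_zero]
  | smul c x hx => rw [map_smul, map_smul, LinearMap.smul_apply, ← smul_add, hx, smul_zero]
  | zero => simp

/-- IHX is the Jacobi identity, read here as the statement that joining with `x` is a derivation;
trilinearity reduces it to trees. -/
theorem join_leibniz (x y z : TreeLie k ℓ A) :
    join x (join y z) = join (join x y) z + join y (join x z) := by
  induction x using ind with
  | of s =>
    induction y using ind with
    | of t =>
      induction z using ind with
      | of r =>
        have := linearCombination_of_eq_zero (Rel.ihx (k := k) (ℓ := ℓ) s t r)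
        simp only [map_add, map_sub, linearCombination_single, one_smul] at this
        rw [join_of, join_of, join_of, join_of, join_of, join_of, ← sub_eq_zero, ← neg_eq_zero,
          ← this]
        abel
      | add x y hx hy => simp only [map_add, hx, hy]; abel
      | smul c x hx => simp only [map_smul, hx, smul_add]
      | zero => simp
    | add x y hx hy => simp only [map_add, LinearMap.add_apply, hx, hy]; abel
    | smul c x hx => simp only [map_smul, LinearMap.smul_apply, hx, smul_add]
    | zero => simp
  | add x y hx hy => simp only [map_add, LinearMap.add_apply, hx, hy]; abel
  | smul c x hx => simp only [map_smul, LinearMap.smul_apply, hx, smul_add]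
  | zero => simp

/-! ### Values of trees in a Lie algebra -/

section Eval

variable {L : Type*} [LieRing L] [LieAlgebra k L]

/-- The value of a tree in a Lie algebra. -/
def evalTree (f : A → L) (g : D → L) : HTree A D → L
  | leaf a => f a
  | hair d => g d
  | node s t => ⁅evalTree f g s, evalTree f g t⁆

/-- Antisymmetry and IHX hold in every Lie algebra, and linearity of `g` gives multilinearity in the
labels. The relations inside larger trees follow because a bracket with a fixed element is linear.
-/
theorem linearCombination_evalTree (f : A → L) (g : W →ₗ[k] L) {p : HTree A D →₀ k}
    (h : Rel ℓ p) : linearCombination k (evalTree f (g ∘ ℓ)) p = 0 := by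
  induction h with
  | as s t =>
    simp only [map_add, linearCombination_single, one_smul, evalTree]
    rw [← lie_skew, neg_add_cancel]
  | ihx s t r =>
    simp only [map_add, map_sub, linearCombination_single, one_smul, evalTree]
    rw [leibniz_lie (evalTree f (g ∘ ℓ) s)]
    abel
  | add d d₁ d₂ h => simp [evalTree, h]
  | smul c d d₁ h => simp [evalTree, h]
  | @left p t _ ih =>
    -- Bracketing on the right with the value of `t` is minus its adjoint action.
    rw [linearCombination_mapDomain_of_comp (-(LieAlgebra.ad k L (evalTree f (g ∘ ℓ) t)))
      (G := evalTree f (g ∘ ℓ)) (fun s => by simp [evalTree]), ih, map_zero]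
  | @right p s _ ih =>
    rw [linearCombination_mapDomain_of_comp (LieAlgebra.ad k L (evalTree f (g ∘ ℓ) s))
      (G := evalTree f (g ∘ ℓ)) (fun s => by simp [evalTree]), ih, map_zero]

/-- The linear map on all trees given by the values in a Lie algebra. -/
noncomputable def eval (f : A → L) (g : W →ₗ[k] L) : TreeLie k ℓ A →ₗ[k] L :=
  lift (evalTree f (g ∘ ℓ)) fun _ hp => linearCombination_evalTree f g hp

theorem eval_of (f : A → L) (g : W →ₗ[k] L) (t : HTree A D) :
    eval f g (of k ℓ t) = evalTree f (g ∘ ℓ) t := lift_of _ _ _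

end Eval

/-! ### Derivations -/

/-- The sum over the hairs of a tree of the trees with the label of the hair changed by `φ`. -/
noncomputable def derivTree (k : Type u) [Field k] {D : Type v} {W : Type w} [AddCommGroup W]
    [Module k W] (ℓ : D → W) {A : Type} (φ : D → D) : HTree A D → TreeLie k ℓ A
  | leaf _ => 0
  | hair d => of k ℓ (hair (φ d))
  | node s t => join (derivTree k ℓ φ s) (of k ℓ t) + join (of k ℓ s) (derivTree k ℓ φ t)

/-- Respecting the hair relations requires that `φ` come from a linear map `Φ` on vectors. For a
relation inside a larger tree, one Leibniz term vanishes by induction and the other because the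
relation itself is already zero among trees. -/
theorem linearCombination_derivTree {φ : D → D} {Φ : W →ₗ[k] W} (hφ : ∀ d, ℓ (φ d) = Φ (ℓ d))
    {p : HTree A D →₀ k} (h : Rel ℓ p) : linearCombination k (derivTree k ℓ φ) p = 0 := by
  induction h with
  | as s t =>
    simp only [map_add, linearCombination_single, one_smul, derivTree]
    rw [add_comm (join (derivTree k ℓ φ t) _), add_add_add_comm, join_skew, join_skew, add_zero]
  | ihx s t r =>
    simp only [map_add, map_sub, linearCombination_single, one_smul, derivTree, LinearMap.add_apply,
      ← join_of, join_leibniz (of k ℓ s), join_leibniz (derivTree k ℓ φ s)]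
    abel
  | add d d₁ d₂ h =>
    have := linearCombination_of_eq_zero (Rel.add (k := k) (A := A) (ℓ := ℓ) (φ d) (φ d₁) (φ d₂)
      (by rw [hφ, hφ, hφ, h, map_add]))
    simpa [derivTree] using this
  | smul c d d₁ h =>
    have := linearCombination_of_eq_zero (Rel.smul (k := k) (A := A) (ℓ := ℓ) c (φ d) (φ d₁)
      (by rw [hφ, hφ, h, map_smul]))
    simpa [derivTree] using this
  | @left p t h ih =>
    rw [linearCombination_mapDomain_of_add (G := derivTree k ℓ φ) (G' := of k ℓ)
      (join.flip (of k ℓ t)) (join.flip (derivTree k ℓ φ t)) (fun s => rfl), ih,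
      linearCombination_of_eq_zero h, map_zero, map_zero, add_zero]
  | @right p s h ih =>
    rw [linearCombination_mapDomain_of_add (G := of k ℓ) (G' := derivTree k ℓ φ)
      (join (derivTree k ℓ φ s)) (join (of k ℓ s)) (fun s => rfl), ih,
      linearCombination_of_eq_zero h, map_zero, map_zero, add_zero]

/-- The derivation of the Lie algebra of trees that changes the labels of the hairs by `φ`. -/
noncomputable def deriv {φ : D → D} {Φ : W →ₗ[k] W} (hφ : ∀ d, ℓ (φ d) = Φ (ℓ d)) :
    TreeLie k ℓ A →ₗ[k] TreeLie k ℓ A :=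
  lift (derivTree k ℓ φ) fun _ hp => linearCombination_derivTree hφ hp

theorem deriv_of {φ : D → D} {Φ : W →ₗ[k] W} (hφ : ∀ d, ℓ (φ d) = Φ (ℓ d)) (t : HTree A D) :
    deriv hφ (of k ℓ t) = derivTree k ℓ φ t := lift_of _ _ _

theorem deriv_join {φ : D → D} {Φ : W →ₗ[k] W} (hφ : ∀ d, ℓ (φ d) = Φ (ℓ d))
    (x y : TreeLie k ℓ A) :
    deriv hφ (join x y) = join (deriv hφ x) y + join x (deriv hφ y) := by
  induction x using ind with
  | of s =>
    induction y using ind with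
    | of t => rw [join_of, deriv_of, deriv_of, deriv_of]; rfl
    | add x y hx hy => simp only [map_add, hx, hy]; abel
    | smul c x hx => simp only [map_smul, hx, smul_add]
    | zero => simp
  | add x y hx hy => simp only [map_add, LinearMap.add_apply, hx, hy]; abel
  | smul c x hx => simp only [map_smul, LinearMap.smul_apply, hx, smul_add]
  | zero => simp

variable [CharZero k]

noncomputable instance : LieRing (TreeLie k ℓ A) where
  bracket x y := join x y
  add_lie x y z := by simp only [map_add, LinearMap.add_apply]
  lie_add x y z := by simp only [map_add]
  -- Antisymmetry of trees only says `2 • ⁅x, x⁆ = 0`; the characteristic enters in dividing by two.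
  lie_self x := by
    have h := join_skew x x
    rw [← two_smul k] at h
    exact (smul_eq_zero.1 h).resolve_left two_ne_zero
  leibniz_lie := join_leibniz

noncomputable instance : LieAlgebra k (TreeLie k ℓ A) where
  lie_smul c x y := map_smul (join x) c y

theorem lie_of (s t : HTree A D) : ⁅of k ℓ s, of k ℓ t⁆ = of k ℓ (node s t) := join_of s t


/-- `deriv` as a derivation. -/
noncomputable def lieDeriv {φ : D → D} {Φ : W →ₗ[k] W} (hφ : ∀ d, ℓ (φ d) = Φ (ℓ d)) :
    LieDerivation k (TreeLie k ℓ A) (TreeLie k ℓ A) where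
  toLinearMap := deriv hφ
  leibniz' x y := by
    -- The rule for `LieDerivation` is written as `⁅x, D y⁆ - ⁅y, D x⁆`, so one bracket has to be
    -- reversed.
    rw [← lie_skew y (deriv hφ x), sub_neg_eq_add, add_comm]
    exact deriv_join hφ x y

theorem eval_lie {L : Type*} [LieRing L] [LieAlgebra k L] (f : A → L) (g : W →ₗ[k] L)
    (x y : TreeLie k ℓ A) : eval f g ⁅x, y⁆ = ⁅eval f g x, eval f g y⁆ := by
  induction x using ind with
  | of s =>
    induction y using ind with
    | of t => rw [lie_of, eval_of, eval_of, eval_of]; rfl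
    | add x y hx hy => rw [lie_add, map_add, map_add, lie_add, hx, hy]
    | smul c x hx => rw [lie_smul, map_smul, map_smul, lie_smul, hx]
    | zero => simp
  | add x y hx hy => rw [add_lie, map_add, map_add, add_lie, hx, hy]
  | smul c x hx => rw [smul_lie, map_smul, map_smul, smul_lie, hx]
  | zero => simp

end TreeLie

/-! ### Changing the labels of the hairs -/

namespace HTree

variable {A B C : Type} {D : Type v} {D' : Type w}

/-- Relabel the hairs. -/
def relabel (f : D → D') : HTree A D → HTree A D'
  | leaf a => leaf a
  | hair d => hair (f d)
  | node s t => node (relabel f s) (relabel f t)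

theorem relabel_bind (f : D → D') (g : A → HTree B D) (t : HTree A D) :
    (t.bind g).relabel f = (t.relabel f).bind fun a => (g a).relabel f := by
  induction t with
  | leaf a => rfl
  | hair d => rfl
  | node s t hs ht => simp only [bind, relabel, hs, ht]

theorem relabel_map (f : D → D') (g : A → B) (t : HTree A D) :
    (t.map g).relabel f = (t.relabel f).map g := relabel_bind _ _ _

theorem occ_relabel (f : D → D') (a : A) (t : HTree A D) : (t.relabel f).occ a = t.occ a := by
  induction t with
  | leaf b => rfl
  | hair d => rfl
  | node s t hs ht => simp only [occ, relabel, hs, ht]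

theorem IsLin.relabel {t : HTree A D} (ht : t.IsLin) (f : D → D') : (t.relabel f).IsLin :=
  ⟨ht.1, fun a => (occ_relabel f a t).trans (ht.2 a)⟩

theorem relabel_graft (f : D → D') (s : HTree (Option A) D) (t : HTree B D) :
    (s.graft t).relabel f = (s.relabel f).graft (t.relabel f) := by
  rw [graft, graft, relabel_bind]
  congr 1
  funext x
  rcases x with _ | x
  · exact relabel_map _ _ _
  · rfl

theorem relabel_up (f : D → D') (a : A) (s r : HTree A D) :
    (up a s r).relabel f = up a (s.relabel f) (r.relabel f) := by
  induction s generalizing r with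
  | leaf b => rfl
  | hair d => rfl
  | node s t hs ht =>
    simp only [up, relabel, occ_relabel]
    split_ifs
    · rw [hs]; rfl
    · rw [ht]; rfl

theorem relabel_act (f : D → D') (e : Option A ≃ Option B) (t : HTree A D) :
    (act e t).relabel f = act e (t.relabel f) := by
  simp only [act]
  rcases e.symm none with _ | a
  · exact relabel_map _ _ _
  · exact (relabel_map _ _ _).trans (congrArg _ (relabel_up f a t (leaf a)))

theorem bind_update_of_occ_eq_zero [DecidableEq A] {i : A} {t : HTree A D} (h : t.occ i = 0)
    (r : HTree A D) : t.bind (Function.update leaf i r) = t := by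
  conv_rhs => rw [← bind_leaf t]
  refine bind_congr fun a ha => Function.update_of_ne ?_ _ _
  rintro rfl
  exact ha h

theorem IsLin.node_hair {t : HTree A D} (ht : t.IsLin) (d : D) : (node (hair d) t).IsLin :=
  ⟨ht.1, fun a => by rw [occ, ht.2]; rfl⟩

end HTree

namespace TreeOperad

open HTree
open Finsupp hiding some

variable {k : Type u} [Field k] {D : Type v} {W : Type w} [AddCommGroup W] [Module k W]
  {ℓ : D → W} {D' : Type*} {W' : Type*} [AddCommGroup W'] [Module k W'] {ℓ' : D' → W'}
  {A B : Type}

theorem Rel.relabel {f : D → D'} {g : W →ₗ[k] W'} (hf : ∀ d, ℓ' (f d) = g (ℓ d))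
    {p : HTree A D →₀ k} (h : Rel ℓ p) : Rel ℓ' (p.mapDomain (HTree.relabel f)) := by
  induction h with
  | as s t => simpa [mapDomain_add, mapDomain_single, HTree.relabel] using Rel.as _ _
  | ihx s t r =>
    simpa [mapDomain_add, mapDomain_sub, mapDomain_single, HTree.relabel] using Rel.ihx _ _ _
  | add d d₁ d₂ h =>
    simpa [mapDomain_add, mapDomain_sub, mapDomain_single, HTree.relabel] using
      Rel.add (ℓ := ℓ') (f d) (f d₁) (f d₂) (by rw [hf, hf, hf, h, map_add])
  | smul c d d₁ h =>
    simpa [mapDomain_add, mapDomain_sub, mapDomain_single, HTree.relabel] using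
      Rel.smul (ℓ := ℓ') c (f d) (f d₁) (by rw [hf, hf, h, map_smul])
  | left t _ h =>
    rw [← mapDomain_comp]
    have := h.left (t.relabel f)
    rwa [← mapDomain_comp] at this
  | right t _ h =>
    rw [← mapDomain_comp]
    have := h.right (t.relabel f)
    rwa [← mapDomain_comp] at this

/-- Relabel the hairs. -/
noncomputable def relabel {f : D → D'} {g : W →ₗ[k] W'} (hf : ∀ d, ℓ' (f d) = g (ℓ d)) :
    Obj k ℓ A →ₗ[k] Obj k ℓ' A :=
  lift (fun t => mk' k ℓ' (t.1.relabel f)) fun p hp => by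
    have h1 : linearCombination k (fun t : LinTree A D => mk' k ℓ' (t.1.relabel f)) p =
        linearCombination k (mk' k ℓ') ((p.mapDomain Subtype.val).mapDomain (HTree.relabel f)) := by
      rw [linearCombination_mapDomain, linearCombination_mapDomain]; rfl
    rw [h1]
    exact (hp.relabel hf).mk_eq_zero

theorem relabel_mk {f : D → D'} {g : W →ₗ[k] W'} (hf : ∀ d, ℓ' (f d) = g (ℓ d)) (t : HTree A D)
    (ht : t.IsLin) : relabel hf (mk k ℓ t ht) = mk k ℓ' (t.relabel f) (ht.relabel f) := by
  rw [relabel, lift_mk, mk'_of_isLin (ht.relabel f)]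

theorem relabel_comp {f : D → D'} {g : W →ₗ[k] W'} (hf : ∀ d, ℓ' (f d) = g (ℓ d))
    (a : Obj k ℓ (Option A)) (b : Obj k ℓ B) :
    relabel hf (comp a b) = comp (relabel hf a) (relabel hf b) := by
  induction a using ind with
  | mk s hs =>
    induction b using ind with
    | mk t ht =>
      rw [comp_mk, relabel_mk, relabel_mk, relabel_mk, comp_mk]
      exact mk_congr _ _ (relabel_graft _ _ _)
    | add x y hx hy => simp only [map_add, hx, hy]
    | smul c x hx => simp only [map_smul, hx]
    | zero => simp only [map_zero]
  | add x y hx hy => simp only [map_add, LinearMap.add_apply, hx, hy]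
  | smul c x hx => simp only [map_smul, LinearMap.smul_apply, hx]
  | zero => simp only [map_zero, LinearMap.zero_apply]

/-- Relabelling the hairs as a morphism of operads. -/
noncomputable def relabelHom {f : D → D'} {g : W →ₗ[k] W'} (hf : ∀ d, ℓ' (f d) = g (ℓ d)) :
    Operad.Hom (treeOperad k ℓ) (treeOperad k ℓ') where
  app A _ := relabel hf
  app_map e a := by
    change relabel hf (map e a) = map e (relabel hf a)
    induction a using ind with
    | mk s hs =>
      rw [map_mk, relabel_mk, relabel_mk, map_mk]
      exact mk_congr _ _ (relabel_map _ _ _)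
    | add x y hx hy => simp only [map_add, hx, hy]
    | smul c x hx => simp only [map_smul, hx]
    | zero => simp only [map_zero]
  app_one := relabel_mk hf _ _
  app_comp a b := relabel_comp hf a b

theorem relabel_act {f : D → D'} {g : W →ₗ[k] W'} (hf : ∀ d, ℓ' (f d) = g (ℓ d))
    (e : Option A ≃ Option B) (a : Obj k ℓ A) : relabel hf (act e a) = act e (relabel hf a) := by
  induction a using ind with
  | mk s hs =>
    rw [act_mk, relabel_mk, relabel_mk, act_mk]
    exact mk_congr _ _ (HTree.relabel_act _ _ _)
  | add x y hx hy => simp only [map_add, hx, hy]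
  | smul c x hx => simp only [map_smul, hx]
  | zero => simp only [map_zero]

/-! ### Trees with prescribed inputs among all trees -/

/-- The multilinear part of the space of all trees. -/
noncomputable def ofTreeLie : TreeLie k ℓ A →ₗ[k] Obj k ℓ A :=
  TreeLie.lift (mk' k ℓ) fun _ hp => hp.mk_eq_zero

theorem ofTreeLie_of {t : HTree A D} (ht : t.IsLin) :
    ofTreeLie (TreeLie.of k ℓ t) = mk k ℓ t ht := by
  rw [ofTreeLie, TreeLie.lift_of, mk'_of_isLin ht]

/-- The inclusion of the multilinear part into the space of all trees. -/
noncomputable def toTreeLie : Obj k ℓ A →ₗ[k] TreeLie k ℓ A :=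
  lift (fun t => TreeLie.of k ℓ t.1) fun p hp => by
    rw [← TreeLie.linearCombination_of_eq_zero hp, linearCombination_mapDomain]
    rfl

theorem toTreeLie_mk (t : HTree A D) (ht : t.IsLin) :
    toTreeLie (mk k ℓ t ht) = TreeLie.of k ℓ t := by
  rw [toTreeLie, lift_mk]

/-! ### Insertion and composition of trees -/

theorem isLin_leaf : (leaf () : HTree Unit D).IsLin := ⟨⟨()⟩, fun _ => if_pos rfl⟩

theorem _root_.HTree.IsLin.bind_update [DecidableEq A] {t : HTree A D} (ht : t.IsLin)
    {u : HTree Unit D} (hu : u.IsLin) (i : A) :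
    (t.bind (Function.update leaf i (u.map fun _ => i))).IsLin := by
  refine ⟨ht.1, fun a => ?_⟩
  rw [occ_bind_of_unique (a := a), ht.2]
  · by_cases h : a = i
    · subst h
      rw [Function.update_self]
      exact (occ_map (f := fun _ : Unit => a) (fun _ _ _ => rfl) () u).trans (hu.2 ())
    · rw [Function.update_of_ne h]
      exact if_pos rfl
  · intro a' ha'
    by_cases h : a' = i
    · subst h
      rw [Function.update_self]
      exact occ_map_eq_zero (fun _ => ha') u
    · rw [Function.update_of_ne h]
      exact if_neg ha'

theorem insert_mk [Finite A] [DecidableEq A] (i : A) (u : HTree Unit D) (hu : u.IsLin)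
    (t : HTree A D) (ht : t.IsLin) :
    (treeOperad k ℓ).insert i (mk k ℓ u hu) (mk k ℓ t ht) =
      mk k ℓ (t.bind (Function.update leaf i (u.map fun _ => i))) (ht.bind_update hu i) := by
  have hi : splitOff i i = none := by simp [splitOff]
  refine ((treeOperad k ℓ).insert_eq (splitOff i) hi _ _).trans ?_
  change map _ (comp (map _ (mk k ℓ t ht)) (mk k ℓ u hu)) = _
  rw [map_mk, comp_mk, map_mk]
  refine mk_congr _ _ ?_
  simp only [HTree.graft, HTree.map, bind_bind]
  congr 1
  funext a
  by_cases h : a = i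
  · subst h
    simp only [HTree.bind, Function.update_self, hi, bind_bind]
    congr 1
  · rw [Function.update_of_ne h]
    obtain ⟨b, hb⟩ : ∃ b, splitOff i a = some b := Option.ne_none_iff_exists'.1 fun h' =>
      h ((splitOff i).injective (h'.trans hi.symm))
    simp only [HTree.bind, hb]
    exact congrArg leaf ((Equiv.symm_apply_eq _).2 hb.symm)

theorem unaryComp_mk [Finite A] (u : HTree Unit D) (hu : u.IsLin) (t : HTree A D) (ht : t.IsLin)
    (h : (u.bind fun _ => t).IsLin) :
    (treeOperad k ℓ).unaryComp (mk k ℓ u hu) (mk k ℓ t ht) = mk k ℓ (u.bind fun _ => t) h := by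
  change map _ (comp (map _ (mk k ℓ u hu)) (mk k ℓ t ht)) = _
  rw [map_mk, comp_mk, map_mk]
  refine mk_congr _ _ ?_
  simp only [HTree.graft, HTree.map, bind_bind]
  congr 1
  funext x
  exact (bind_bind _ _ t).trans (bind_leaf t)

end TreeOperad

/-! ### Operads with a space of unary operations -/

namespace Operad

section Spread

variable {k : Type u} [Field k] {H : Type v} [Ring H] [HopfAlgebra k H] (P : Operad.{u, w} k)
  (j : H →ₗ[k] P.obj Unit) {A : Type} [Finite A]

theorem map_spread_of_commute (T : P.obj A →ₗ[k] P.obj A) (l : List A)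
    (hT : ∀ i ∈ l, ∀ (h : H) (x : P.obj A), T (P.insert i (j h) x) = P.insert i (j h) (T x))
    (h : H) (x : P.obj A) : T (spread k H P j l h x) = spread k H P j l h (T x) := by
  induction l generalizing h x with
  | nil => exact map_smul T _ _
  | cons i l ih =>
    rw [spread_cons, spread_cons]
    induction Coalgebra.comul (R := k) h using TensorProduct.induction_on with
    | zero => simp
    | tmul g g' =>
      change T (P.insert i (j g) (spread k H P j l g' x)) =
        P.insert i (j g) (spread k H P j l g' (T x))
      rw [hT i (by simp), ih fun i' hi' => hT i' (by simp [hi'])]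
    | add x y hx hy => simp only [map_add, LinearMap.add_apply, hx, hy]

/-- The coproduct is multiplicative, and at each single input insertion reverses products. Distinct
inputs are needed to let the insertion of `g` at `i` commute past the insertions of the factors of
`h` at the other inputs. -/
theorem spread_mul (hj : ∀ g h : H, j (g * h) = P.unaryComp (j g) (j h)) {l : List A}
    (hl : l.Nodup) (g h : H) (x : P.obj A) :
    spread k H P j l (g * h) x = spread k H P j l h (spread k H P j l g x) := by
  induction l generalizing g h x with
  | nil =>
    change Coalgebra.counit (R := k) (g * h) • x =
      Coalgebra.counit (R := k) h • Coalgebra.counit (R := k) g • x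
    rw [Bialgebra.counit_mul, smul_smul, mul_comm]
  | cons i l ih =>
    rw [List.nodup_cons] at hl
    rw [spread_cons, spread_cons, spread_cons, Bialgebra.comul_mul]
    induction Coalgebra.comul (R := k) g using TensorProduct.induction_on with
    | zero => simp
    | add a b ha hb => simp only [add_mul, map_add, LinearMap.add_apply, ha, hb]
    | tmul g g' =>
      induction Coalgebra.comul (R := k) h using TensorProduct.induction_on with
      | zero => simp
      | add a b ha hb => simp only [mul_add, map_add, LinearMap.add_apply, ha, hb]
      | tmul h h' =>
        rw [Algebra.TensorProduct.tmul_mul_tmul]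
        change P.insert i (j (g * h)) (spread k H P j l (g' * h') x) =
          P.insert i (j h) (spread k H P j l h' (P.insert i (j g) (spread k H P j l g' x)))
        rw [hj, insert_unaryComp, ih hl.2,
          map_spread_of_commute P j (P.insert i (j g)) l fun i' hi' h x => P.insert_comm
            (by rintro rfl; exact hl.1 hi') _ _ _]

theorem spread_one (hj : j 1 = P.one) (l : List A) (x : P.obj A) :
    spread k H P j l 1 x = x := by
  induction l with
  | nil => exact (congrArg (· • x) (Bialgebra.counit_one (R := k) (A := H))).trans (one_smul k x)
  | cons i l ih =>
    rw [spread_cons, Bialgebra.comul_one]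
    change P.insert i (j 1) (spread k H P j l 1 x) = x
    rw [hj, insert_one, ih]

/-- In the iterated coproduct of a primitive element every term has one factor `h` and all others
`1`, and inserting `1` does nothing. The counit hypothesis accounts for the empty list. -/
theorem spread_primitive (hj : j 1 = P.one) (l : List A) (x : P.obj A) {h : H}
    (hc : Coalgebra.comul (R := k) h = h ⊗ₜ[k] 1 + 1 ⊗ₜ[k] h)
    (hε : Coalgebra.counit (R := k) h = 0) :
    spread k H P j l h x = (l.map fun i => P.insert i (j h) x).sum := by
  induction l with
  | nil => exact (congrArg (· • x) hε).trans (zero_smul k x)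
  | cons i l ih =>
    rw [spread_cons, hc, map_add, LinearMap.add_apply, List.map_cons, List.sum_cons]
    change P.insert i (j h) (spread k H P j l 1 x) + P.insert i (j 1) (spread k H P j l h x) = _
    rw [hj, insert_one, ih, spread_one P j hj]

end Spread

/-! ### The tensor algebra acting through unary operations -/

section Unary

variable {k : Type u} [Field k] {V : Type v} [AddCommGroup V] [Module k V] (P : Operad.{u, w} k)
  (j : V →ₗ[k] P.obj Unit) {A B : Type} [Finite A] [Finite B]

/-- The action of the tensor algebra on the operations by composition with unary operations. -/
noncomputable def unaryAction (A : Type) [Finite A] :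
    TensorAlgebra k V →ₐ[k] Module.End k (P.obj A) :=
  TensorAlgebra.lift k (P.unaryComp ∘ₗ j)

theorem unaryAction_ι (v : V) (x : P.obj A) :
    P.unaryAction j A (TensorAlgebra.ι k v) x = P.unaryComp (j v) x := by
  rw [unaryAction, TensorAlgebra.lift_ι_apply]
  rfl

/-- Commuting with the generators implies commuting with the algebra they generate. The cases in use
are renaming of inputs, insertion at an input and grafting on an input. -/
theorem map_unaryAction_of_commute (T : P.obj A →ₗ[k] P.obj B)
    (hT : ∀ v x, T (P.unaryComp (j v) x) = P.unaryComp (j v) (T x)) (h : TensorAlgebra k V)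
    (x : P.obj A) : T (P.unaryAction j A h x) = P.unaryAction j B h (T x) := by
  induction h using TensorAlgebra.induction generalizing x with
  | algebraMap r =>
    rw [AlgHom.commutes, AlgHom.commutes, Module.algebraMap_end_apply, Module.algebraMap_end_apply,
      map_smul]
  | ι v => rw [unaryAction_ι, unaryAction_ι, hT]
  | mul a b ha hb => rw [map_mul, map_mul, Module.End.mul_apply, Module.End.mul_apply, ha, hb]
  | add a b ha hb =>
    rw [map_add, map_add, LinearMap.add_apply, LinearMap.add_apply, map_add, ha, hb]

theorem map_unaryAction (e : A ≃ B) (h : TensorAlgebra k V) (x : P.obj A) :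
    P.map e (P.unaryAction j A h x) = P.unaryAction j B h (P.map e x) :=
  P.map_unaryAction_of_commute j (P.map e) (fun _ _ => P.map_unaryComp _ _ _) h x

theorem insert_unaryAction (i : A) (g : P.obj Unit) (h : TensorAlgebra k V) (x : P.obj A) :
    P.insert i g (P.unaryAction j A h x) = P.unaryAction j A h (P.insert i g x) :=
  P.map_unaryAction_of_commute j (P.insert i g) (fun _ _ => (P.unaryComp_insert _ _ _ _).symm) h x

theorem unaryComp_comp (h : P.obj Unit) (a : P.obj (Option A)) (b : P.obj B) :
    P.unaryComp h (P.comp a b) = P.comp (P.unaryComp h a) b := by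
  rw [unaryComp_apply, ← P.comp_assoc, unaryComp_apply, map_map]
  have : Equiv.emptySum Empty (Option A) =
      (optSumR Empty A).trans (Equiv.optionCongr (Equiv.emptySum Empty A)) := by
    ext1 x
    rcases x with x | _ | x
    · exact x.elim
    · rfl
    · rfl
  rw [this, P.map_trans _ (Equiv.optionCongr _), comp_map_left]
  refine P.map_congr (fun x => ?_) _
  rcases x with (x | x) | x
  · exact x.elim
  · rfl
  · rfl

theorem comp_unaryAction (h : TensorAlgebra k V) (a : P.obj (Option A)) (b : P.obj B) :
    P.comp (P.unaryAction j (Option A) h a) b = P.unaryAction j (A ⊕ B) h (P.comp a b) :=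
  P.map_unaryAction_of_commute j (P.comp.flip b) (fun _ _ => (P.unaryComp_comp _ _ _).symm) h a

/-- The action commutes with grafting, so acting on `1 ∘ x` is the same as acting on the unit first.
-/
theorem unaryAction_eq (h : TensorAlgebra k V) (x : P.obj A) :
    P.unaryAction j A h x = P.unaryComp (P.unaryAction j Unit h P.one) x := by
  rw [unaryComp_apply, map_unaryAction, comp_unaryAction, map_unaryAction, P.one_comp]

/-- The unary operations given by the elements of the tensor algebra. -/
noncomputable def unaryOfTensor : TensorAlgebra k V →ₗ[k] P.obj Unit :=
  LinearMap.applyₗ P.one ∘ₗ (P.unaryAction j Unit).toLinearMap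

theorem unaryOfTensor_apply (h : TensorAlgebra k V) :
    P.unaryOfTensor j h = P.unaryAction j Unit h P.one := rfl

theorem unaryOfTensor_one : P.unaryOfTensor j 1 = P.one := by
  rw [unaryOfTensor_apply, map_one, Module.End.one_apply]

theorem unaryComp_one (h : P.obj Unit) : P.unaryComp h P.one = h := by
  rw [unaryComp_apply]
  have h1 := P.comp_one (P.map unitOpt h)
  have h2 := congrArg (P.map unitOpt.symm) h1
  rw [map_map, map_map, Equiv.self_trans_symm, P.map_refl] at h2
  refine Eq.trans (P.map_congr (fun x => ?_) _) h2
  rcases x with x | x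
  · exact x.elim
  · rfl

theorem unaryOfTensor_ι (v : V) : P.unaryOfTensor j (TensorAlgebra.ι k v) = j v := by
  rw [unaryOfTensor_apply, unaryAction_ι, unaryComp_one]

theorem unaryOfTensor_mul (g h : TensorAlgebra k V) :
    P.unaryOfTensor j (g * h) = P.unaryComp (P.unaryOfTensor j g) (P.unaryOfTensor j h) := by
  rw [unaryOfTensor_apply, map_mul, Module.End.mul_apply, unaryAction_eq]
  rfl

open Classical in
/-- The unit with its input renamed. -/
noncomputable def oneAt (A : Type) [Finite A] : P.obj A :=
  if h : Nonempty (Unit ≃ A) then P.map h.some P.one else 0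

/-- Any two bijections onto a one-point set agree, so the choice in the definition is immaterial. -/
theorem map_one_eq_oneAt (e : Unit ≃ A) : P.map e P.one = P.oneAt A := by
  have h : Nonempty (Unit ≃ A) := ⟨e⟩
  rw [oneAt, dif_pos h]
  refine P.map_congr (fun x => ?_) _
  have := e.symm.subsingleton
  exact Subsingleton.elim _ _

theorem nonempty_unit_equiv {A : Type} (h : Nat.card A = 1) : Nonempty (Unit ≃ A) := by
  have := (Nat.card_eq_one_iff_unique.1 h).1
  obtain ⟨a⟩ := (Nat.card_eq_one_iff_unique.1 h).2
  exact ⟨⟨fun _ => a, fun _ => (), fun _ => rfl, fun _ => Subsingleton.elim _ _⟩⟩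

/-- The morphism of operads from the tensor algebra given by unary operations. -/
noncomputable def tensorHom : Hom (algebraOperad k (TensorAlgebra k V)) P where
  app A _ := LinearMap.applyₗ (P.oneAt A) ∘ₗ (P.unaryAction j A).toLinearMap ∘ₗ
    (algebraOperadObj k (TensorAlgebra k V) A).subtype
  app_map {A B} _ _ e h := by
    change P.unaryAction j B h.1 (P.oneAt B) = P.map e (P.unaryAction j A h.1 (P.oneAt A))
    by_cases hA : Nat.card A = 1
    · obtain ⟨f⟩ := nonempty_unit_equiv hA
      rw [map_unaryAction, ← P.map_one_eq_oneAt f, map_map, map_one_eq_oneAt]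
    · rw [h.2 hA, map_zero, map_zero, LinearMap.zero_apply, LinearMap.zero_apply, map_zero]
  app_one := by
    change P.unaryAction j Unit 1 (P.oneAt Unit) = P.one
    rw [map_one, Module.End.one_apply, ← P.map_one_eq_oneAt (Equiv.refl _), P.map_refl]
  app_comp {A B} _ _ g h := by
    change P.unaryAction j (A ⊕ B) (g.1 * h.1) (P.oneAt (A ⊕ B)) =
      P.comp (P.unaryAction j (Option A) g.1 (P.oneAt (Option A)))
        (P.unaryAction j B h.1 (P.oneAt B))
    -- Outside arity one both sides vanish. Otherwise `A` is empty, the first factor acts at the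
    -- root of the composite, and what remains is the unit law.
    by_cases hA : Nat.card (Option A) = 1
    · by_cases hB : Nat.card B = 1
      · obtain ⟨f⟩ := nonempty_unit_equiv hB
        have hA' : IsEmpty A := by
          rw [Finite.card_option] at hA
          rw [← Finite.card_eq_zero_iff]; omega
        have a : A ≃ Empty := Equiv.equivEmpty A
        rw [comp_unaryAction, map_mul, Module.End.mul_apply]
        congr 1
        rw [← P.map_one_eq_oneAt (unitOpt.trans (Equiv.optionCongr a.symm)), P.map_trans,
          comp_map_left]
        have h1 : P.comp (P.map unitOpt P.one) (P.unaryAction j B h.1 (P.oneAt B)) =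
            P.map (Equiv.emptySum Empty B).symm (P.unaryAction j B h.1 (P.oneAt B)) := by
          conv_rhs => rw [← P.one_comp (P.unaryAction j B h.1 (P.oneAt B))]
          rw [map_map, Equiv.self_trans_symm, P.map_refl]
        rw [h1, map_map, map_unaryAction, ← P.map_one_eq_oneAt f, map_map, map_one_eq_oneAt]
      · rw [h.2 hB, mul_zero, map_zero, map_zero, LinearMap.zero_apply, LinearMap.zero_apply,
          map_zero]
    · rw [g.2 hA, zero_mul, map_zero, map_zero, LinearMap.zero_apply, LinearMap.zero_apply,
        LinearMap.map_zero₂]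

theorem tensorHom_app (h : (algebraOperad k (TensorAlgebra k V)).obj A) :
    (P.tensorHom j).app A h = P.unaryAction j A h.1 (P.oneAt A) := rfl

theorem tensorHom_unary (h : TensorAlgebra k V) :
    (P.tensorHom j).app Unit (algebraOperadUnary k h) = P.unaryOfTensor j h := by
  change P.unaryAction j Unit h (P.oneAt Unit) = P.unaryAction j Unit h P.one
  rw [← P.map_one_eq_oneAt (Equiv.refl _), P.map_refl]

/-- If the generators commute with an operation like primitive elements, then the whole tensor
algebra does so through the coproduct. -/
theorem unaryAction_eq_spread {x : P.obj A} {l : List A} (hl : l.Nodup)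
    (hx : ∀ v, P.unaryComp (j v) x = (l.map fun i => P.insert i (j v) x).sum)
    (h : TensorAlgebra k V) :
    P.unaryAction j A h x = spread k (TensorAlgebra k V) P (P.unaryOfTensor j) l h x := by
  induction h using TensorAlgebra.induction with
  | algebraMap r =>
    rw [AlgHom.commutes, Module.algebraMap_end_apply, Algebra.algebraMap_eq_smul_one, map_smul,
      LinearMap.smul_apply, spread_one _ _ (P.unaryOfTensor_one j)]
  | ι v =>
    rw [unaryAction_ι, hx, spread_primitive _ _ (P.unaryOfTensor_one j) _ _
      (TensorAlgebra.comul_ι k V v) (TensorAlgebra.counit_ι k V v), unaryOfTensor_ι]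
  | mul a b ha hb =>
    -- First spread `b`. The action of `a` at the root commutes with insertions at the inputs, so
    -- `a` reaches `x` and spreads there too. The order in which `b` and `a` are then inserted is
    -- the one in `spread_mul`.
    rw [map_mul, Module.End.mul_apply, hb, map_spread_of_commute _ _ _ _
      (fun i _ h x => (P.insert_unaryAction j i _ a x).symm), ha,
      spread_mul _ _ (P.unaryOfTensor_mul j) hl]
  | add a b ha hb => rw [map_add, map_add, LinearMap.add_apply, LinearMap.add_apply, ha, hb]

end Unary

end Operad

/-! ### The morphism from `H Lie` to the operad of trees with hairs -/

namespace TreeLie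

open HTree TreeOperad

variable {k : Type u} [Field k] {D : Type v} {W : Type w} [AddCommGroup W] [Module k W]
  {ℓ : D → W} {A : Type}

/-- A hair at the root of a tree without hairs can be moved to the inputs. -/
theorem sum_of_bind_update [Fintype A] [DecidableEq A] (d : D) (f : Empty → D)
    (t : HTree A Empty) (ht : ∀ a, t.occ a ≤ 1) :
    ∑ i ∈ Finset.univ.filter (fun i => t.occ i ≠ 0), of k ℓ ((t.relabel f).bind
      (Function.update leaf i (node (hair d) (leaf i)))) =
    join (of k ℓ (hair d)) (of k ℓ (t.relabel f)) := by
  induction t with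
  | leaf a =>
    have : Finset.univ.filter (fun i => (leaf a : HTree A Empty).occ i ≠ 0) = {a} := by
      ext i; simp [occ, eq_comm]
    rw [this, Finset.sum_singleton]
    simp [HTree.relabel, HTree.bind, join_of]
  | hair d => exact d.elim
  | node s t hs ht' =>
    -- The hypothesis that inputs occur at most once passes to both branches, unlike linearity, and
    -- it makes their sets of inputs disjoint. The sum over the inputs therefore splits into the two
    -- terms of a Leibniz rule.
    simp only [occ] at ht
    have hd : Disjoint (Finset.univ.filter (fun i => s.occ i ≠ 0))
        (Finset.univ.filter (fun i => t.occ i ≠ 0)) := by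
      rw [Finset.disjoint_filter]
      intro i _ h
      have := ht i
      grind
    have hu : Finset.univ.filter (fun i => (node s t).occ i ≠ 0) =
        (Finset.univ.filter (fun i => s.occ i ≠ 0)).disjUnion
          (Finset.univ.filter (fun i => t.occ i ≠ 0)) hd := by
      ext i
      rw [Finset.mem_filter, Finset.mem_disjUnion, Finset.mem_filter, Finset.mem_filter]
      simp only [Finset.mem_univ, true_and]
      change s.occ i + t.occ i ≠ 0 ↔ _
      omega
    rw [hu, Finset.sum_disjUnion]
    have h1 : ∀ i ∈ Finset.univ.filter (fun i => s.occ i ≠ 0),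
        of k ℓ (((node s t).relabel f).bind (Function.update leaf i (node (hair d) (leaf i)))) =
        join.flip (of k ℓ (t.relabel f)) (of k ℓ ((s.relabel f).bind
          (Function.update leaf i (node (hair d) (leaf i))))) := by
      intro i hi
      rw [LinearMap.flip_apply, join_of]
      simp only [HTree.relabel, HTree.bind]
      rw [bind_update_of_occ_eq_zero (t := t.relabel f)]
      rw [occ_relabel]
      have := ht i
      have := (Finset.mem_filter.1 hi).2
      omega
    have h2 : ∀ i ∈ Finset.univ.filter (fun i => t.occ i ≠ 0),
        of k ℓ (((node s t).relabel f).bind (Function.update leaf i (node (hair d) (leaf i)))) =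
        join (of k ℓ (s.relabel f)) (of k ℓ ((t.relabel f).bind
          (Function.update leaf i (node (hair d) (leaf i))))) := by
      intro i hi
      rw [join_of]
      simp only [HTree.relabel, HTree.bind]
      rw [bind_update_of_occ_eq_zero (t := s.relabel f)]
      rw [occ_relabel]
      have := ht i
      have := (Finset.mem_filter.1 hi).2
      omega
    -- By induction each partial sum brackets the hair with one branch; `join_leibniz` combines the
    -- two into the bracket of the hair with the whole tree.
    rw [Finset.sum_congr rfl h1, Finset.sum_congr rfl h2, ← map_sum, ← map_sum,
      hs fun a => by have := ht a; omega, ht' fun a => by have := ht a; omega, LinearMap.flip_apply,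
      ← join_leibniz, join_of]
    rfl

end TreeLie

/-! ### Hairs as unary operations, and their commutation with Lie trees -/

section HairyLie

open HTree TreeOperad
open Finsupp hiding some

variable (k : Type u) [Field k] (V : Type v) [AddCommGroup V] [Module k V]

/-- `treeHair` as a linear map. -/
noncomputable def hairLinear : V →ₗ[k] (hairyLie k V).obj Unit where
  toFun := treeHair k (id : V → V)
  map_add' v w := by
    have := ((Rel.add (k := k) (ℓ := (id : V → V)) (A := Unit) (v + w) v w rfl).left
      (leaf ())).mk_eq_zero
    simp only [mapDomain_sub, mapDomain_single, map_sub, linearCombination_single,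
      one_smul] at this
    rw [mk'_of_isLin (isLin_leaf.node_hair _), mk'_of_isLin (isLin_leaf.node_hair _),
      mk'_of_isLin (isLin_leaf.node_hair _), sub_sub, sub_eq_zero] at this
    exact this
  map_smul' c v := by
    have := ((Rel.smul (k := k) (ℓ := (id : V → V)) (A := Unit) c (c • v) v rfl).left
      (leaf ())).mk_eq_zero
    simp only [mapDomain_sub, mapDomain_single, map_sub, linearCombination_single,
      one_smul] at this
    rw [mk'_of_isLin (isLin_leaf.node_hair _), mk'_of_isLin (isLin_leaf.node_hair _),
      sub_eq_zero] at this
    exact this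

variable {V} {A : Type} [Finite A]

/-- The class of a tree in the operad of trees with hairs. -/
noncomputable def hairyTree (t : HTree A V) (ht : t.IsLin) : (hairyLie k V).obj A :=
  mk k id t ht

/-- The class of a tree in the Lie operad. -/
noncomputable def lieTree (t : HTree A Empty) (ht : t.IsLin) : (lieOperad k).obj A :=
  mk k noLabels t ht

variable {k}

theorem hairyLie_hom_ext {M : Type*} [AddCommGroup M] [Module k M]
    {f g : (hairyLie k V).obj A →ₗ[k] M}
    (h : ∀ (t : HTree A V) (ht : t.IsLin), f (hairyTree k t ht) = g (hairyTree k t ht)) : f = g :=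
  TreeOperad.hom_ext h

theorem lieOperad_hom_ext {M : Type*} [AddCommGroup M] [Module k M]
    {f g : (lieOperad k).obj A →ₗ[k] M}
    (h : ∀ (t : HTree A Empty) (ht : t.IsLin), f (lieTree k t ht) = g (lieTree k t ht)) : f = g :=
  TreeOperad.hom_ext h

theorem unaryComp_hairLinear (v : V) (t : HTree A V) (ht : t.IsLin) :
    (hairyLie k V).unaryComp (hairLinear k V v) (hairyTree k t ht) =
      hairyTree k (node (hair v) t) (ht.node_hair v) :=
  unaryComp_mk _ (isLin_leaf.node_hair v) t ht (ht.node_hair v)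

theorem insert_hairLinear [DecidableEq A] (i : A) (v : V) (t : HTree A V)
    (ht : t.IsLin) :
    (hairyLie k V).insert i (hairLinear k V v) (hairyTree k t ht) =
      hairyTree k (t.bind (Function.update leaf i (node (hair v) (leaf i))))
        (ht.bind_update (isLin_leaf.node_hair v) i) :=
  insert_mk i _ (isLin_leaf.node_hair v) t ht

variable (k V) in
/-- The inclusion of the Lie operad into the operad of trees with hairs. -/
noncomputable def lieToHairy : Operad.Hom (lieOperad k) (hairyLie k V) :=
  relabelHom (f := Empty.elim) (g := 0) (fun d => d.elim)

theorem lieToHairy_lieTree (t : HTree A Empty) (ht : t.IsLin) :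
    (lieToHairy k V).app A (lieTree k t ht) =
      hairyTree k (t.relabel Empty.elim) (ht.relabel _) :=
  relabel_mk (g := 0) (fun d => d.elim) _ _

/-- The commutation relation for a generator `v`. The sum runs over a list in order to match the
inserted iterated coproduct of a primitive element. -/
theorem unaryComp_hairLinear_lie (v : V) (o : (lieOperad k).obj A) {l : List A}
    (hl : l.Nodup) (hl' : ∀ i, i ∈ l) :
    (hairyLie k V).unaryComp (hairLinear k V v) ((lieToHairy k V).app A o) =
      (l.map fun i => (hairyLie k V).insert i (hairLinear k V v) ((lieToHairy k V).app A o)).sum := by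
  classical
  have := Fintype.ofFinite A
  have hF : l.toFinset = Finset.univ := by ext i; simp [hl']
  rw [← List.sum_toFinset _ hl, hF]
  have key : (hairyLie k V).unaryComp (hairLinear k V v) ∘ₗ (lieToHairy k V).app A =
      ∑ i, (hairyLie k V).insert i (hairLinear k V v) ∘ₗ (lieToHairy k V).app A := by
    refine lieOperad_hom_ext fun t ht => ?_
    rw [LinearMap.sum_apply, LinearMap.comp_apply, lieToHairy_lieTree, unaryComp_hairLinear]
    -- The identity was proved among all trees, where inputs may be missing and induction on
    -- branches is possible; here its multilinear part is taken.
    have h1 := congrArg ofTreeLie (TreeLie.sum_of_bind_update (k := k) (ℓ := (id : V → V)) v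
      Empty.elim t (fun a => (ht.2 a).le))
    have h2 : Finset.univ.filter (fun i => t.occ i ≠ 0) = Finset.univ := by
      ext i; simp [ht.2 i]
    rw [h2, TreeLie.join_of, map_sum, ofTreeLie_of ((ht.relabel _).node_hair v)] at h1
    refine Eq.trans h1.symm ?_
    refine Finset.sum_congr rfl fun i _ => ?_
    rw [LinearMap.comp_apply, lieToHairy_lieTree, insert_hairLinear]
    exact ofTreeLie_of ((ht.relabel _).bind_update (isLin_leaf.node_hair v) i)
  have := LinearMap.congr_fun key o
  rwa [LinearMap.sum_apply] at this

/-- The morphism is freely determined on `T(V)` by the lines with one hair and on `Lie` by the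
inclusion of trees without hairs. The commutation relations hold for elements of `V` and hence for
all of `T(V)`. -/
theorem exists_hopfLie_hom : ∃ Φ : Operad.Hom (hopfOperad k (TensorAlgebra k V) (lieOperad k))
      (hairyLie k V),
    (∀ (A : Type) [Finite A] (h : (algebraOperad k (TensorAlgebra k V)).obj A),
      Φ.app A (hopfOperad.ofHopf k (TensorAlgebra k V) (lieOperad k) A h) =
        ((hairyLie k V).tensorHom (hairLinear k V)).app A h) ∧
    ∀ (A : Type) [Finite A] (o : (lieOperad k).obj A),
      Φ.app A (hopfOperad.ofOperad k (TensorAlgebra k V) (lieOperad k) A o) =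
        (lieToHairy k V).app A o := by
  refine hopfOperad.exists_lift _ _ fun A _ h o l hl hl' => ?_
  have h1 : ((hairyLie k V).tensorHom (hairLinear k V)).app Unit ∘ₗ algebraOperadUnary k =
      (hairyLie k V).unaryOfTensor (hairLinear k V) :=
    LinearMap.ext fun h => Operad.tensorHom_unary _ _ h
  rw [Operad.tensorHom_unary, h1, ← Operad.unaryAction_eq_spread _ _ hl fun v =>
    unaryComp_hairLinear_lie v o hl hl', Operad.unaryAction_eq]
  rfl

end HairyLie

/-! ### Generation of the operad of trees with hairs -/

namespace HTree

variable {A B : Type} {D : Type v}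

theorem exists_map_val {P : A → Prop} {t : HTree A D} (h : ∀ a, t.occ a ≠ 0 → P a) :
    ∃ s : HTree {a // P a} D, s.map Subtype.val = t := by
  induction t with
  | leaf a => exact ⟨leaf ⟨a, h a (by simp [occ])⟩, rfl⟩
  | hair d => exact ⟨hair d, rfl⟩
  | node s t hs ht =>
    obtain ⟨s', rfl⟩ := hs fun a ha => h a (by simp only [occ]; omega)
    obtain ⟨t', rfl⟩ := ht fun a ha => h a (by simp only [occ]; omega)
    exact ⟨node s' t', rfl⟩

end HTree

section Generation

open HTree TreeOperad
open Finsupp hiding some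

variable {k : Type u} [Field k] {V : Type v} [AddCommGroup V] [Module k V] {A : Type} [Finite A]

theorem map_hairyTree {B : Type} [Finite B] (e : A ≃ B) (t : HTree A V) (ht : t.IsLin) :
    (hairyLie k V).map e (hairyTree k t ht) = hairyTree k (t.map e) (ht.map e) :=
  map_mk e t ht

theorem comp_hairyTree {B : Type} [Finite B] (s : HTree (Option A) V) (hs : s.IsLin)
    (t : HTree B V) (ht : t.IsLin) :
    (hairyLie k V).comp (hairyTree k s hs) (hairyTree k t ht) =
      hairyTree k (s.graft t) (hs.graft ht) :=
  comp_mk s hs t ht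

theorem isLin_vertex {D : Type v} : (node (leaf true) (leaf false) : HTree Bool D).IsLin :=
  ⟨⟨true⟩, fun a => by cases a <;> simp [HTree.occ]⟩

theorem treeVertex_eq : treeVertex k (id : V → V) = hairyTree k _ isLin_vertex := rfl

theorem hairyTree_swap {s t : HTree A V} (h : (node s t).IsLin) (h' : (node t s).IsLin) :
    hairyTree k (node s t) h = - hairyTree k (node t s) h' := by
  have := (Rel.as (k := k) (ℓ := (id : V → V)) s t).mk_eq_zero
  simp only [map_add, linearCombination_single, one_smul] at this
  rw [mk'_of_isLin h, mk'_of_isLin h'] at this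
  exact eq_neg_of_add_eq_zero_left this

theorem hairyTree_node_node {s t r : HTree A V} (h : (node (node s t) r).IsLin)
    (h' : (node s (node t r)).IsLin) (h'' : (node t (node s r)).IsLin) :
    hairyTree k _ h = hairyTree k _ h' - hairyTree k _ h'' := by
  have := (Rel.ihx (k := k) (ℓ := (id : V → V)) s t r).mk_eq_zero
  simp only [map_add, map_sub, linearCombination_single, one_smul] at this
  rw [mk'_of_isLin h, mk'_of_isLin h', mk'_of_isLin h''] at this
  exact (sub_eq_zero.1 ((sub_sub_eq_add_sub _ _ _).trans
    ((add_sub_right_comm _ _ _).trans this))  : _)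

/-- The trees with hairs are generated, as an operad, by the bracket and the lines with one
hair. -/
theorem hairyTree_mem {N : ∀ (A : Type) [Finite A], Submodule k ((hairyLie k V).obj A)}
    (one : (hairyLie k V).one ∈ N Unit) (hair : ∀ v, hairLinear k V v ∈ N Unit)
    (vertex : treeVertex k (id : V → V) ∈ N Bool)
    (map : ∀ {A B : Type} [Finite A] [Finite B] (e : A ≃ B), ∀ a ∈ N A,
      (hairyLie k V).map e a ∈ N B)
    (comp : ∀ {A B : Type} [Finite A] [Finite B], ∀ a ∈ N (Option A), ∀ b ∈ N B,
      (hairyLie k V).comp a b ∈ N (A ⊕ B)) (t : HTree A V) (ht : t.IsLin) :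
    hairyTree k t ht ∈ N A := by
  have hunary : ∀ {A : Type} [Finite A] (h), h ∈ N Unit → ∀ a ∈ N A,
      (hairyLie k V).unaryComp h a ∈ N A := fun h hh a ha =>
    map _ _ (comp _ (map _ _ hh) _ ha)
  -- A branch without inputs acts on the other branch like an element of the Lie algebra generated
  -- by the hairs. The Jacobi identity turns the action of a bracket into a commutator of actions,
  -- so the branch reduces to single hairs, and a single hair is grafted at the root.
  have hnode : ∀ {A : Type} [Finite A] (s : HTree A V) (_ : ∀ a, s.occ a = 0) (t : HTree A V)
      (ht : t.IsLin) (h : (node s t).IsLin), hairyTree k t ht ∈ N A →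
      hairyTree k (node s t) h ∈ N A := by
    intro A _ s hs
    induction s with
    | leaf a => exact absurd (hs a) (by simp [occ])
    | hair d =>
      intro t ht h hN
      rw [← unaryComp_hairLinear d t ht]
      exact hunary _ (hair d) _ hN
    | node a b iha ihb =>
      intro t ht h hN
      have ha : ∀ i, a.occ i = 0 := fun i => by have := hs i; simp only [occ] at this; omega
      have hb : ∀ i, b.occ i = 0 := fun i => by have := hs i; simp only [occ] at this; omega
      have lin : ∀ {x y : HTree A V}, (∀ i, x.occ i = 0) → y.IsLin → (node x y).IsLin :=
        fun hx hy => ⟨hy.1, fun i => by simp only [occ, hx i, hy.2 i]⟩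
      rw [hairyTree_node_node h (lin ha (lin hb ht)) (lin hb (lin ha ht))]
      exact sub_mem (iha ha _ (lin hb ht) _ (ihb hb _ ht _ hN))
        (ihb hb _ (lin ha ht) _ (iha ha _ ht _ hN))
  -- A branch uses only some of the inputs, so its arity set is smaller. The induction is therefore
  -- on the shape of the tree, for all trees `s` that become `t` after renaming inputs.
  suffices H : ∀ (t : HTree A V) (B : Type) [Finite B] (s : HTree B V) (f : B → A) (hs : s.IsLin),
      s.map f = t → hairyTree k s hs ∈ N B from H t A t id ht (bind_leaf t)
  intro t
  induction t with
  | leaf a =>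
    intro B _ s f hs h
    rcases s with b | d | ⟨s, t⟩
    · have hb : ∀ b', b = b' := fun b' => by
        have := hs.2 b'; simp only [occ] at this; by_contra hne; simp [hne] at this
      let e : Unit ≃ B := ⟨fun _ => b, fun _ => (), fun _ => rfl, hb⟩
      have : hairyTree k (leaf b) hs = (hairyLie k V).map e (hairyLie k V).one :=
        (map_mk e (leaf ()) isLin_leaf).symm
      rw [this]
      exact map _ _ one
    · exact absurd h (by simp [HTree.map, HTree.bind])
    · exact absurd h (by simp [HTree.map, HTree.bind])
  | hair d =>
    intro B _ s f hs h
    rcases s with b | d | ⟨s, t⟩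
    · exact absurd h (by simp [HTree.map, HTree.bind])
    · obtain ⟨b⟩ := hs.1
      exact absurd (hs.2 b) (by simp [occ])
    · exact absurd h (by simp [HTree.map, HTree.bind])
  | node s₀ t₀ ihs iht =>
    intro B _ r f hr h
    rcases r with b | d | ⟨s, t⟩
    · exact absurd h (by simp [HTree.map, HTree.bind])
    · exact absurd h (by simp [HTree.map, HTree.bind])
    obtain ⟨rfl, rfl⟩ : s.map f = s₀ ∧ t.map f = t₀ := by
      simpa [HTree.map, HTree.bind] using h
    have hst : ∀ b, s.occ b + t.occ b = 1 := hr.2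
    by_cases h1 : ∀ b, s.occ b = 0
    · have ht : t.IsLin := ⟨hr.1, fun b => by have := hst b; have := h1 b; omega⟩
      exact hnode s h1 t ht hr (iht B t f ht rfl)
    by_cases h2 : ∀ b, t.occ b = 0
    · have hs : s.IsLin := ⟨hr.1, fun b => by have := hst b; have := h2 b; omega⟩
      have hr' : (node t s).IsLin := ⟨hr.1, fun b => by simp only [occ]; have := hst b; omega⟩
      rw [hairyTree_swap hr hr']
      exact neg_mem (hnode t h2 s hs hr' (ihs B s f hs rfl))
    push Not at h1 h2
    obtain ⟨b₁, hb₁⟩ := h1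
    obtain ⟨b₂, hb₂⟩ := h2
    -- Both branches now contain inputs, and linearity divides the inputs between them. Each branch
    -- is cut down to its own inputs, and the tree is the bracket with these two branches grafted on
    -- it.
    set P : B → Prop := fun b => s.occ b ≠ 0
    set Q : B → Prop := fun b => t.occ b ≠ 0
    obtain ⟨s', hs'⟩ := exists_map_val (P := P) (t := s) fun _ h => h
    obtain ⟨t', ht'⟩ := exists_map_val (P := Q) (t := t) fun _ h => h
    have hsl : s'.IsLin := ⟨⟨⟨b₁, hb₁⟩⟩, fun b => by
      rw [← occ_map Subtype.val_injective, hs']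
      have := hst b; have : s.occ b.1 ≠ 0 := b.2; omega⟩
    have htl : t'.IsLin := ⟨⟨⟨b₂, hb₂⟩⟩, fun b => by
      rw [← occ_map Subtype.val_injective, ht']
      have := hst b; have : t.occ b.1 ≠ 0 := b.2; omega⟩
    have hsN := ihs _ s' (f ∘ Subtype.val) hsl (by rw [← hs', HTree.map_map])
    have htN := iht _ t' (f ∘ Subtype.val) htl (by rw [← ht', HTree.map_map])
    -- The first input of the bracket becomes the slot for the first grafting, and the second input
    -- the slot for the next one.
    let e₀ : Bool ≃ Option (Option Empty) :=
      { toFun := fun b => if b then none else some none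
        invFun := fun o => o.isNone
        left_inv := by rintro (_ | _) <;> rfl
        right_inv := by rintro (_ | _ | x); exacts [rfl, rfl, x.elim] }
    let e : (Empty ⊕ {b // P b}) ⊕ {b // Q b} ≃ B := Equiv.ofBijective
      (Sum.elim (Sum.elim Empty.elim Subtype.val) Subtype.val) (by
        constructor
        · rintro ((⟨⟨⟩⟩ | x) | x) ((⟨⟨⟩⟩ | y) | y) hxy
          · simp only [Sum.elim_inl, Sum.elim_inr] at hxy; rw [Subtype.ext hxy]
          · have hx := x.2; have hy := y.2; have := hst x.1
            simp only [Sum.elim_inl, Sum.elim_inr] at hxy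
            rw [← hxy] at hy
            simp only [P, Q] at hx hy; omega
          · have hx := x.2; have hy := y.2; have := hst x.1
            simp only [Sum.elim_inl, Sum.elim_inr] at hxy
            rw [← hxy] at hy
            simp only [P, Q] at hx hy; omega
          · simp only [Sum.elim_inr] at hxy; rw [Subtype.ext hxy]
        · intro b
          by_cases hb : P b
          · exact ⟨.inl (.inr ⟨b, hb⟩), rfl⟩
          · refine ⟨.inr ⟨b, ?_⟩, rfl⟩
            have := hst b
            simp only [P, Q] at hb ⊢; omega)
    have key : hairyTree k (node s t) hr = (hairyLie k V).map e ((hairyLie k V).comp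
        ((hairyLie k V).map (optSumL Empty {b // P b}) ((hairyLie k V).comp
          ((hairyLie k V).map e₀ (treeVertex k (id : V → V))) (hairyTree k s' hsl)))
        (hairyTree k t' htl)) := by
      rw [treeVertex_eq, map_hairyTree, comp_hairyTree, map_hairyTree, comp_hairyTree, map_hairyTree]
      refine mk_congr _ _ ?_
      rw [← hs', ← ht']
      refine congrArg₂ HTree.node ?_ ?_
      · change _ = HTree.bind _ (HTree.bind _ (HTree.bind _ (HTree.bind _ s')))
        simp only [bind_bind]
        rfl
      · change _ = HTree.bind _ (HTree.bind _ t')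
        rw [bind_bind]
        rfl
    rw [key]
    exact map _ _ (comp _ (map _ _ (comp _ (map _ _ vertex) _ hsN)) _ htN)

/-- A morphism of operads to the operad of trees with hairs is surjective if its image contains
the bracket and the lines with one hair. -/
theorem hairyLie_hom_surjective {P : Operad.{u, w} k} (F : Operad.Hom P (hairyLie k V))
    (hair : ∀ v, hairLinear k V v ∈ LinearMap.range (F.app Unit))
    (vertex : treeVertex k (id : V → V) ∈ LinearMap.range (F.app Bool)) :
    Function.Surjective (F.app A) := by
  rw [← LinearMap.range_eq_top, Submodule.eq_top_iff']
  intro x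
  induction x using TreeOperad.ind with
  | mk t ht =>
    refine hairyTree_mem (N := fun A _ => LinearMap.range (F.app A)) ⟨_, F.app_one⟩ hair vertex
      ?_ ?_ t ht
    · rintro A B _ _ e _ ⟨a, rfl⟩
      exact ⟨_, F.app_map e a⟩
    · rintro A B _ _ _ ⟨a, rfl⟩ _ ⟨b, rfl⟩
      exact ⟨_, F.app_comp a b⟩
  | add x y hx hy => exact add_mem hx hy
  | smul c x hx => exact Submodule.smul_mem _ c hx
  | zero => exact zero_mem _

end Generation

/-! ### Trees whose hairs are labelled by an input and an element of an algebra -/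

section Insertion

open HTree TreeOperad
open Finsupp hiding some

variable {k : Type u} [Field k] {A : Type} [DecidableEq A] {H : Type v} [Ring H] [Algebra k H]
  {N : Type w} [AddCommGroup N] [Module k N]

/-- The vector that a pair of an input and a coefficient stands for. -/
def pairVector (d : A × H) : A → H := Pi.single d.1 d.2

namespace HTree

/-- Make the hairs labelled by pairs the inputs, and forget the coefficients. -/
def forget : HTree Empty (A × H) → HTree A Empty
  | leaf a => a.elim
  | hair d => leaf d.1
  | node s t => node (forget s) (forget t)

/-- The sum of the labels of the hairs. -/
def weight : HTree Empty (A × H) → A → H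
  | leaf a => a.elim
  | hair d => pairVector d
  | node s t => weight s + weight t

theorem weight_eq_zero {t : HTree Empty (A × H)} {i : A} (h : t.forget.occ i = 0) :
    t.weight i = 0 := by
  induction t with
  | leaf a => exact a.elim
  | hair d =>
    have : i ≠ d.1 := by
      rintro rfl
      simp [forget, occ] at h
    exact Pi.single_eq_of_ne this _
  | node s t hs ht =>
    have h' : s.forget.occ i + t.forget.occ i = 0 := h
    change s.weight i + t.weight i = 0
    rw [hs (by omega), ht (by omega), add_zero]

end HTree

variable (k) in
/-- A function of a tree and of a family of coefficients that respects the relations between trees,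
and that is multilinear in the coefficients of the inputs of the tree. -/
structure IsTreeFunctional (G : HTree A Empty → (A → H) → N) : Prop where
  rel : ∀ (c : A → H) {q : HTree A Empty →₀ k}, Rel noLabels q →
    linearCombination k (fun u => G u c) q = 0
  add : ∀ {u : HTree A Empty} {i : A}, u.occ i = 1 → ∀ (c : A → H) (x y : H),
    G u (Function.update c i (x + y)) = G u (Function.update c i x) + G u (Function.update c i y)
  smul : ∀ {u : HTree A Empty} {i : A}, u.occ i = 1 → ∀ (c : A → H) (r : k) (x : H),
    G u (Function.update c i (r • x)) = r • G u (Function.update c i x)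
  zero : ∀ {u : HTree A Empty} {i : A}, 2 ≤ u.occ i → ∀ c : A → H, G u c = 0

namespace IsTreeFunctional

variable {G : HTree A Empty → (A → H) → N}

theorem update_add_weight {c : A → H} {t : HTree Empty (A × H)} {i : A}
    (h : t.forget.occ i = 0) (x : H) :
    Function.update c i x + t.weight = Function.update (c + t.weight) i x := by
  ext j
  by_cases hj : j = i
  · subst hj
    simp [weight_eq_zero h]
  · simp [hj]

/-- A relation occurs inside surrounding trees; this absorbs one surrounding branch into the
functional. If an input of `u` also occurs in that branch, it is repeated in the joined tree and the
`zero` axiom disposes of both sides. Otherwise the branch adds nothing to the coefficient of this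
input. -/
theorem left (hG : IsTreeFunctional k G) (t : HTree Empty (A × H)) :
    IsTreeFunctional k fun u c => G (node u t.forget) (c + t.weight) where
  rel c q hq := by
    have := hG.rel (c + t.weight) (hq.left t.forget)
    rwa [linearCombination_mapDomain] at this
  add {u i} hu c x y := by
    rcases Nat.eq_zero_or_pos (t.forget.occ i) with h | h
    · rw [update_add_weight h, update_add_weight h, update_add_weight h]
      exact hG.add (u := node u t.forget) (show u.occ i + t.forget.occ i = 1 by omega) _ x y
    · have : 2 ≤ (node u t.forget).occ i := show 2 ≤ u.occ i + t.forget.occ i by omega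
      simp only [hG.zero this, add_zero]
  smul {u i} hu c r x := by
    rcases Nat.eq_zero_or_pos (t.forget.occ i) with h | h
    · rw [update_add_weight h, update_add_weight h]
      exact hG.smul (u := node u t.forget) (show u.occ i + t.forget.occ i = 1 by omega) _ r x
    · have : 2 ≤ (node u t.forget).occ i := show 2 ≤ u.occ i + t.forget.occ i by omega
      simp only [hG.zero this, smul_zero]
  zero {u i} hu c := hG.zero (u := node u t.forget) (i := i) (show 2 ≤ u.occ i + t.forget.occ i by omega) _

theorem right (hG : IsTreeFunctional k G) (t : HTree Empty (A × H)) :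
    IsTreeFunctional k fun u c => G (node t.forget u) (t.weight + c) where
  rel c q hq := by
    have := hG.rel (t.weight + c) (hq.right t.forget)
    rwa [linearCombination_mapDomain] at this
  add {u i} hu c x y := by
    simp only [add_comm t.weight]
    rcases Nat.eq_zero_or_pos (t.forget.occ i) with h | h
    · rw [update_add_weight h, update_add_weight h, update_add_weight h]
      exact hG.add (u := node t.forget u) (show t.forget.occ i + u.occ i = 1 by omega) _ x y
    · have : 2 ≤ (node t.forget u).occ i := show 2 ≤ t.forget.occ i + u.occ i by omega
      simp only [hG.zero this, add_zero]
  smul {u i} hu c r x := by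
    simp only [add_comm t.weight]
    rcases Nat.eq_zero_or_pos (t.forget.occ i) with h | h
    · rw [update_add_weight h, update_add_weight h]
      exact hG.smul (u := node t.forget u) (show t.forget.occ i + u.occ i = 1 by omega) _ r x
    · have : 2 ≤ (node t.forget u).occ i := show 2 ≤ t.forget.occ i + u.occ i by omega
      simp only [hG.zero this, smul_zero]
  zero {u i} hu c := hG.zero (u := node t.forget u) (i := i) (show 2 ≤ t.forget.occ i + u.occ i by omega) _

/-- A linear relation between vectors may involve pairs with different inputs, for instance when a
coefficient is zero. The functional on single leaves is hence expressed by one linear map on all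
families, the sum of its values at the individual inputs. -/
theorem exists_linear [Fintype A] (hG : IsTreeFunctional k G) :
    ∃ g : (A → H) →ₗ[k] N, ∀ d : A × H, G (leaf d.1) (pairVector d) = g (pairVector d) := by
  have ho : ∀ a : A, (leaf a : HTree A Empty).occ a = 1 := fun a => if_pos rfl
  refine ⟨{ toFun := fun c => ∑ a, G (leaf a) (Function.update 0 a (c a))
            map_add' := fun c c' => ?_
            map_smul' := fun r c => ?_ }, fun d => ?_⟩
  · rw [← Finset.sum_add_distrib]
    exact Finset.sum_congr rfl fun a _ => hG.add (ho a) _ _ _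
  · rw [RingHom.id_apply, Finset.smul_sum]
    exact Finset.sum_congr rfl fun a _ => hG.smul (ho a) _ _ _
  · refine Eq.symm ((Finset.sum_eq_single d.1 (fun a _ ha => ?_) (by simp)).trans ?_)
    · rw [pairVector, Pi.single_eq_of_ne ha]
      have := hG.smul (ho a) 0 0 0
      rwa [zero_smul, zero_smul] at this
    · rw [pairVector, Pi.single_eq_same]
      rfl

/-- The induction on the relation is over all functionals at once, so that surrounding branches can
be absorbed by `left` and `right`. Antisymmetry and IHX preserve the total weight and become
relations between trees without coefficients; the hair relations reduce to linearity at a leaf. -/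
theorem linearCombination_eq_zero [Fintype A] (hG : IsTreeFunctional k G)
    {p : HTree Empty (A × H) →₀ k} (h : Rel pairVector p) :
    linearCombination k (fun t : HTree Empty (A × H) => G t.forget t.weight) p = 0 := by
  induction h generalizing G with
  | as s t =>
    have := hG.rel (s.weight + t.weight) (Rel.as s.forget t.forget)
    simp only [map_add, linearCombination_single] at this ⊢
    rw [← this]
    simp only [HTree.weight, forget, add_comm t.weight]
  | ihx s t r =>
    have := hG.rel (s.weight + t.weight + r.weight) (Rel.ihx s.forget t.forget r.forget)
    simp only [map_add, map_sub, linearCombination_single] at this ⊢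
    rw [← this]
    simp only [HTree.weight, forget, add_assoc, add_left_comm t.weight]
  | add d d₁ d₂ h =>
    obtain ⟨g, hg⟩ := hG.exists_linear
    simp only [map_sub, linearCombination_single, one_smul]
    change G (leaf d.1) (pairVector d) - G (leaf d₁.1) (pairVector d₁) -
      G (leaf d₂.1) (pairVector d₂) = 0
    rw [hg, hg, hg, h, map_add, add_sub_cancel_left, sub_self]
  | smul c d d₁ h =>
    obtain ⟨g, hg⟩ := hG.exists_linear
    simp only [map_sub, linearCombination_single, one_smul]
    change G (leaf d.1) (pairVector d) - c • G (leaf d₁.1) (pairVector d₁) = 0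
    rw [hg, hg, h, map_smul, sub_self]
  | left t _ ih =>
    rw [linearCombination_mapDomain]
    exact ih (hG.left t)
  | right s _ ih =>
    rw [linearCombination_mapDomain]
    exact ih (hG.right s)

end IsTreeFunctional

end Insertion

/-! ### Simultaneous insertion at several inputs -/

namespace Operad

variable {k : Type u} [Field k] (P : Operad.{u, w} k) {H : Type v} [Ring H] [Algebra k H]
  (j : H →ₗ[k] P.obj Unit) {A : Type} [Finite A]

/-- Insert unary operations at the inputs in a list. -/
noncomputable def insertList (l : List A) (c : A → H) : Module.End k (P.obj A) :=
  (l.map fun i => P.insert i (j (c i))).prod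

theorem insertList_congr {l : List A} {c c' : A → H} (h : ∀ i ∈ l, c i = c' i) :
    P.insertList j l c = P.insertList j l c' := by
  rw [insertList, insertList]
  congr 1
  exact List.map_congr_left fun i hi => by rw [h i hi]

/-- Insertions at distinct inputs commute, so the one at `i` can be made outermost; the rest, `y`,
does not depend on it. Linearity in the coefficient of `i` and its behaviour under multiplication
can then be read off. -/
theorem exists_insertList_update [DecidableEq A] {l : List A} (hl : l.Nodup) {i : A} (hi : i ∈ l)
    (c : A → H) (x : P.obj A) : ∃ y, ∀ h, P.insertList j l (Function.update c i h) x =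
      P.insert i (j h) y := by
  induction l with
  | nil => simp at hi
  | cons a l ih =>
    rw [List.nodup_cons] at hl
    by_cases hai : i = a
    · subst hai
      refine ⟨P.insertList j l c x, fun h => ?_⟩
      change P.insert i (j (Function.update c i h i)) (P.insertList j l (Function.update c i h) x) = _
      rw [Function.update_self, insertList_congr P j (c' := c)]
      intro b hb
      rw [Function.update_of_ne]
      rintro rfl
      exact hl.1 hb
    · obtain ⟨y, hy⟩ := ih hl.2 ((List.mem_cons.1 hi).resolve_left hai)
      refine ⟨P.insert a (j (c a)) y, fun h => ?_⟩
      change P.insert a (j (Function.update c i h a)) (P.insertList j l (Function.update c i h) x) = _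
      rw [hy, Function.update_of_ne (Ne.symm hai), P.insert_comm (Ne.symm hai)]

theorem insertList_one (hj : j 1 = P.one) (l : List A) (x : P.obj A) :
    P.insertList j l 1 x = x := by
  induction l with
  | nil => rfl
  | cons a l ih =>
    change P.insert a (j 1) (P.insertList j l 1 x) = x
    rw [ih, hj, P.insert_one]

/-- The further factor is inserted after `c i`, further from the operation, and such an insertion
corresponds to multiplication from the right. -/
theorem insertList_update_mul [DecidableEq A] (hj : ∀ g h : H, j (g * h) = P.unaryComp (j g) (j h))
    {l : List A} (hl : l.Nodup) {i : A} (hi : i ∈ l) (c : A → H) (h : H) (x : P.obj A) :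
    P.insertList j l (Function.update c i (c i * h)) x = P.insert i (j h) (P.insertList j l c x) := by
  obtain ⟨y, hy⟩ := P.exists_insertList_update j hl hi c x
  have := hy (c i)
  rw [Function.update_eq_self] at this
  rw [hy, this, hj, insert_unaryComp]

end Operad

/-! ### The inverse on the operad of trees with hairs -/

namespace TreeLie

open HTree TreeOperad
open Finsupp hiding some

variable {k : Type u} [Field k] {D : Type v} {W : Type w} [AddCommGroup W] [Module k W]
  {ℓ : D → W} {A : Type}

/-- Relabelling of the hairs. -/
noncomputable def relabel {f : D → D} {g : W →ₗ[k] W} (hf : ∀ d, ℓ (f d) = g (ℓ d)) :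
    TreeLie k ℓ A →ₗ[k] TreeLie k ℓ A :=
  lift (fun t => of k ℓ (t.relabel f)) fun p hp => by
    have := linearCombination_of_eq_zero (hp.relabel hf)
    rwa [linearCombination_mapDomain] at this

theorem relabel_of {f : D → D} {g : W →ₗ[k] W} (hf : ∀ d, ℓ (f d) = g (ℓ d)) (t : HTree A D) :
    relabel hf (of k ℓ t) = of k ℓ (t.relabel f) := lift_of _ _ _

theorem relabel_join {f : D → D} {g : W →ₗ[k] W} (hf : ∀ d, ℓ (f d) = g (ℓ d))
    (x y : TreeLie k ℓ A) : relabel hf (join x y) = join (relabel hf x) (relabel hf y) := by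
  induction x using ind with
  | of s =>
    induction y using ind with
    | of t => simp only [join_of, relabel_of, HTree.relabel]
    | add x y hx hy => simp only [map_add, hx, hy]
    | smul c x hx => simp only [map_smul, hx]
    | zero => simp only [map_zero]
  | add x y hx hy => simp only [map_add, LinearMap.add_apply, hx, hy]
  | smul c x hx => simp only [map_smul, LinearMap.smul_apply, hx]
  | zero => simp only [map_zero, LinearMap.zero_apply]

/-- Commutation need only hold for single labels. It is applied to left and right multiplication of
coefficients, where it amounts to associativity. -/
theorem relabel_deriv {f φ : D → D} {g Φ : W →ₗ[k] W} (hf : ∀ d, ℓ (f d) = g (ℓ d))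
    (hφ : ∀ d, ℓ (φ d) = Φ (ℓ d)) (h : ∀ d, f (φ d) = φ (f d)) (x : TreeLie k ℓ A) :
    relabel hf (deriv hφ x) = deriv hφ (relabel hf x) := by
  induction x using ind with
  | of s =>
    rw [deriv_of, relabel_of, deriv_of]
    induction s with
    | leaf a => exact map_zero _
    | hair d => simp only [derivTree, relabel_of, HTree.relabel, h]
    | node s t hs ht =>
      simp only [derivTree, HTree.relabel, map_add, relabel_join, hs, ht, relabel_of]
  | add x y hx hy => simp only [map_add, hx, hy]
  | smul c x hx => simp only [map_smul, hx]
  | zero => simp only [map_zero]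

theorem derivTree_add {φ φ₁ φ₂ : D → D} (h : ∀ d, ℓ (φ d) = ℓ (φ₁ d) + ℓ (φ₂ d))
    (t : HTree A D) : derivTree k ℓ φ t = derivTree k ℓ φ₁ t + derivTree k ℓ φ₂ t := by
  induction t with
  | leaf a => exact (add_zero _).symm
  | hair d =>
    have := linearCombination_of_eq_zero (Rel.add (k := k) (ℓ := ℓ) (A := A) _ _ _ (h d))
    simp only [map_sub, linearCombination_single, one_smul] at this
    exact sub_eq_zero.1 ((sub_sub _ _ _).symm.trans this)
  | node s t hs ht =>
    simp only [derivTree, hs, ht, map_add, LinearMap.add_apply]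
    abel

theorem derivTree_smul {φ φ₁ : D → D} (c : k) (h : ∀ d, ℓ (φ d) = c • ℓ (φ₁ d))
    (t : HTree A D) : derivTree k ℓ φ t = c • derivTree k ℓ φ₁ t := by
  induction t with
  | leaf a => exact (smul_zero _).symm
  | hair d =>
    have := linearCombination_of_eq_zero (Rel.smul (k := k) (ℓ := ℓ) (A := A) c _ _ (h d))
    simp only [map_sub, linearCombination_single, one_smul] at this
    exact sub_eq_zero.1 this
  | node s t hs ht =>
    simp only [derivTree, hs, ht, map_smul, LinearMap.smul_apply, smul_add]

end TreeLie

/-! ### Pushing hairs to the inputs by evaluation in a semidirect sum -/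

section PairLie

open HTree TreeOperad LieAlgebra
open Finsupp hiding some

variable (k : Type u) [Field k] (V : Type v) [AddCommGroup V] [Module k V] (A : Type)
  [DecidableEq A]

/-- The space of trees whose hairs are labelled by an input and a coefficient in the tensor
algebra. -/
abbrev PairLie : Type _ :=
  TreeLie k (pairVector : A × TensorAlgebra k V → A → TensorAlgebra k V) Empty

variable {k V A}

/-- Multiply the coefficients from the left. -/
def mulCoeff (h : TensorAlgebra k V) (d : A × TensorAlgebra k V) : A × TensorAlgebra k V :=
  (d.1, h * d.2)

theorem pairVector_mulCoeff (h : TensorAlgebra k V) (d : A × TensorAlgebra k V) :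
    pairVector (mulCoeff h d) = (LinearMap.mulLeft k h).compLeft A (pairVector d) := by
  ext i
  by_cases hi : i = d.1
  · subst hi; simp [pairVector, mulCoeff]
  · simp [pairVector, mulCoeff, hi]

/-- Multiply the coefficients of the input `i` from the right. -/
def coeffMul (i : A) (h : TensorAlgebra k V) (d : A × TensorAlgebra k V) : A × TensorAlgebra k V :=
  (d.1, if d.1 = i then d.2 * h else d.2)

/-- `coeffMul` on families of coefficients. -/
def familyMul (i : A) (h : TensorAlgebra k V) : (A → TensorAlgebra k V) →ₗ[k] A → TensorAlgebra k V where
  toFun c := Function.update c i (c i * h)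
  map_add' c c' := by
    ext j
    by_cases hj : j = i
    · subst hj; simp [add_mul]
    · simp [hj]
  map_smul' r c := by
    ext j
    by_cases hj : j = i
    · subst hj; simp
    · simp [hj]

theorem pairVector_coeffMul (i : A) (h : TensorAlgebra k V) (d : A × TensorAlgebra k V) :
    pairVector (coeffMul i h d) = familyMul i h (pairVector d) := by
  ext j
  by_cases hj : j = i
  · subst hj
    by_cases hd : j = d.1
    · subst hd; simp [pairVector, coeffMul, familyMul]
    · simp [pairVector, coeffMul, familyMul, hd]
  · by_cases hd : j = d.1
    · subst hd; simp [pairVector, coeffMul, familyMul, hj]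
    · simp [pairVector, coeffMul, familyMul, hd, hj]

theorem forget_relabel_coeffMul (i : A) (h : TensorAlgebra k V)
    (t : HTree Empty (A × TensorAlgebra k V)) : (t.relabel (coeffMul i h)).forget = t.forget := by
  induction t with
  | leaf a => exact a.elim
  | hair d => rfl
  | node s t hs ht => exact congrArg₂ node hs ht

theorem weight_relabel_coeffMul (i : A) (h : TensorAlgebra k V)
    (t : HTree Empty (A × TensorAlgebra k V)) :
    (t.relabel (coeffMul i h)).weight = familyMul i h t.weight := by
  induction t with
  | leaf a => exact a.elim
  | hair d => exact pairVector_coeffMul i h d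
  | node s t hs ht =>
    change _ + _ = familyMul i h (s.weight + t.weight)
    rw [map_add, hs, ht]

variable [CharZero k]

/-- The derivation of multiplying the coefficients by `v` from the left. -/
noncomputable def mulDeriv : V →ₗ[k] LieDerivation k (PairLie k V A) (PairLie k V A) where
  toFun v := TreeLie.lieDeriv (pairVector_mulCoeff (TensorAlgebra.ι k v))
  map_add' v w := LieDerivation.ext fun x => by
    have : TreeLie.deriv (A := Empty) (pairVector_mulCoeff (A := A) (TensorAlgebra.ι k (v + w))) =
        TreeLie.deriv (pairVector_mulCoeff (TensorAlgebra.ι k v)) +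
          TreeLie.deriv (pairVector_mulCoeff (TensorAlgebra.ι k w)) := TreeLie.hom_ext fun t => by
      rw [LinearMap.add_apply, TreeLie.deriv_of, TreeLie.deriv_of, TreeLie.deriv_of]
      refine TreeLie.derivTree_add (fun d => ?_) t
      simp only [mulCoeff, pairVector, map_add, add_mul, Pi.single_add]
    exact LinearMap.congr_fun this x
  map_smul' c v := LieDerivation.ext fun x => by
    have : TreeLie.deriv (A := Empty) (pairVector_mulCoeff (A := A) (TensorAlgebra.ι k (c • v))) =
        c • TreeLie.deriv (pairVector_mulCoeff (TensorAlgebra.ι k v)) :=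
      TreeLie.hom_ext fun t => by
        rw [LinearMap.smul_apply, TreeLie.deriv_of, TreeLie.deriv_of]
        refine TreeLie.derivTree_smul c (fun d => ?_) t
        simp only [mulCoeff, pairVector, map_smul, smul_mul_assoc, Pi.single_smul]
    exact LinearMap.congr_fun this x

theorem mulDeriv_apply (v : V) (x : PairLie k V A) :
    mulDeriv v x = TreeLie.deriv (pairVector_mulCoeff (TensorAlgebra.ι k v)) x := rfl

theorem relabel_mulDeriv (i : A) (h : TensorAlgebra k V) (v : V) (x : PairLie k V A) :
    TreeLie.relabel (pairVector_coeffMul i h) (mulDeriv v x) =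
      mulDeriv v (TreeLie.relabel (pairVector_coeffMul i h) x) := by
  refine TreeLie.relabel_deriv _ (pairVector_mulCoeff (TensorAlgebra.ι k v)) (fun d => ?_) x
  by_cases hd : d.1 = i <;> simp only [coeffMul, mulCoeff, hd, if_true, if_false, mul_assoc]

/-- The class of the input `a`, with coefficient one. -/
noncomputable def pairLeaf (a : A) : PairLie k V A := TreeLie.of k _ (hair (a, 1))

/-- Push the hairs of a tree to the inputs: a hair at the root becomes a derivation, and the hairs
above an input are multiplied to form the coefficient of this input. -/
noncomputable def pushHairs : TreeLie k (id : V → V) A →ₗ[k]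
    (PairLie k V A ⋊⁅LieHom.id⁆ LieDerivation k (PairLie k V A) (PairLie k V A)) :=
  TreeLie.eval (fun a => SemiDirectSum.inl _ (pairLeaf a))
    ((SemiDirectSum.inr _ : _ →ₗ⁅k⁆ _).toLinearMap ∘ₗ mulDeriv)

theorem pushHairs_leaf (a : A) : pushHairs (TreeLie.of k (id : V → V) (leaf a)) =
    ⟨pairLeaf a, 0⟩ := TreeLie.eval_of _ _ _

theorem pushHairs_hair (v : V) : pushHairs (A := A) (TreeLie.of k (id : V → V) (hair v)) =
    ⟨0, mulDeriv v⟩ := TreeLie.eval_of _ _ _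

theorem pushHairs_node (s t : HTree A V) :
    pushHairs (TreeLie.of k (id : V → V) (node s t)) =
      ⁅pushHairs (TreeLie.of k (id : V → V) s), pushHairs (TreeLie.of k (id : V → V) t)⁆ := by
  rw [pushHairs, ← TreeLie.eval_lie, TreeLie.lie_of]

/-- The derivation attached to a tree is built by commutators from left multiplications by elements
of `V`, and each of these commutes with multiplying one coefficient from the right. -/
theorem relabel_pushHairs_right (i : A) (h : TensorAlgebra k V) (t : HTree A V)
    (x : PairLie k V A) :
    TreeLie.relabel (pairVector_coeffMul i h) ((pushHairs (TreeLie.of k (id : V → V) t)).right x) =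
      (pushHairs (TreeLie.of k (id : V → V) t)).right
        (TreeLie.relabel (pairVector_coeffMul i h) x) := by
  induction t generalizing x with
  | leaf a => rw [pushHairs_leaf]; exact map_zero _
  | hair v => rw [pushHairs_hair]; exact relabel_mulDeriv i h v x
  | node s t hs ht =>
    rw [pushHairs_node, SemiDirectSum.lie_eq_mk]
    simp only [LieDerivation.commutator_apply, map_sub, hs, ht]

/-- Everything that happens to an input on the way to the root multiplies its coefficient from the
left. A hair directly above the input `i` acts first, on the coefficient `1`, and so amounts to
right multiplication by `v` in the final result. The derivation component is unchanged, since it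
does not see the inputs. -/
theorem pushHairs_bind_update (i : A) (v : V) (t : HTree A V) :
    pushHairs (TreeLie.of k (id : V → V)
        (t.bind (Function.update leaf i (node (hair v) (leaf i))))) =
      ⟨TreeLie.relabel (pairVector_coeffMul i (TensorAlgebra.ι k v))
        (pushHairs (TreeLie.of k (id : V → V) t)).left,
        (pushHairs (TreeLie.of k (id : V → V) t)).right⟩ := by
  induction t with
  | leaf a =>
    by_cases ha : a = i
    · subst ha
      simp only [HTree.bind, Function.update_self]
      -- The derivation of `v` sends `i` with coefficient `1` to `i` with coefficient `v * 1`, which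
      -- is also `1 * v`.
      rw [pushHairs_node, pushHairs_leaf, pushHairs_hair, SemiDirectSum.lie_eq_mk]
      simp only [zero_lie, lie_zero, zero_add, map_zero, LieHom.id_apply, sub_zero, mulDeriv_apply]
      rw [pairLeaf, TreeLie.deriv_of, TreeLie.relabel_of]
      simp [TreeLie.derivTree, mulCoeff, HTree.relabel, coeffMul]
    · simp only [HTree.bind, Function.update_of_ne ha]
      rw [pushHairs_leaf, pairLeaf, TreeLie.relabel_of]
      simp [HTree.relabel, coeffMul, ha]
  | hair w =>
    simp only [HTree.bind, pushHairs_hair, map_zero]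
  | node s t hs ht =>
    rw [HTree.bind, pushHairs_node, pushHairs_node, hs, ht, SemiDirectSum.lie_eq_mk,
      SemiDirectSum.lie_eq_mk]
    simp only [LieHom.id_apply, map_sub, map_add, relabel_pushHairs_right]
    congr 3
    exact (TreeLie.relabel_join _ _ _).symm

end PairLie

/-! ### The linear left inverse and injectivity -/

section Inverse

open HTree TreeOperad LieAlgebra
open Finsupp hiding some

/-- Each coefficient enters through a single insertion, which is linear. Trees with a repeated input
have class zero in the Lie operad by the convention of `mk'`. -/
theorem isTreeFunctional_insertList {k : Type u} [Field k] {A : Type} [DecidableEq A] [Finite A]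
    {H : Type v} [Ring H] [Algebra k H] (P : Operad.{u, w} k) (j : H →ₗ[k] P.obj Unit)
    (f : (lieOperad k).obj A →ₗ[k] P.obj A) {l : List A} (hl : l.Nodup) (hl' : ∀ i, i ∈ l) :
    IsTreeFunctional k fun (u : HTree A Empty) (c : A → H) =>
      P.insertList j l c (f (mk' k noLabels u)) where
  rel c q hq := by
    have h := congrArg (P.insertList j l c ∘ₗ f) hq.mk_eq_zero
    refine Eq.trans ?_ (h.trans (map_zero (P.insertList j l c ∘ₗ f)))
    exact LinearMap.congr_fun
      (linearCombination_linear_comp (M := (lieOperad k).obj A) (v := mk' k noLabels) k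
        (P.insertList j l c ∘ₗ f)) q
  add {u i} _ c x y := by
    obtain ⟨z, hz⟩ := P.exists_insertList_update j hl (hl' i) c (f (mk' k noLabels u))
    rw [hz, hz, hz, map_add, map_add, LinearMap.add_apply]
  smul {u i} _ c r x := by
    obtain ⟨z, hz⟩ := P.exists_insertList_update j hl (hl' i) c (f (mk' k noLabels u))
    rw [hz, hz, map_smul, map_smul, LinearMap.smul_apply]
  zero {u i} hu c := by
    have : mk' k noLabels u = 0 := dif_neg fun h => by have := h.2 i; omega
    rw [this]
    exact ((congrArg _ (map_zero f)).trans (map_zero (P.insertList j l c)))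

/-- Without hairs the evaluation stays in `L`, and each occurrence of an input has coefficient one.
Counting occurrences makes the statement inductive; for a tree with each input exactly once, the
weight is constantly one. -/
theorem pushHairs_relabel {k : Type u} [Field k] [CharZero k] {V : Type v} [AddCommGroup V]
    [Module k V] {A : Type} [DecidableEq A] (t : HTree A Empty) :
    ∃ t' : HTree Empty (A × TensorAlgebra k V), t'.forget = t ∧ (∀ i, t'.weight i = t.occ i) ∧
      pushHairs (TreeLie.of k (id : V → V) (t.relabel Empty.elim)) = ⟨TreeLie.of k _ t', 0⟩ := by
  induction t with
  | leaf a =>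
    refine ⟨hair (a, 1), rfl, fun i => ?_, pushHairs_leaf a⟩
    by_cases hi : i = a
    · subst hi; simp [HTree.weight, pairVector, occ]
    · simp [HTree.weight, pairVector, occ, hi, Ne.symm hi]
  | hair d => exact d.elim
  | node s t hs ht =>
    obtain ⟨s', hs1, hs2, hs3⟩ := hs
    obtain ⟨t', ht1, ht2, ht3⟩ := ht
    refine ⟨node s' t', congrArg₂ node hs1 ht1, fun i => ?_, ?_⟩
    · change s'.weight i + t'.weight i = ((s.occ i + t.occ i : ℕ) : TensorAlgebra k V)
      rw [hs2, ht2, Nat.cast_add]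
    · rw [HTree.relabel, pushHairs_node, hs3, ht3, SemiDirectSum.lie_eq_mk]
      simp [TreeLie.lie_of]

variable {k : Type u} [Field k] {V : Type v} [AddCommGroup V] [Module k V] {A : Type}
  [Finite A] [DecidableEq A]

variable (k V) in
/-- Trees with coefficients as operations of `H Lie`. -/
noncomputable def pairToHopf {l : List A} (hl : l.Nodup) (hl' : ∀ i, i ∈ l) :
    PairLie k V A →ₗ[k] (hopfOperad k (TensorAlgebra k V) (lieOperad k)).obj A :=
  have := Fintype.ofFinite A
  TreeLie.lift (fun t => (hopfOperad k (TensorAlgebra k V) (lieOperad k)).insertList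
      (hopfOperad.unary k (TensorAlgebra k V) (lieOperad k)) l t.weight
      (hopfOperad.ofOperad k (TensorAlgebra k V) (lieOperad k) A (mk' k noLabels t.forget)))
    fun _ hp => (isTreeFunctional_insertList _ _ _ hl hl').linearCombination_eq_zero hp

theorem pairToHopf_of {l : List A} (hl : l.Nodup) (hl' : ∀ i, i ∈ l)
    (t : HTree Empty (A × TensorAlgebra k V)) :
    pairToHopf k V hl hl' (TreeLie.of k _ t) =
      (hopfOperad k (TensorAlgebra k V) (lieOperad k)).insertList
        (hopfOperad.unary k (TensorAlgebra k V) (lieOperad k)) l t.weight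
        (hopfOperad.ofOperad k (TensorAlgebra k V) (lieOperad k) A (mk' k noLabels t.forget)) := by
  rw [pairToHopf]
  exact TreeLie.lift_of _ _ _

/-- Multiplying the coefficient of `i` from the right in `L` becomes an insertion at `i` in `H Lie`;
the underlying tree does not change. -/
theorem pairToHopf_relabel {l : List A} (hl : l.Nodup) (hl' : ∀ i, i ∈ l) (i : A)
    (h : TensorAlgebra k V) (x : PairLie k V A) :
    pairToHopf k V hl hl' (TreeLie.relabel (pairVector_coeffMul i h) x) =
      (hopfOperad k (TensorAlgebra k V) (lieOperad k)).insert i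
        (hopfOperad.unary k (TensorAlgebra k V) (lieOperad k) h) (pairToHopf k V hl hl' x) := by
  induction x using TreeLie.ind with
  | of t =>
    rw [TreeLie.relabel_of, pairToHopf_of, pairToHopf_of, forget_relabel_coeffMul,
      weight_relabel_coeffMul]
    exact Operad.insertList_update_mul _ _ (hopfOperad.unary_mul _ _ _) hl (hl' i) _ _ _
  | add x y hx hy => simp only [map_add, hx, hy]
  | smul c x hx => simp only [map_smul, hx]
  | zero => simp only [map_zero]

variable [CharZero k]

variable (k V) in
/-- The map from the operad of trees with hairs to `H Lie`. -/
noncomputable def hairyToHopf {l : List A} (hl : l.Nodup) (hl' : ∀ i, i ∈ l) :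
    (hairyLie k V).obj A →ₗ[k] (hopfOperad k (TensorAlgebra k V) (lieOperad k)).obj A :=
  pairToHopf k V hl hl' ∘ₗ SemiDirectSum.projl _ ∘ₗ pushHairs ∘ₗ toTreeLie

theorem hairyToHopf_hairyTree {l : List A} (hl : l.Nodup) (hl' : ∀ i, i ∈ l) (t : HTree A V)
    (ht : t.IsLin) : hairyToHopf k V hl hl' (hairyTree k t ht) =
      pairToHopf k V hl hl' (pushHairs (TreeLie.of k (id : V → V) t)).left :=
  congrArg (fun x => pairToHopf k V hl hl' (pushHairs x).left) (toTreeLie_mk t ht)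

theorem hairyToHopf_insert {l : List A} (hl : l.Nodup) (hl' : ∀ i, i ∈ l) (i : A) (v : V)
    (x : (hairyLie k V).obj A) :
    hairyToHopf k V hl hl' ((hairyLie k V).insert i (hairLinear k V v) x) =
      (hopfOperad k (TensorAlgebra k V) (lieOperad k)).insert i
        (hopfOperad.unary k (TensorAlgebra k V) (lieOperad k) (TensorAlgebra.ι k v))
        (hairyToHopf k V hl hl' x) := by
  have key : hairyToHopf k V hl hl' ∘ₗ (hairyLie k V).insert i (hairLinear k V v) =
      (hopfOperad k (TensorAlgebra k V) (lieOperad k)).insert i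
        (hopfOperad.unary k (TensorAlgebra k V) (lieOperad k) (TensorAlgebra.ι k v)) ∘ₗ
        hairyToHopf k V hl hl' := by
    refine hairyLie_hom_ext fun t ht => ?_
    rw [LinearMap.comp_apply, LinearMap.comp_apply, insert_hairLinear,
      hairyToHopf_hairyTree hl hl' t, ← pairToHopf_relabel]
    exact (hairyToHopf_hairyTree hl hl' _ _).trans
      (congrArg (fun x => pairToHopf k V hl hl' x.left) (pushHairs_bind_update i v t))
  exact LinearMap.congr_fun key x

/-- Insertion at an input reverses products in both operads, so the case of `V` extends to the whole
tensor algebra by iteration. -/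
theorem hairyToHopf_insert_unaryOfTensor {l : List A} (hl : l.Nodup) (hl' : ∀ i, i ∈ l) (i : A)
    (h : TensorAlgebra k V) (x : (hairyLie k V).obj A) :
    hairyToHopf k V hl hl' ((hairyLie k V).insert i
        ((hairyLie k V).unaryOfTensor (hairLinear k V) h) x) =
      (hopfOperad k (TensorAlgebra k V) (lieOperad k)).insert i
        (hopfOperad.unary k (TensorAlgebra k V) (lieOperad k) h) (hairyToHopf k V hl hl' x) := by
  induction h using TensorAlgebra.induction generalizing x with
  | algebraMap r =>
    rw [Algebra.algebraMap_eq_smul_one, map_smul, map_smul, map_smul, map_smul,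
      Operad.unaryOfTensor_one, hopfOperad.unary_one, LinearMap.smul_apply, LinearMap.smul_apply,
      map_smul, Operad.insert_one, Operad.insert_one]
  | ι v => rw [Operad.unaryOfTensor_ι, hairyToHopf_insert]
  | add g h hg hh => simp only [map_add, LinearMap.add_apply, hg, hh]
  | mul g h hg hh =>
    rw [Operad.unaryOfTensor_mul, hopfOperad.unary_mul, Operad.insert_unaryComp,
      Operad.insert_unaryComp, hh, hg]

/-- On a tree without hairs all coefficients are one, and inserting ones gives back the Lie
operation. -/
theorem hairyToHopf_lieToHairy {l : List A} (hl : l.Nodup) (hl' : ∀ i, i ∈ l)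
    (o : (lieOperad k).obj A) :
    hairyToHopf k V hl hl' ((lieToHairy k V).app A o) =
      hopfOperad.ofOperad k (TensorAlgebra k V) (lieOperad k) A o := by
  have key : hairyToHopf k V hl hl' ∘ₗ (lieToHairy k V).app A =
      hopfOperad.ofOperad k (TensorAlgebra k V) (lieOperad k) A := by
    refine lieOperad_hom_ext fun t ht => ?_
    rw [LinearMap.comp_apply, lieToHairy_lieTree, hairyToHopf_hairyTree]
    obtain ⟨t', ht1, ht2, ht3⟩ := pushHairs_relabel (k := k) (V := V) t
    have hw : t'.weight = 1 := funext fun i => by rw [ht2, ht.2 i, Nat.cast_one]; rfl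
    rw [ht3, pairToHopf_of, ht1, hw, Operad.insertList_one _ _ rfl, mk'_of_isLin ht]
    rfl
  exact LinearMap.congr_fun key o

/-- The map back is only known to be linear and to respect insertions of elements of `H`. This
suffices, because Lie operations and insertions already span `H Lie`, and on these the composite
with `Φ` is the identity. -/
theorem hopfLie_hom_injective
    {Φ : Operad.Hom (hopfOperad k (TensorAlgebra k V) (lieOperad k)) (hairyLie k V)}
    (hΦ : ∀ h, Φ.app Unit (hopfOperad.unary k (TensorAlgebra k V) (lieOperad k) h) =
      (hairyLie k V).unaryOfTensor (hairLinear k V) h)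
    (hΦ' : ∀ (A : Type) [Finite A] (o : (lieOperad k).obj A),
      Φ.app A (hopfOperad.ofOperad k (TensorAlgebra k V) (lieOperad k) A o) =
        (lieToHairy k V).app A o) (A : Type) [Finite A] : Function.Injective (Φ.app A) := by
  classical
  have key : ∀ {A : Type} [Finite A] {x : (hopfOperad k (TensorAlgebra k V) (lieOperad k)).obj A}
      (_ : hopfOperad.InsertSpan x) {l : List A} (hl : l.Nodup) (hl' : ∀ i, i ∈ l),
      hairyToHopf k V hl hl' (Φ.app A x) = x := by
    intro A _ x hx l hl hl'
    induction hx with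
    | of o => rw [hΦ', hairyToHopf_lieToHairy]
    | insert i h _ ih => rw [Φ.app_insert, hΦ, hairyToHopf_insert_unaryOfTensor, ih]
    | zero => simp only [map_zero]
    | add _ _ hx hy => simp only [map_add, hx, hy]
    | smul c _ hx => simp only [map_smul, hx]
  have := Fintype.ofFinite A
  have hl' : ∀ i : A, i ∈ Finset.univ.toList := by simp
  exact Function.LeftInverse.injective (g := hairyToHopf k V (Finset.nodup_toList _) hl')
    fun x => key (hopfOperad.insertSpan A x) _ _

end Inverse

/-! ### Cyclic structures -/

namespace Operad

variable {k : Type u} [Field k]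

namespace CyclicStructure

variable {P : Operad.{u, v} k}

theorem act_map (C : P.CyclicStructure) {A B Z : Type} [Finite A] [Finite B] [Finite Z]
    (f : A ≃ B) (e : Option B ≃ Option Z) (x : P.obj A) :
    C.act e (P.map f x) = C.act ((Equiv.optionCongr f).trans e) x := by
  rw [C.act_trans, C.act_optionCongr]

/-- Two bijections of entries that take the same entry to the root act in the same way, up to a
bijection of the inputs. -/
theorem exists_act_eq_map {A B Z : Type} [Finite A] [Finite B] [Finite Z]
    (e₀ : Option A ≃ Option B) (e : Option A ≃ Option Z) (h : e (e₀.symm none) = none) :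
    ∃ g : B ≃ Z, ∀ (C : P.CyclicStructure) (x : P.obj A), C.act e x = P.map g (C.act e₀ x) := by
  obtain ⟨g, hg⟩ := exists_optionCongr (e₀.symm.trans e) h
  refine ⟨g, fun C x => ?_⟩
  rw [← C.act_optionCongr, ← hg, ← C.act_trans, ← Equiv.trans_assoc, Equiv.self_trans_symm,
    Equiv.refl_trans]

/-- If two cyclic structures agree on two operations, they agree on the composition. -/
theorem act_comp_eq {C C' : P.CyclicStructure} {A B : Type} [Finite A] [Finite B]
    {x : P.obj (Option A)} {y : P.obj B}
    (hx : ∀ (Z : Type) [Finite Z] (e : Option (Option A) ≃ Option Z), C.act e x = C'.act e x)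
    (hy : ∀ (Z : Type) [Finite Z] (e : Option B ≃ Option Z), C.act e y = C'.act e y)
    (Z : Type) [Finite Z] (e : Option (A ⊕ B) ≃ Option Z) :
    C.act e (P.comp x y) = C'.act e (P.comp x y) := by
  classical
  obtain ⟨r, hr⟩ := e.surjective none
  rcases r with _ | a | b
  -- The root stays the root, and both actions are the relabelling of inputs.
  · obtain ⟨f, rfl⟩ := exists_optionCongr e hr
    rw [C.act_optionCongr, C'.act_optionCongr]
  -- An input of `x` becomes the root. Up to renaming inputs this is the exchange of `a` and the
  -- root within `x`, with `y` untouched.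
  · obtain ⟨g, hg⟩ := exists_act_eq_map (P := P)
      (extendSum (Equiv.swap none (some a)) B) e (by
        refine Eq.trans (congrArg e ?_) hr
        rw [Equiv.symm_apply_eq]
        simp [extendSum, optSumL])
    rw [hg, hg, C.act_comp_left, C'.act_comp_left, hx]
  -- An input of `y` becomes the root. After renaming it to the added point, the rotation law
  -- exchanges the roles of the two factors.
  · obtain ⟨B', _, σ, hσ⟩ : ∃ (B' : Type) (_ : Finite B') (σ : B ≃ Option B'), σ b = none :=
      ⟨_, inferInstance, splitOff b, by simp [splitOff]⟩
    obtain ⟨y', rfl⟩ : ∃ y', P.map σ.symm y' = y :=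
      ⟨P.map σ y, by rw [map_map, Equiv.self_trans_symm, P.map_refl]⟩
    have hy' : ∀ (Z : Type) [Finite Z] (e : Option (Option B') ≃ Option Z),
        C.act e y' = C'.act e y' := by
      intro Z _ e
      have := hy Z ((Equiv.optionCongr σ).trans e)
      rwa [C.act_map, C'.act_map, ← Equiv.trans_assoc, ← Equiv.optionCongr_trans,
        Equiv.symm_trans_self, Equiv.optionCongr_refl, Equiv.refl_trans] at this
    rw [comp_map_right, C.act_map, C'.act_map]
    obtain ⟨g, hg⟩ := exists_act_eq_map (P := P) (rotateComp A B')
      ((Equiv.optionCongr (Equiv.sumCongr (Equiv.refl A) σ.symm)).trans e) (by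
        refine Eq.trans (congrArg e ?_) hr
        change some (Sum.inr (σ.symm none)) = _
        rw [(Equiv.symm_apply_eq σ).2 hσ.symm])
    rw [hg, hg, C.act_comp_rotate, C'.act_comp_rotate, hx, hy']

/-- A cyclic structure transported along an isomorphism of operads. -/
def transport {Q : Operad.{u, w} k} (D : Q.CyclicStructure) (f : Iso P Q) :
    P.CyclicStructure where
  act {A B} _ _ e := (f.app B).symm.toLinearMap ∘ₗ D.act e ∘ₗ (f.app A).toLinearMap
  act_optionCongr {A B} _ _ e a := by
    refine (LinearEquiv.symm_apply_eq _).2 ?_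
    rw [f.app_map, ← D.act_optionCongr]
    rfl
  act_trans {A B Z} _ _ _ e g a := by
    refine (LinearEquiv.symm_apply_eq _).2 ?_
    simp [D.act_trans]
  act_comp_left e a b := by
    refine (LinearEquiv.symm_apply_eq _).2 ?_
    simp [f.app_comp, D.act_comp_left]
  act_comp_rotate a b := by
    refine (LinearEquiv.symm_apply_eq _).2 ?_
    simp [f.app_comp, D.act_comp_rotate]

theorem app_transport_act {Q : Operad.{u, w} k} (D : Q.CyclicStructure) (f : Iso P Q)
    {A B : Type} [Finite A] [Finite B] (e : Option A ≃ Option B) (a : P.obj A) :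
    f.app B ((D.transport f).act e a) = D.act e (f.app A a) :=
  (f.app B).apply_symm_apply _

end CyclicStructure

theorem insert_unit_one (P : Operad.{u, v} k) (h : P.obj Unit) : P.insert () h P.one = h := by
  rw [P.insert_eq unitOpt rfl]
  refine Eq.trans (P.map_congr (fun x => ?_) _) (P.one_comp h)
  rcases x with x | x
  · exact x.elim
  · rfl

end Operad

/-- `H Lie` is generated by the two suboperads on which the action is prescribed, and agreement of
two cyclic structures passes to renamings, compositions and linear combinations. The argument works
for any `H𝒪`. -/
theorem IsInducedCyclic.unique {k : Type u} [Field k] {H : Type v} [Ring H] [HopfAlgebra k H]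
    [Coalgebra.IsCocomm k H] {O : Operad.{u, w} k} {D : O.CyclicStructure}
    {C C' : (hopfOperad k H O).CyclicStructure} (hC : IsInducedCyclic k H O D C)
    (hC' : IsInducedCyclic k H O D C') : C = C' := by
  have key : ∀ (A : Type) [Finite A] (x : (hopfOperad k H O).obj A) (B : Type) [Finite B]
      (e : Option A ≃ Option B), C.act e x = C'.act e x := by
    intro A _ x
    refine hopfOperad.induction (p := fun A _ x => ∀ (B : Type) [Finite B]
      (e : Option A ≃ Option B), C.act e x = C'.act e x) ?_ ?_ ?_ ?_ ?_ ?_ ?_ A x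
    · intro A _ h B _ e
      rw [(hC e).1, (hC' e).1]
    · intro A _ o B _ e
      rw [(hC e).2, (hC' e).2]
    · intro A B _ _ f x hx Z _ e
      rw [C.act_map, C'.act_map, hx]
    · intro A B _ _ x y hx hy Z _ e
      exact Operad.CyclicStructure.act_comp_eq hx hy Z e
    · intro A _ B _ e
      rw [map_zero, map_zero]
    · intro A _ x y hx hy B _ e
      rw [map_add, map_add, hx, hy]
    · intro A _ c x hx B _ e
      rw [map_smul, map_smul, hx]
  refine Operad.CyclicStructure.ext ?_
  funext A B _ _ e
  exact LinearMap.ext fun x => key A x B e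

/-! ### Moving the root of a tree with hairs, and the antipode -/

section HairyCyclic

open HTree TreeOperad

variable {k : Type u} [Field k] {V : Type v} [AddCommGroup V] [Module k V] {A B : Type}

/-- The old root becomes the input `b`, and the hair next to it stays next to it. At their common
vertex the cyclic order is hair, rest, old root; seen from the rest this is first the old root, then
the hair. -/
theorem HTree.act_node_hair {D : Type v} [DecidableEq B] {e : Option A ≃ Option B} {b : B}
    (he : e none = some b) (d : D) {t : HTree A D} (ht : t.IsLin) :
    (node (hair d) t).act e = (t.act e).bind (Function.update leaf b (node (leaf b) (hair d))) := by
  classical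
  refine act_unique (ht.node_hair d) ?_
  have h1 := (eqv_act e ht).bind
    (Function.update leaf (some b) (node (leaf (some b)) (hair d)) : Option B → HTree (Option B) D)
  rw [he] at h1 ⊢
  have h2 : (t.map fun a => e (some a)).bind
      (Function.update leaf (some b) (node (leaf (some b)) (hair d))) =
      t.map fun a => e (some a) := by
    refine bind_update_of_occ_eq_zero (A := Option B) (i := some b)
      (occ_map_eq_zero (fun a ha => ?_) t) _
    exact absurd (e.injective (ha.trans he.symm)) (by simp)
  have h3 : ((t.act e).map some).bind
      (Function.update leaf (some b) (node (leaf (some b)) (hair d))) =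
      ((t.act e).bind (Function.update leaf b (node (leaf b) (hair d)))).map some := by
    rw [HTree.map, HTree.map, bind_bind, bind_bind]
    congr 1
    funext b'
    by_cases hb : b' = b
    · subst hb; simp [HTree.bind]
    · simp [HTree.bind, hb]
  rw [h2, h3] at h1
  simp only [HTree.bind, Function.update_self] at h1
  rw [Function.update_of_ne (by simp)] at h1
  -- The glueing point moves through the vertex with the hair, from the edge of the old root to the
  -- edge of `t`; then the rerooting of `t` itself applies.
  exact (Eqv.swap _ _).trans ((Eqv.rot _ _ _).trans ((Eqv.swap _ _).trans ((Eqv.rot _ _ _).trans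
    ((Eqv.swap _ _).trans h1))))

variable [Finite A] [Finite B]

theorem hairyLieCyclic_act (e : Option A ≃ Option B) (t : HTree A V) (ht : t.IsLin) :
    (hairyLieCyclic k V).act e (hairyTree k t ht) = hairyTree k (t.act e) (ht.act e) :=
  act_mk e t ht

/-- After the root has moved, the hair comes second at its vertex instead of first. Antisymmetry
restores the order at the cost of a sign. -/
theorem act_unaryComp_hairLinear {e : Option A ≃ Option B} {b : B} (he : e none = some b) (v : V)
    (x : (hairyLie k V).obj A) :
    (hairyLieCyclic k V).act e ((hairyLie k V).unaryComp (hairLinear k V v) x) =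
      - (hairyLie k V).insert b (hairLinear k V v) ((hairyLieCyclic k V).act e x) := by
  classical
  have key : (hairyLieCyclic k V).act e ∘ₗ (hairyLie k V).unaryComp (hairLinear k V v) =
      - ((hairyLie k V).insert b (hairLinear k V v) ∘ₗ (hairyLieCyclic k V).act e) := by
    refine hairyLie_hom_ext fun t ht => ?_
    have hl : (node (leaf ()) (hair v) : HTree Unit V).IsLin :=
      ⟨⟨()⟩, fun a => by simp [occ]⟩
    have h1 : hairLinear k V v = - hairyTree k _ hl :=
      hairyTree_swap (isLin_leaf.node_hair v) hl
    rw [LinearMap.comp_apply, unaryComp_hairLinear, hairyLieCyclic_act, LinearMap.neg_apply,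
      LinearMap.comp_apply, hairyLieCyclic_act, h1, map_neg, LinearMap.neg_apply, neg_neg]
    refine Eq.trans (mk_congr _ ((ht.act e).bind_update hl b) (act_node_hair he v ht)) ?_
    exact (insert_mk b _ hl _ (ht.act e)).symm
  exact LinearMap.congr_fun key x

theorem antipode_ι (v : V) :
    HopfAlgebra.antipode k (TensorAlgebra.ι k v) = - TensorAlgebra.ι k v := by
  change MulOpposite.unop (tensorAntipode k V (TensorAlgebra.ι k v)) = _
  simp [tensorAntipode]

/-- On `V` the sign is that of the antipode. Turning composition at the root into insertion at `b`
reverses products, and the antipode reverses them as well, so the formula extends to `T(V)`. -/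
theorem act_unaryAction {e : Option A ≃ Option B} {b : B} (he : e none = some b)
    (h : TensorAlgebra k V) (x : (hairyLie k V).obj A) :
    (hairyLieCyclic k V).act e ((hairyLie k V).unaryAction (hairLinear k V) A h x) =
      (hairyLie k V).insert b ((hairyLie k V).unaryOfTensor (hairLinear k V)
        (HopfAlgebra.antipode k h)) ((hairyLieCyclic k V).act e x) := by
  induction h using TensorAlgebra.induction generalizing x with
  | algebraMap r =>
    rw [Algebra.algebraMap_eq_smul_one, map_smul, map_smul, map_smul, map_smul, map_one,
      HopfAlgebra.antipode_one, Operad.unaryOfTensor_one, LinearMap.smul_apply,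
      LinearMap.smul_apply, map_smul, Module.End.one_apply, Operad.insert_one]
  | ι v =>
    rw [Operad.unaryAction_ι, act_unaryComp_hairLinear he, antipode_ι, map_neg, map_neg,
      Operad.unaryOfTensor_ι, LinearMap.neg_apply]
  | add g h hg hh => simp only [map_add, LinearMap.add_apply, hg, hh]
  | mul g h hg hh =>
    rw [map_mul, Module.End.mul_apply, hg, hh, HopfAlgebra.antipode_mul_antidistrib,
      Operad.unaryOfTensor_mul, Operad.insert_unaryComp]

theorem oneAt_hairyLie (a : A) (ha : (leaf a : HTree A V).IsLin) :
    (hairyLie k V).oneAt A = hairyTree k (leaf a) ha := by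
  have hb : ∀ b, a = b := fun b => by
    have := ha.2 b; simp only [occ] at this; by_contra hne; simp [hne] at this
  let e : Unit ≃ A := ⟨fun _ => a, fun _ => (), fun _ => rfl, hb⟩
  rw [← (hairyLie k V).map_one_eq_oneAt e]
  exact map_hairyTree e (leaf ()) isLin_leaf

/-- The unit is a line without vertices, which is symmetric in its two ends. -/
theorem act_oneAt {e : Option A ≃ Option B} {b : B} (he : e none = some b)
    (hA : Nat.card A = 1) :
    (hairyLieCyclic k V).act e ((hairyLie k V).oneAt A) = (hairyLie k V).oneAt B := by
  obtain ⟨a, ha⟩ := Nat.card_eq_one_iff_exists.1 hA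
  have hea : e (some a) = none := by
    obtain ⟨r, hr⟩ := e.surjective none
    rcases r with _ | r
    · rw [he] at hr; exact absurd hr (by simp)
    · rwa [ha r] at hr
  have hl : (leaf a : HTree A V).IsLin := ⟨⟨a⟩, fun a' => if_pos (ha a').symm⟩
  have h1 : (leaf a : HTree A V).act e = leaf b := by
    refine act_unique hl ?_
    change Eqv (leaf (e none)) (leaf (e (some a))) (leaf none) (leaf (some b))
    rw [he, hea]
    exact .swap _ _
  have h2 : (leaf b : HTree B V).IsLin := h1 ▸ hl.act e
  rw [oneAt_hairyLie a hl, oneAt_hairyLie b h2, hairyLieCyclic_act]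
  exact mk_congr _ _ h1

/-- An element of `H` acts on the unit. Moving the root turns this into the insertion of its
antipode at the only input of the unit, which is the same unary operation. -/
theorem tensorHom_act (e : Option A ≃ Option B)
    (h : (algebraOperad k (TensorAlgebra k V)).obj A) :
    ((hairyLie k V).tensorHom (hairLinear k V)).app B
        ((hopfCyclic k (TensorAlgebra k V)).act e h) =
      (hairyLieCyclic k V).act e (((hairyLie k V).tensorHom (hairLinear k V)).app A h) := by
  -- If the root is fixed, both actions are relabellings of the input; the antipode occurs only when
  -- the root moves.
  rcases he : e none with _ | b
  · obtain ⟨f, rfl⟩ := Operad.exists_optionCongr e he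
    rw [Operad.CyclicStructure.act_optionCongr, Operad.CyclicStructure.act_optionCongr,
      Operad.Hom.app_map]
  by_cases hA : Nat.card A = 1
  · have hB : Nat.card B = 1 := by
      have := Nat.card_congr e
      rw [Finite.card_option, Finite.card_option] at this
      omega
    have h1 : ((hopfCyclic k (TensorAlgebra k V)).act e h).1 = HopfAlgebra.antipode k h.1 := by
      change hopfEntryAct k _ e h.1 = _
      rw [hopfEntryAct, if_neg (by simp [he])]
    rw [Operad.tensorHom_app, Operad.tensorHom_app, act_unaryAction he, act_oneAt he hA, h1]
    obtain ⟨g⟩ := Operad.nonempty_unit_equiv hB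
    have hg : g () = b := by
      obtain ⟨b', hb'⟩ := Nat.card_eq_one_iff_exists.1 hB
      rw [hb' b, hb' (g ())]
    rw [← (hairyLie k V).map_one_eq_oneAt g, ← hg, ← Operad.map_insert, Operad.insert_unit_one,
      ← Operad.map_unaryAction, Operad.unaryOfTensor_apply]
  · have h0 : h = 0 := Subtype.ext (h.2 hA)
    rw [h0]
    simp only [map_zero]

theorem lieToHairy_act (e : Option A ≃ Option B) (o : (lieOperad k).obj A) :
    (lieToHairy k V).app B ((lieCyclic k).act e o) =
      (hairyLieCyclic k V).act e ((lieToHairy k V).app A o) :=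
  TreeOperad.relabel_act (g := 0) (fun d => d.elim) e o

end HairyCyclic

/-! ### The isomorphism and the cyclic structure -/

theorem mainTheorem11 (k : Type u) [Field k] [CharZero k] (V : Type v) [AddCommGroup V]
    [Module k V] :
    (∃! C : (hopfOperad k (TensorAlgebra k V) (lieOperad k)).CyclicStructure,
      IsInducedCyclic k (TensorAlgebra k V) (lieOperad k) (lieCyclic k) C) ∧
    ∃ Φ : Operad.Iso (hopfOperad k (TensorAlgebra k V) (lieOperad k)) (hairyLie k V),
      (∀ C : (hopfOperad k (TensorAlgebra k V) (lieOperad k)).CyclicStructure,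
        IsInducedCyclic k (TensorAlgebra k V) (lieOperad k) (lieCyclic k) C →
          Φ.IsCyclic C (hairyLieCyclic k V)) ∧
      (∀ v : V, Φ.app Unit (hopfOperad.ofHopf k (TensorAlgebra k V) (lieOperad k) Unit
          (algebraOperadUnary k (TensorAlgebra.ι k v))) = treeHair k (id : V → V) v) ∧
      Φ.app Bool (hopfOperad.ofOperad k (TensorAlgebra k V) (lieOperad k) Bool
          (treeVertex k noLabels)) = treeVertex k (id : V → V) := by
  obtain ⟨Φ, hΦ, hΦ'⟩ := exists_hopfLie_hom (k := k) (V := V)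
  have hunary : ∀ h, Φ.app Unit (hopfOperad.unary k (TensorAlgebra k V) (lieOperad k) h) =
      (hairyLie k V).unaryOfTensor (hairLinear k V) h := fun h =>
    (hΦ Unit _).trans (Operad.tensorHom_unary _ _ h)
  have hhair : ∀ v, Φ.app Unit (hopfOperad.ofHopf k (TensorAlgebra k V) (lieOperad k) Unit
      (algebraOperadUnary k (TensorAlgebra.ι k v))) = treeHair k (id : V → V) v := fun v =>
    (hunary _).trans (Operad.unaryOfTensor_ι _ _ v)
  have hvertex : Φ.app Bool (hopfOperad.ofOperad k (TensorAlgebra k V) (lieOperad k) Bool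
      (treeVertex k noLabels)) = treeVertex k (id : V → V) :=
    (hΦ' Bool _).trans (lieToHairy_lieTree _ isLin_vertex)
  let F : Operad.Iso (hopfOperad k (TensorAlgebra k V) (lieOperad k)) (hairyLie k V) :=
    { app := fun A _ => LinearEquiv.ofBijective (Φ.app A) ⟨hopfLie_hom_injective hunary hΦ' A,
        hairyLie_hom_surjective Φ (fun v => ⟨_, hhair v⟩) ⟨_, hvertex⟩⟩
      app_map := Φ.app_map
      app_one := Φ.app_one
      app_comp := Φ.app_comp }
  -- The candidate is the transported structure. That it extends the given ones is checked after
  -- applying the injective `F`, where it becomes the compatibility of the two generating maps with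
  -- moving the root.
  have hC : IsInducedCyclic k (TensorAlgebra k V) (lieOperad k) (lieCyclic k)
      ((hairyLieCyclic k V).transport F) := by
    refine fun {A B} _ _ e => ⟨fun h => (F.app B).injective ?_, fun o => (F.app B).injective ?_⟩
    · rw [Operad.CyclicStructure.app_transport_act]
      change (hairyLieCyclic k V).act e (Φ.app A _) = Φ.app B _
      rw [hΦ, hΦ, tensorHom_act]
    · rw [Operad.CyclicStructure.app_transport_act]
      change (hairyLieCyclic k V).act e (Φ.app A _) = Φ.app B _
      rw [hΦ', hΦ', lieToHairy_act]
  -- By uniqueness every induced structure is the transported one, for which `F` is cyclic by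
  -- construction.
  refine ⟨⟨_, hC, fun C hC' => hC'.unique hC⟩, F, fun C hC' => ?_, hhair, hvertex⟩
  rw [hC'.unique hC]
  exact fun e a => Operad.CyclicStructure.app_transport_act _ F e a
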